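/- Let $q\in\mathbb C^{*}$ be a primitive $N$-th root of unity, $N\ge 1$. Let $\ell$ be the order of $q^2$, i.e. $\ell=N$ if $N$ is odd and $\ell=N/2$ if $N$ is even, and put $\varepsilon=-1$ if $N\equiv 2 \pmod 4$ and $\varepsilon=1$ otherwise (so $\ell=N$, $\varepsilon=1$ for odd $N$). Let $\mathrm T_q$ be the $\mathbb C$-algebra generated by $X^{\pm1},Y^{\pm1}$ with the relation $q^{-1}XY=qYX$. Put $$y_0=X^{-1},\quad y_1=Y,\quad y_2=(1+qY)X,\quad y_3=Y^{-1}+qXY^{-1}+X,\quad y_4=Y^{-1}+qY^{-1}X^{-1}$$ (indices modulo $5$; this is the orbit of $X^{-1}$ under the order $5$ automorphism $\gamma: X\mapsto Y^{-1},\ Y\mapsto(1+qY)X$ of the fraction field of $\mathrm T_q$, $\gamma(y_k)=y_{k+1}$). For integers $a\le 0\le b$ and $c\in\mathbb Z/5$ let $X_{a,b;c}=q^{-ab}\,y_k^{-a}\,y_{k+1}^{\,b}$ with $k=3c+2=(c-1)/2\in\mathbb Z/5$, so that $X_{a,b;1}=q^{-ab}X^aY^b$ and $X_{a,b;c+2}=\gamma(X_{a,b;c})$.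 These elements are the quantum canonical basis, and their linear span $\mathbb L_q\subset \mathrm T_q$ is a subalgebra. Let $\mathcal M^{\rm cyc}_{0,5}$ be the complex variety of $5$-tuples $(x_c)_{c\in\mathbb Z/5}$ of points of $\mathbb P^1$ with $x_c\ne x_{c+1}$ for all $c$, modulo $PGL_2(\mathbb C)$ (with the quotient of the Zariski topology and the sheaf of invariant regular functions), and on it consider the regular functions $$X^{\rm cl}_{a,b;c}=r(x_c,x_{c+1},x_{c+2},x_{c+3})^{a}\,r(x_c,x_{c+2},x_{c+3},x_{c+4})^{b},\qquad a\le 0\le b,$$ where $r(z_1,z_2,z_3,z_4)=\frac{(z_1-z_2)(z_3-z_4)}{(z_1-z_4)(z_2-z_3)}$. Then: 1. The center $Z$ of $\mathbb L_q$ is generated, as a $\mathbb C$-algebra, by the elements $X_{\ell a,\ell b;c}$ ($a\le 0\le b$, $c\in\mathbb Z/5$). 2. There is an isomorphism of $\mathbb C$-algebras $\varphi: Z\to\mathcal O(\mathcal M^{\rm cyc}_{0,5})$ with $\varphi(X_{\ell a,\ell b;c})=\varepsilon^{a+b+ab}X^{\rm cl}_{a,b;c}$ for all $a\le 0\le b$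 and $c$, and it identifies $\mathcal M^{\rm cyc}_{0,5}$ with the spectrum of $Z$: sending a point $p$ to $\{z\in Z:\varphi(z)(p)=0\}$ is a homeomorphism onto the maximal spectrum of $Z$, and for each $s\in Z$ the ring of regular functions on the open set $\{\varphi(s)\neq0\}$ is the localization $Z[1/s]$. 3. Via $\varphi$, the assignment $V\mapsto\mathcal O(V)\otimes_Z\mathbb L_q$ is a sheaf of algebras on $\mathcal M^{\rm cyc}_{0,5}$, and for every open $V$ its sections form an Azumaya algebra over $\mathcal O(V)$. -/

import Mathlib

open scoped TensorProduct

noncomputable section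

namespace QuantumM05

/-! ## The quantum torus -/

/-- The four generators of the quantum torus algebra. -/
inductive Gen : Type
  | X
  | Xinv
  | Y
  | Yinv

/-- The defining relations of the quantum torus algebra: `X`, `Y` are invertible and
`q⁻¹ X Y - q Y X = 0`. -/
inductive TorusRel (q : ℂˣ) : FreeAlgebra ℂ Gen → FreeAlgebra ℂ Gen → Prop
  | X_mul_Xinv : TorusRel q (FreeAlgebra.ι ℂ Gen.X * FreeAlgebra.ι ℂ Gen.Xinv) 1
  | Xinv_mul_X : TorusRel q (FreeAlgebra.ι ℂ Gen.Xinv * FreeAlgebra.ι ℂ Gen.X) 1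
  | Y_mul_Yinv : TorusRel q (FreeAlgebra.ι ℂ Gen.Y * FreeAlgebra.ι ℂ Gen.Yinv) 1
  | Yinv_mul_Y : TorusRel q (FreeAlgebra.ι ℂ Gen.Yinv * FreeAlgebra.ι ℂ Gen.Y) 1
  | comm : TorusRel q
      ((q : ℂ)⁻¹ • (FreeAlgebra.ι ℂ Gen.X * FreeAlgebra.ι ℂ Gen.Y)
        - (q : ℂ) • (FreeAlgebra.ι ℂ Gen.Y * FreeAlgebra.ι ℂ Gen.X)) 0

/-- The two-dimensional quantum torus algebra `T_q` over `ℂ`. -/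
def Torus (q : ℂˣ) : Type := RingQuot (TorusRel q)

instance (q : ℂˣ) : Ring (Torus q) := inferInstanceAs (Ring (RingQuot (TorusRel q)))

instance (q : ℂˣ) : Algebra ℂ (Torus q) :=
  inferInstanceAs (Algebra ℂ (RingQuot (TorusRel q)))

/-- The image of a generator in the quantum torus. -/
def Torus.gen (q : ℂˣ) (g : Gen) : Torus q :=
  RingQuot.mkAlgHom ℂ (TorusRel q) (FreeAlgebra.ι ℂ g)

theorem Torus.X_mul_Xinv (q : ℂˣ) : Torus.gen q Gen.X * Torus.gen q Gen.Xinv = 1 := by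
  have h := RingQuot.mkAlgHom_rel ℂ (TorusRel.X_mul_Xinv (q := q))
  simpa only [map_mul, map_one] using! h

theorem Torus.Xinv_mul_X (q : ℂˣ) : Torus.gen q Gen.Xinv * Torus.gen q Gen.X = 1 := by
  have h := RingQuot.mkAlgHom_rel ℂ (TorusRel.Xinv_mul_X (q := q))
  simpa only [map_mul, map_one] using! h

theorem Torus.Y_mul_Yinv (q : ℂˣ) : Torus.gen q Gen.Y * Torus.gen q Gen.Yinv = 1 := by
  have h := RingQuot.mkAlgHom_rel ℂ (TorusRel.Y_mul_Yinv (q := q))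
  simpa only [map_mul, map_one] using! h

theorem Torus.Yinv_mul_Y (q : ℂˣ) : Torus.gen q Gen.Yinv * Torus.gen q Gen.Y = 1 := by
  have h := RingQuot.mkAlgHom_rel ℂ (TorusRel.Yinv_mul_Y (q := q))
  simpa only [map_mul, map_one] using! h

theorem Torus.X_mul_Y (q : ℂˣ) :
    Torus.gen q Gen.X * Torus.gen q Gen.Y
      = ((q : ℂ) ^ 2) • (Torus.gen q Gen.Y * Torus.gen q Gen.X) := by
  have h := RingQuot.mkAlgHom_rel ℂ (TorusRel.comm (q := q))
  simp only [map_sub, map_smul, map_mul, map_zero] at h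
  have h' : (q : ℂ)⁻¹ • (Torus.gen q Gen.X * Torus.gen q Gen.Y)
      = (q : ℂ) • (Torus.gen q Gen.Y * Torus.gen q Gen.X) := sub_eq_zero.mp h
  have hq : (q : ℂ) ≠ 0 := q.ne_zero
  have h2 := congrArg (fun t => (q : ℂ) • t) h'
  simp only [smul_smul, mul_inv_cancel₀ hq, one_smul] at h2
  rw [h2, pow_two]

/-! ## The quantum canonical basis and the algebra `L_q` -/

/-- The five elements `y 0 = X⁻¹`, `y 1 = Y`, `y 2 = (1 + q Y) X`,
`y 3 = Y⁻¹ + q X Y⁻¹ + X`, `y 4 = Y⁻¹ + q Y⁻¹ X⁻¹` of the quantum torus.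
They are the orbit of `X⁻¹` under the order five automorphism `γ` of the fraction field given by
`X ↦ Y⁻¹`, `Y ↦ (1 + q Y) X`, with `γ (y k) = y (k + 1)`:
see `y_add_two_mul` below, which says `γᵏ⁺¹ Y = (1 + q γᵏ Y) γᵏ X`.
At `q = 1` they are `X⁻¹`, `Y`, `(1 + Y) X`, `(1 + X + X Y) / Y`, `(1 + X) / (X Y)`. -/
def y (q : ℂˣ) : ZMod 5 → Torus q :=
  ![Torus.gen q Gen.Xinv,
    Torus.gen q Gen.Y,
    (1 + (q : ℂ) • Torus.gen q Gen.Y) * Torus.gen q Gen.X,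
    Torus.gen q Gen.Yinv + (q : ℂ) • (Torus.gen q Gen.X * Torus.gen q Gen.Yinv)
      + Torus.gen q Gen.X,
    Torus.gen q Gen.Yinv + (q : ℂ) • (Torus.gen q Gen.Yinv * Torus.gen q Gen.Xinv)]

/-- The element `q^{mn} (y k)^m (y (k+1))^n`: the `k`-th shift `γᵏ` of the
`*`-invariant monomial `q^{mn} X^{-m} Y^n`. -/
def clusterMonomial (q : ℂˣ) (k : ZMod 5) (m n : ℕ) : Torus q :=
  ((q : ℂ) ^ (m * n)) • (y q k ^ m * y q (k + 1) ^ n)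

/-- The quantum canonical map on integral tropical points, given on the five cones by
the `*`-invariant versions of
`X^a Y^b`,
`((1+X)/(XY))^{-b} X^a`,
`((1+X+XY)/Y)^a ((1+X)/(XY))^{-b}`,
`((1+Y)X)^b ((1+X+XY)/Y)^{a-b}`,
`Y^{b-a} ((1+Y)X)^a`. -/
def canonicalMap (q : ℂˣ) (a b : ℤ) : Torus q :=
  if a ≤ 0 ∧ 0 ≤ b then clusterMonomial q 0 (-a).toNat b.toNat
  else if a ≤ 0 ∧ b ≤ 0 then clusterMonomial q 4 (-b).toNat (-a).toNat
  else if 0 ≤ a ∧ b ≤ 0 then clusterMonomial q 3 a.toNat (-b).toNat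
  else if 0 ≤ b ∧ b ≤ a then clusterMonomial q 2 b.toNat (a - b).toNat
  else clusterMonomial q 1 (b - a).toNat a.toNat

theorem clusterMonomial_mem_range (q : ℂˣ) (k : ZMod 5) (m n : ℕ) :
    clusterMonomial q k m n ∈ Set.range fun p : ℤ × ℤ => canonicalMap q p.1 p.2 := by
  have key : ∀ (k : ZMod 5) (m : ℕ),
      clusterMonomial q k 0 m = clusterMonomial q (k + 1) m 0 := by
    intro k m
    simp [clusterMonomial]
  have k0 := key 0
  have k1 := key 1
  have k2 := key 2
  have k3 := key 3
  have k4 := key 4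
  rw [show (0 : ZMod 5) + 1 = 1 by decide] at k0
  rw [show (1 : ZMod 5) + 1 = 2 by decide] at k1
  rw [show (2 : ZMod 5) + 1 = 3 by decide] at k2
  rw [show (3 : ZMod 5) + 1 = 4 by decide] at k3
  rw [show (4 : ZMod 5) + 1 = 0 by decide] at k4
  have h0 : ∀ m n : ℕ, canonicalMap q (-m) n = clusterMonomial q 0 m n := by
    intro m n
    simp [canonicalMap]
  have h4 : ∀ m n : ℕ, canonicalMap q (-n) (-m) = clusterMonomial q 4 m n := by
    intro m n
    rcases Nat.eq_zero_or_pos m with rfl | hm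
    · rw [k4 n]
      simpa using h0 n 0
    · unfold canonicalMap
      rw [if_neg (by omega), if_pos (by omega)]
      simp
  have h3 : ∀ m n : ℕ, canonicalMap q m (-n) = clusterMonomial q 3 m n := by
    intro m n
    rcases Nat.eq_zero_or_pos m with rfl | hm
    · rw [k3 n]
      simpa using h4 n 0
    · unfold canonicalMap
      rw [if_neg (by omega), if_neg (by omega), if_pos (by omega)]
      simp
  have h2 : ∀ m n : ℕ, canonicalMap q (m + n) m = clusterMonomial q 2 m n := by
    intro m n
    rcases Nat.eq_zero_or_pos m with rfl | hm
    · rw [k2 n]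
      simpa using h3 n 0
    · unfold canonicalMap
      rw [if_neg (by omega), if_neg (by omega), if_neg (by omega), if_pos (by omega)]
      simp
  have h1 : ∀ m n : ℕ, canonicalMap q n (m + n) = clusterMonomial q 1 m n := by
    intro m n
    rcases Nat.eq_zero_or_pos m with rfl | hm
    · rw [k1 n]
      simpa using h2 n 0
    · rcases Nat.eq_zero_or_pos n with rfl | hn
      · rw [← k0 m]
        simpa using h0 0 m
      · unfold canonicalMap
        rw [if_neg (by omega), if_neg (by omega), if_neg (by omega), if_neg (by omega)]
        simp
  have hk : k = 0 ∨ k = 1 ∨ k = 2 ∨ k = 3 ∨ k = 4 := by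
    revert k
    decide
  rcases hk with rfl | rfl | rfl | rfl | rfl
  · exact ⟨(-m, n), h0 m n⟩
  · exact ⟨(n, m + n), h1 m n⟩
  · exact ⟨(m + n, m), h2 m n⟩
  · exact ⟨(m, -n), h3 m n⟩
  · exact ⟨(-n, -m), h4 m n⟩

theorem range_canonicalMap (q : ℂˣ) :
    (Set.range fun p : ℤ × ℤ => canonicalMap q p.1 p.2)
      = Set.range fun p : ZMod 5 × ℕ × ℕ => clusterMonomial q p.1 p.2.1 p.2.2 := by
  apply Set.Subset.antisymm
  · rintro _ ⟨⟨a, b⟩, rfl⟩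
    simp only [canonicalMap]
    split_ifs
    · exact ⟨(0, _, _), rfl⟩
    · exact ⟨(4, _, _), rfl⟩
    · exact ⟨(3, _, _), rfl⟩
    · exact ⟨(2, _, _), rfl⟩
    · exact ⟨(1, _, _), rfl⟩
  · rintro _ ⟨⟨k, m, n⟩, rfl⟩
    exact clusterMonomial_mem_range q k m n

theorem Torus.relations (q : ℂˣ) {x x' y y' : Torus q}
    (hX : x * x' = 1) (hX' : x' * x = 1) (hY : y * y' = 1) (hY' : y' * y = 1)
    (h : x * y = ((q : ℂ) ^ 2) • (y * x)) :
    x' * y = ((q : ℂ) ^ 2)⁻¹ • (y * x') ∧ x * y' = ((q : ℂ) ^ 2)⁻¹ • (y' * x) ∧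
      x' * y' = ((q : ℂ) ^ 2) • (y' * x') := by
  have hq : (q : ℂ) ^ 2 ≠ 0 := pow_ne_zero 2 q.ne_zero
  have e1 : x' * y = ((q : ℂ) ^ 2)⁻¹ • (y * x') := by
    have h1 : y * x' = ((q : ℂ) ^ 2) • (x' * y) := by
      calc y * x' = x' * (x * y) * x' := by
            rw [← mul_assoc x', hX', one_mul]
        _ = ((q : ℂ) ^ 2) • (x' * y * (x * x')) := by
            rw [h]; simp only [mul_smul_comm, smul_mul_assoc, mul_assoc]
        _ = _ := by rw [hX, mul_one]
    rw [h1, smul_smul, inv_mul_cancel₀ hq, one_smul]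
  have e2 : ∀ {u : Torus q} {c : ℂ}, c ≠ 0 → u * y = c • (y * u) → u * y' = c⁻¹ • (y' * u) := by
    intro u c hc hu
    have h1 : y' * u = c • (u * y') := by
      calc y' * u = y' * (u * y) * y' := by
            rw [mul_assoc, mul_assoc, hY, mul_one]
        _ = c • (y' * y * u * y') := by
            rw [hu]; simp only [mul_smul_comm, smul_mul_assoc, mul_assoc]
        _ = _ := by rw [hY', one_mul]
    rw [h1, smul_smul, inv_mul_cancel₀ hc, one_smul]
  refine ⟨e1, e2 hq h, ?_⟩
  have := e2 (inv_ne_zero hq) e1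
  rwa [inv_inv] at this

theorem y_relations (q : ℂˣ) (k : ZMod 5) :
    y q (k + 1) * y q k = ((q : ℂ) ^ 2) • (y q k * y q (k + 1)) ∧
    y q (k + 2) * y q k = 1 + (q : ℂ) • y q (k + 1) ∧
    y q k * y q (k + 2) = 1 + ((q : ℂ)⁻¹) • y q (k + 1) := by
  have hX := Torus.X_mul_Xinv q
  have hX' := Torus.Xinv_mul_X q
  have hY := Torus.Y_mul_Yinv q
  have hY' := Torus.Yinv_mul_Y q
  have h := Torus.X_mul_Y q
  obtain ⟨h1, h2, h3⟩ := Torus.relations q hX hX' hY hY' h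
  have h0 : y q 0 = Torus.gen q Gen.Xinv := rfl
  have y1 : y q 1 = Torus.gen q Gen.Y := rfl
  have y2 : y q 2 = (1 + (q : ℂ) • Torus.gen q Gen.Y) * Torus.gen q Gen.X := rfl
  have y3 : y q 3 = Torus.gen q Gen.Yinv + (q : ℂ) • (Torus.gen q Gen.X * Torus.gen q Gen.Yinv)
      + Torus.gen q Gen.X := rfl
  have y4 : y q 4 = Torus.gen q Gen.Yinv
      + (q : ℂ) • (Torus.gen q Gen.Yinv * Torus.gen q Gen.Xinv) := rfl
  generalize Torus.gen q Gen.X = x at *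
  generalize Torus.gen q Gen.Xinv = x' at *
  generalize Torus.gen q Gen.Y = u at *
  generalize Torus.gen q Gen.Yinv = u' at *
  have aY : ∀ t, u * (u' * t) = t := fun t => by rw [← mul_assoc, hY, one_mul]
  have aY' : ∀ t, u' * (u * t) = t := fun t => by rw [← mul_assoc, hY', one_mul]
  have a0 : ∀ t, x * (u * t) = ((q : ℂ) ^ 2) • (u * (x * t)) := fun t => by
    rw [← mul_assoc, h, smul_mul_assoc, mul_assoc]
  have a1 : ∀ t, x' * (u * t) = ((q : ℂ) ^ 2)⁻¹ • (u * (x' * t)) := fun t => by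
    rw [← mul_assoc, h1, smul_mul_assoc, mul_assoc]
  have a2 : ∀ t, x * (u' * t) = ((q : ℂ) ^ 2)⁻¹ • (u' * (x * t)) := fun t => by
    rw [← mul_assoc, h2, smul_mul_assoc, mul_assoc]
  have a3 : ∀ t, x' * (u' * t) = ((q : ℂ) ^ 2) • (u' * (x' * t)) := fun t => by
    rw [← mul_assoc, h3, smul_mul_assoc, mul_assoc]
  have hq : (q : ℂ) ≠ 0 := q.ne_zero
  have hk : k = 0 ∨ k = 1 ∨ k = 2 ∨ k = 3 ∨ k = 4 := by
    revert k
    decide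
  have s1 : (0 : ZMod 5) + 1 = 1 ∧ (1 : ZMod 5) + 1 = 2 ∧ (2 : ZMod 5) + 1 = 3 ∧
    (3 : ZMod 5) + 1 = 4 ∧ (4 : ZMod 5) + 1 = 0 := by decide
  have s2 : (0 : ZMod 5) + 2 = 2 ∧ (1 : ZMod 5) + 2 = 3 ∧ (2 : ZMod 5) + 2 = 4 ∧
    (3 : ZMod 5) + 2 = 0 ∧ (4 : ZMod 5) + 2 = 1 := by decide
  obtain ⟨s10, s11, s12, s13, s14⟩ := s1
  obtain ⟨s20, s21, s22, s23, s24⟩ := s2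
  rcases hk with rfl | rfl | rfl | rfl | rfl <;>
  simp only [s10, s11, s12, s13, s14, s20, s21, s22, s23, s24, h0, y1, y2, y3, y4,
    mul_add, add_mul, mul_one, one_mul, mul_assoc, mul_smul_comm, smul_mul_assoc, smul_smul,
    smul_add, h, h1, h2, h3, a0, a1, a2, a3, hX, hX', hY, hY', aY, aY'] <;>
  refine ⟨?_, ?_, ?_⟩ <;> (try match_scalars) <;> (try trivial) <;> field_simp <;> ring

theorem y_add_one_mul (q : ℂˣ) (k : ZMod 5) :
    y q (k + 1) * y q k = ((q : ℂ) ^ 2) • (y q k * y q (k + 1)) :=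
  (y_relations q k).1

theorem y_add_two_mul (q : ℂˣ) (k : ZMod 5) :
    y q (k + 2) * y q k = 1 + (q : ℂ) • y q (k + 1) :=
  (y_relations q k).2.1

theorem y_mul_add_two (q : ℂˣ) (k : ZMod 5) :
    y q k * y q (k + 2) = 1 + ((q : ℂ)⁻¹) • y q (k + 1) :=
  (y_relations q k).2.2

/-- The linear span of the quantum canonical basis. -/
def canonicalSpan (q : ℂˣ) : Submodule ℂ (Torus q) :=
  Submodule.span ℂ (Set.range fun p : ℤ × ℤ => canonicalMap q p.1 p.2)

theorem one_mem_canonicalSpan (q : ℂˣ) : (1 : Torus q) ∈ canonicalSpan q := by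
  have h := clusterMonomial_mem_range q 0 0 0
  simp only [clusterMonomial, pow_zero, mul_one, mul_zero, one_smul] at h
  exact Submodule.subset_span h

theorem monomial_mem_canonicalSpan (q : ℂˣ) (k : ZMod 5) (m n : ℕ) :
    y q k ^ m * y q (k + 1) ^ n ∈ canonicalSpan q := by
  have h : clusterMonomial q k m n ∈ canonicalSpan q :=
    Submodule.subset_span (clusterMonomial_mem_range q k m n)
  have h2 := (canonicalSpan q).smul_mem (((q : ℂ) ^ (m * n))⁻¹) h
  rwa [clusterMonomial, smul_smul, inv_mul_cancel₀ (pow_ne_zero _ q.ne_zero), one_smul] at h2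

theorem y_add_one_mul_pow (q : ℂˣ) (k : ZMod 5) (m : ℕ) :
    y q (k + 1) * y q k ^ m = (((q : ℂ) ^ 2) ^ m) • (y q k ^ m * y q (k + 1)) := by
  induction m with
  | zero => simp
  | succ m ih =>
    rw [pow_succ, ← mul_assoc, ih, smul_mul_assoc, mul_assoc, y_add_one_mul, mul_smul_comm,
      smul_smul, ← pow_succ, mul_assoc]

theorem y_mul_add_one_pow (q : ℂˣ) (k : ZMod 5) (n : ℕ) :
    y q k * y q (k + 1) ^ n = ((((q : ℂ) ^ 2)⁻¹) ^ n) • (y q (k + 1) ^ n * y q k) := by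
  have h1 : y q k * y q (k + 1) = (((q : ℂ) ^ 2)⁻¹) • (y q (k + 1) * y q k) := by
    rw [y_add_one_mul, smul_smul, inv_mul_cancel₀ (pow_ne_zero 2 q.ne_zero), one_smul]
  induction n with
  | zero => simp
  | succ n ih =>
    rw [pow_succ, ← mul_assoc, ih, smul_mul_assoc, mul_assoc, h1, mul_smul_comm,
      smul_smul, ← pow_succ, mul_assoc]

theorem y_mul_mem_canonicalSpan (q : ℂˣ) (j : ZMod 5) (s : Torus q) (hs : s ∈ canonicalSpan q) :
    y q j * s ∈ canonicalSpan q := by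
  have hM := monomial_mem_canonicalSpan q
  have c0 : ∀ k m n, y q k * (y q k ^ m * y q (k + 1) ^ n) ∈ canonicalSpan q := by
    intro k m n
    rw [← mul_assoc, ← pow_succ']
    exact hM k _ _
  have c1 : ∀ k m n, y q (k + 1) * (y q k ^ m * y q (k + 1) ^ n) ∈ canonicalSpan q := by
    intro k m n
    rw [← mul_assoc, y_add_one_mul_pow, smul_mul_assoc, mul_assoc, ← pow_succ']
    exact (canonicalSpan q).smul_mem _ (hM k _ _)
  have c2 : ∀ k m n, y q (k + 2) * (y q k ^ m * y q (k + 1) ^ n) ∈ canonicalSpan q := by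
    intro k m n
    cases m with
    | zero =>
      have h := c1 (k + 1) n 0
      have e : k + 1 + 1 = k + 2 := by ring
      simpa [e] using h
    | succ m =>
      rw [pow_succ', mul_assoc, ← mul_assoc, y_add_two_mul, add_mul, one_mul, smul_mul_assoc]
      exact (canonicalSpan q).add_mem (hM k _ _) ((canonicalSpan q).smul_mem _ (c1 k _ _))
  have c4 : ∀ k m n, y q k * (y q (k + 1) ^ m * y q (k + 2) ^ n) ∈ canonicalSpan q := by
    intro k m n
    have e : k + 1 + 1 = k + 2 := by ring
    cases n with
    | zero => simpa using hM k 1 m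
    | succ n =>
      rw [← mul_assoc, y_mul_add_one_pow, pow_succ' (y q (k + 2)), smul_mul_assoc, mul_assoc,
        ← mul_assoc (y q k), y_mul_add_two, add_mul, one_mul, smul_mul_assoc, mul_add,
        mul_smul_comm]
      refine (canonicalSpan q).smul_mem _ ((canonicalSpan q).add_mem ?_
        ((canonicalSpan q).smul_mem _ ?_))
      · simpa [e] using hM (k + 1) m n
      · rw [← mul_assoc, ← pow_succ]
        simpa [e] using hM (k + 1) (m + 1) n
  have c3 : ∀ k m n, y q k * (y q (k + 2) ^ m * y q (k + 3) ^ n) ∈ canonicalSpan q := by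
    intro k m n
    cases m with
    | zero =>
      cases n with
      | zero => simpa using hM k 1 0
      | succ n =>
        have h := y_add_two_mul q (k + 3)
        have e : k + 3 + 2 = k := by
          rw [add_assoc, show (3 : ZMod 5) + 2 = 0 by decide, add_zero]
        have e1 : k + 3 + 1 = k + 4 := by
          rw [add_assoc, show (3 : ZMod 5) + 1 = 4 by decide]
        rw [e, e1] at h
        rw [pow_zero, one_mul, pow_succ', ← mul_assoc, h, add_mul, one_mul, smul_mul_assoc]
        refine (canonicalSpan q).add_mem ?_ ((canonicalSpan q).smul_mem _ ?_)
        · simpa using hM (k + 3) n 0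
        · have := c1 (k + 3) n 0
          simpa [e1] using this
    | succ m =>
      rw [pow_succ', mul_assoc, ← mul_assoc, y_mul_add_two, add_mul, one_mul, smul_mul_assoc]
      have e : k + 2 + 1 = k + 3 := by
        rw [add_assoc, show (2 : ZMod 5) + 1 = 3 by decide]
      refine (canonicalSpan q).add_mem ?_ ((canonicalSpan q).smul_mem _ ?_)
      · simpa [e] using hM (k + 2) m n
      · have := c4 (k + 1) m n
        have e' : k + 1 + 1 = k + 2 := by ring
        have e'' : k + 1 + 2 = k + 3 := by ring
        simpa [e', e''] using this
  refine Submodule.span_induction (p := fun s _ => y q j * s ∈ canonicalSpan q) ?_ ?_ ?_ ?_ hs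
  · intro t ht
    rw [range_canonicalMap] at ht
    obtain ⟨⟨k, m, n⟩, rfl⟩ := ht
    simp only [clusterMonomial, mul_smul_comm]
    refine (canonicalSpan q).smul_mem _ ?_
    have hj : j = k ∨ j = k + 1 ∨ j = k + 2 ∨ k = j + 2 ∨ k = j + 1 := by
      revert j k
      decide
    rcases hj with rfl | rfl | rfl | rfl | rfl
    · exact c0 _ _ _
    · exact c1 _ _ _
    · exact c2 _ _ _
    · have e : j + 2 + 1 = j + 3 := by ring
      rw [e]
      exact c3 _ _ _
    · have e : j + 1 + 1 = j + 2 := by ring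
      rw [e]
      exact c4 _ _ _
  · simp
  · intro a b _ _ ha hb
    rw [mul_add]
    exact (canonicalSpan q).add_mem ha hb
  · intro r a _ ha
    rw [mul_smul_comm]
    exact (canonicalSpan q).smul_mem _ ha

theorem mul_mem_canonicalSpan (q : ℂˣ) (s t : Torus q)
    (hs : s ∈ canonicalSpan q) (ht : t ∈ canonicalSpan q) : s * t ∈ canonicalSpan q := by
  have hpow : ∀ (j : ZMod 5) (m : ℕ) (t : Torus q), t ∈ canonicalSpan q →
      y q j ^ m * t ∈ canonicalSpan q := by
    intro j m t ht
    induction m with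
    | zero => simpa using ht
    | succ m ih =>
      rw [pow_succ', mul_assoc]
      exact y_mul_mem_canonicalSpan q j _ ih
  refine Submodule.span_induction (p := fun s _ => s * t ∈ canonicalSpan q) ?_ ?_ ?_ ?_ hs
  · intro s hs
    rw [range_canonicalMap] at hs
    obtain ⟨⟨k, m, n⟩, rfl⟩ := hs
    simp only [clusterMonomial, smul_mul_assoc, mul_assoc]
    exact (canonicalSpan q).smul_mem _ (hpow _ _ _ (hpow _ _ _ ht))
  · simp
  · intro a b _ _ ha hb
    rw [add_mul]
    exact (canonicalSpan q).add_mem ha hb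
  · intro r a _ ha
    rw [smul_mul_assoc]
    exact (canonicalSpan q).smul_mem _ ha

/-- The algebra `L_q`: the span of the image of the quantum canonical map, which is closed under
multiplication. -/
def L (q : ℂˣ) : Subalgebra ℂ (Torus q) :=
  (canonicalSpan q).toSubalgebra (one_mem_canonicalSpan q) (mul_mem_canonicalSpan q)

/-- The basis element `X_{a,b;c}` of `L_q` for `a = -m ≤ 0` and `b = n ≥ 0`, with `c` modulo `5`.
For `c = 1` it is `q^{-ab} X^a Y^b`, and `X_{a,b;c+2} = γ (X_{a,b;c})`
(note `3 * c + 2 = (c - 1) / 2` in `ZMod 5`). -/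
def basisElt (q : ℂˣ) (m n : ℕ) (c : ZMod 5) : L q :=
  ⟨clusterMonomial q (3 * c + 2) m n,
    Submodule.subset_span (clusterMonomial_mem_range q (3 * c + 2) m n)⟩

/-- An algebra as an algebra over its center. -/
instance centerAlgebra (B : Type) [Ring B] [Algebra ℂ B] : Algebra (Subalgebra.center ℂ B) B where
  algebraMap := (Subalgebra.center ℂ B).val.toRingHom
  commutes' r x := (Subalgebra.mem_center_iff.mp r.2 x).symm
  smul_def' _ _ := rfl

/-! ## The moduli space of cyclic configurations of five points -/

/-- Five cyclically ordered points on the complex projective line such that neighbours are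
distinct. -/
def Config : Type :=
  { x : ZMod 5 → Projectivization ℂ (Fin 2 → ℂ) // ∀ i, x i ≠ x (i + 1) }

/-- Homogeneous coordinates of the five points. -/
def Config.coord (x : Config) : ZMod 5 × Fin 2 → ℂ := fun p => (x.1 p.1).rep p.2

/-- `P` is multihomogeneous of multidegree `d` in the five pairs of homogeneous coordinates. -/
def IsMultihomogeneous (P : MvPolynomial (ZMod 5 × Fin 2) ℂ) (d : ZMod 5 → ℕ) : Prop :=
  MvPolynomial.IsWeightedHomogeneous
    (fun p : ZMod 5 × Fin 2 => (Pi.single p.1 1 : ZMod 5 → ℕ)) P d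

/-- The Zariski topology, as an open subset of the fifth power of the projective line. -/
instance : TopologicalSpace Config :=
  TopologicalSpace.generateFrom
    { W | ∃ (Q : MvPolynomial (ZMod 5 × Fin 2) ℂ) (d : ZMod 5 → ℕ),
      IsMultihomogeneous Q d ∧ W = { x | MvPolynomial.eval x.coord Q ≠ 0 } }

/-- Two configurations are equivalent if they differ by an element of `PGL₂(ℂ)`. -/
instance configSetoid : Setoid Config where
  r x x' := ∃ g : Matrix.ProjGenLinGroup (Fin 2) ℂ, ∀ i, x'.1 i = g • x.1 i
  iseqv :=
    { refl := fun _ => ⟨1, fun _ => (one_smul _ _).symm⟩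
      symm := fun ⟨g, h⟩ => ⟨g⁻¹, fun i => by rw [h i, inv_smul_smul]⟩
      trans := fun ⟨g, h⟩ ⟨g', h'⟩ => ⟨g' * g, fun i => by rw [h' i, h i, mul_smul]⟩ }

/-- The moduli space `M^cyc_{0,5}` of configurations of five cyclically ordered points on the
projective line with distinct neighbours: the quotient of `Config` by `PGL₂(ℂ)`. -/
def ModuliSpace : Type := Quotient configSetoid

/-- The class of a configuration. -/
def ModuliSpace.mk (x : Config) : ModuliSpace := Quotient.mk configSetoid x

/-- The Zariski topology of the moduli space is the quotient topology. -/
instance : TopologicalSpace ModuliSpace :=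
  inferInstanceAs (TopologicalSpace (Quotient configSetoid))

/-- A function on an open subset of the moduli space is regular if its pull back to the space of
configurations is, locally in the Zariski topology, a ratio of two multihomogeneous polynomials of
the same multidegree with non-vanishing denominator. -/
def IsRegular (V : TopologicalSpace.Opens ModuliSpace) (f : V → ℂ) : Prop :=
  ∀ x : Config, ModuliSpace.mk x ∈ V → ∃ W : TopologicalSpace.Opens Config, x ∈ W ∧
    ∃ (P Q : MvPolynomial (ZMod 5 × Fin 2) ℂ) (d : ZMod 5 → ℕ),
      IsMultihomogeneous P d ∧ IsMultihomogeneous Q d ∧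
      ∀ x' ∈ W, MvPolynomial.eval x'.coord Q ≠ 0 ∧
        ∀ h : ModuliSpace.mk x' ∈ V,
          f ⟨ModuliSpace.mk x', h⟩ = MvPolynomial.eval x'.coord P / MvPolynomial.eval x'.coord Q

theorem IsMultihomogeneous.mul {P Q : MvPolynomial (ZMod 5 × Fin 2) ℂ} {d e : ZMod 5 → ℕ}
    (hP : IsMultihomogeneous P d) (hQ : IsMultihomogeneous Q e) :
    IsMultihomogeneous (P * Q) (d + e) :=
  MvPolynomial.IsWeightedHomogeneous.mul hP hQ

/-- The `ℂ`-algebra of regular functions on an open subset of the moduli space. -/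
def regularFunctions (V : TopologicalSpace.Opens ModuliSpace) : Subalgebra ℂ (V → ℂ) where
  carrier := { f | IsRegular V f }
  algebraMap_mem' r := by
    intro x _
    refine ⟨⊤, trivial, MvPolynomial.C r, 1, 0,
      MvPolynomial.isWeightedHomogeneous_C _ r, MvPolynomial.isWeightedHomogeneous_one ℂ _, ?_⟩
    intro x' _
    refine ⟨by simp, fun _ => by simp⟩
  add_mem' := by
    intro f g hf hg x hx
    obtain ⟨W, hxW, P, Q, d, hP, hQ, h⟩ := hf x hx
    obtain ⟨W', hxW', P', Q', d', hP', hQ', h'⟩ := hg x hx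
    refine ⟨W ⊓ W', ⟨hxW, hxW'⟩, P * Q' + Q * P', Q * Q', d + d',
      (hP.mul hQ').add (hQ.mul hP'), hQ.mul hQ', ?_⟩
    intro x' hx'
    obtain ⟨h1, h2⟩ := h x' hx'.1
    obtain ⟨h1', h2'⟩ := h' x' hx'.2
    refine ⟨by simpa using ⟨h1, h1'⟩, fun hV => ?_⟩
    rw [Pi.add_apply, h2 hV, h2' hV]
    simp only [map_add, map_mul]
    field_simp
  mul_mem' := by
    intro f g hf hg x hx
    obtain ⟨W, hxW, P, Q, d, hP, hQ, h⟩ := hf x hx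
    obtain ⟨W', hxW', P', Q', d', hP', hQ', h'⟩ := hg x hx
    refine ⟨W ⊓ W', ⟨hxW, hxW'⟩, P * P', Q * Q', d + d', hP.mul hP', hQ.mul hQ', ?_⟩
    intro x' hx'
    obtain ⟨h1, h2⟩ := h x' hx'.1
    obtain ⟨h1', h2'⟩ := h' x' hx'.2
    refine ⟨by simpa using ⟨h1, h1'⟩, fun hV => ?_⟩
    rw [Pi.mul_apply, h2 hV, h2' hV]
    simp only [map_mul]
    field_simp

/-- Restriction of regular functions. -/
def restrict {V W : TopologicalSpace.Opens ModuliSpace} (h : V ≤ W) :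
    regularFunctions W →ₐ[ℂ] regularFunctions V where
  toFun f := ⟨fun p => f.1 ⟨p.1, h p.2⟩, fun x hx => by
    obtain ⟨U, hxU, P, Q, d, hP, hQ, hU⟩ := f.2 x (h hx)
    exact ⟨U, hxU, P, Q, d, hP, hQ, fun x' hx' =>
      ⟨(hU x' hx').1, fun hV => (hU x' hx').2 (h hV)⟩⟩⟩
  map_one' := rfl
  map_mul' _ _ := rfl
  map_zero' := rfl
  map_add' _ _ := rfl
  commutes' _ := rfl

/-- The area of the parallelogram spanned by chosen homogeneous coordinates of two points. -/
def bracket (z w : Projectivization ℂ (Fin 2 → ℂ)) : ℂ := z.rep 0 * w.rep 1 - z.rep 1 * w.rep 0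

/-- The cross-ratio `(z₁ - z₂)(z₃ - z₄) / ((z₁ - z₄)(z₂ - z₃))`; it is only used where
`z₁ ≠ z₄` and `z₂ ≠ z₃`. -/
def crossRatio (z₁ z₂ z₃ z₄ : Projectivization ℂ (Fin 2 → ℂ)) : ℂ :=
  (bracket z₁ z₂ * bracket z₃ z₄) / (bracket z₁ z₄ * bracket z₂ z₃)

/-- The function
`X_{a,b;c} = r(x_c, x_{c+1}, x_{c+2}, x_{c+3})^a r(x_c, x_{c+2}, x_{c+3}, x_{c+4})^b`
for `a = -m ≤ 0` and `b = n ≥ 0`, where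
`r(z₁, z₂, z₃, z₄)⁻¹` is written as `r(z₂, z₃, z₄, z₁)`. -/
def classicalX (m n : ℕ) (c : ZMod 5) (x : Config) : ℂ :=
  crossRatio (x.1 (c + 1)) (x.1 (c + 2)) (x.1 (c + 3)) (x.1 c) ^ m
    * crossRatio (x.1 c) (x.1 (c + 2)) (x.1 (c + 3)) (x.1 (c + 4)) ^ n

/-! ## Identification with a spectrum and sheaves of algebras -/

/-- The regular functions on an open subset `V` of the moduli space, as an algebra over a
`ℂ`-algebra `A` by means of a homomorphism from `A` to the global regular functions. -/
def Functions {A : Type} [CommRing A] [Algebra ℂ A] (_φ : A →ₐ[ℂ] regularFunctions ⊤)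
    (V : TopologicalSpace.Opens ModuliSpace) : Type :=
  regularFunctions V

section

variable {A : Type} [CommRing A] [Algebra ℂ A] (φ : A →ₐ[ℂ] regularFunctions ⊤)

instance (V : TopologicalSpace.Opens ModuliSpace) : CommRing (Functions φ V) :=
  inferInstanceAs (CommRing (regularFunctions V))

instance (V : TopologicalSpace.Opens ModuliSpace) : Algebra A (Functions φ V) :=
  RingHom.toAlgebra (S := Functions φ V) ((restrict (le_top : V ≤ ⊤)).comp φ).toRingHom

/-- Restriction, as a homomorphism of `A`-algebras. -/
def Functions.res {V W : TopologicalSpace.Opens ModuliSpace} (h : V ≤ W) :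
    Functions φ W →ₐ[A] Functions φ V :=
  { (restrict h).toRingHom with commutes' := fun _ => rfl }

/-- The homomorphism `φ` identifies the moduli space, with its Zariski topology and its sheaf of
regular functions, with the spectrum (of maximal ideals) of `A`: there is a homeomorphism such that
the maximal ideal of a point `p` consists of the elements of `A` vanishing at `p`, and the sections
over the basic open set defined by `s` are `A[1/s]`. -/
structure IdentifiesSpectrum : Prop where
  points : ∃ Φ : ModuliSpace ≃ₜ MaximalSpectrum A,
    ∀ (p : ModuliSpace) (z : A), z ∈ (Φ p).asIdeal ↔ (φ z).1 ⟨p, trivial⟩ = 0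
  sections : ∀ (s : A) (V : TopologicalSpace.Opens ModuliSpace),
    (∀ p : ModuliSpace, p ∈ V ↔ (φ s).1 ⟨p, trivial⟩ ≠ 0) →
      IsLocalization.Away s (Functions φ V)

variable (B : Type) [Ring B] [Algebra A B]

/-- The sections over `V` of the sheaf of algebras on the moduli space given by an
`A`-algebra `B`. -/
abbrev AlgebraSections (V : TopologicalSpace.Opens ModuliSpace) : Type :=
  Functions φ V ⊗[A] B

/-- Restriction of sections. -/
def AlgebraSections.res {V W : TopologicalSpace.Opens ModuliSpace} (h : V ≤ W) :
    AlgebraSections φ B W →ₐ[A] AlgebraSections φ B V :=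
  Algebra.TensorProduct.map (Functions.res φ h) (AlgHom.id A B)

/-- The assignment of `O(V) ⊗_A B` to `V` is a sheaf of algebras on the moduli space, and its
sections over every open set `V` form an Azumaya algebra over the ring of regular functions
on `V`. -/
structure IsSheafOfAzumayaAlgebras : Prop where
  existsUnique_glue : ∀ (ι : Type) (V : ι → TopologicalSpace.Opens ModuliSpace)
    (s : ∀ i, AlgebraSections φ B (V i)),
    (∀ i j, AlgebraSections.res φ B (inf_le_left : V i ⊓ V j ≤ V i) (s i)
      = AlgebraSections.res φ B (inf_le_right : V i ⊓ V j ≤ V j) (s j)) →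
    ∃! t : AlgebraSections φ B (⨆ i, V i),
      ∀ i, AlgebraSections.res φ B (le_iSup V i) t = s i
  isAzumaya : ∀ V : TopologicalSpace.Opens ModuliSpace,
    IsAzumaya (Functions φ V) (AlgebraSections φ B V)

end

end QuantumM05

end

noncomputable section

namespace QuantumM05

/-! ## Representations of the quantum torus and leading exponents -/

/-! Everything is governed by the pentagon relations. In `L_q` one has `y_{k+1} y_k = q² y_k
y_{k+1}` and `y_k y_{k+2} = 1 + q⁻¹ y_{k+1}`. When `q²` has order `l`, the powers `y_k^l` are
central, and the factorization of `1 - T^l` over the roots of unity turns the quantum relation into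
the classical one, `w_k w_{k+2} = 1 + w_{k+1}`, for `w_k = ε y_k^l`.

Center. The canonical basis element with index `(a,b)` has a coordinatewise largest exponent, namely
`(a,b)`, so the basis is independent. A central element commutes with `X` and `Y`, so only exponents
in `lℤ²` occur in it. Descent on leading exponents (`center_le_span`) writes it through the basis
elements with index in `lℤ²`, which are scalar multiples of `w_k^m w_{k+1}^n`. Such monomials span
the abstract ring of the pentagon relations, so the center is presented by these relations
(`presentedByPentagon_centralGen`). The same leading exponents at `q = 1` embed that ring in Laurent
polynomials, so it is reduced.

Geometry. Five cross-ratios of a configuration satisfy the pentagon relations by Plücker. Conversely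
a solution yields five explicit vectors whose coordinates are polynomial in it, and every
configuration is `PGL₂`-equivalent to the one so obtained. Hence points of the moduli space are
solutions, that is characters of the center, that is its maximal ideals by the Nullstellensatz. The
polynomial section converts ratios of multihomogeneous polynomials into fractions over the center;
the ideal of denominators of a regular function then gives the localization statement
(`exists_pow_mul_eq`).

Azumaya property. Where `w_k w_{k+1}` is invertible the algebra is a quantum torus, and averaging
over powers of `y_k` and `y_{k+1}` gives elements of the enveloping algebra that annihilate
commutators. The pentagon relations make these five loci cover the spectrum, so the local traces
combine to the global data `HasTraces`. These data survive base change, force the Azumaya property,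
and contain a dual basis; the latter reduces gluing of sections to gluing of regular functions. -/

/-- The algebra homomorphism from the quantum torus given by two invertible elements that
`q²`-commute. -/
theorem Torus.exists_lift (q : ℂˣ) {E : Type*} [Ring E] [Algebra ℂ E] (x x' u u' : E)
    (hx : x * x' = 1) (hx' : x' * x = 1) (hu : u * u' = 1) (hu' : u' * u = 1)
    (h : x * u = ((q : ℂ) ^ 2) • (u * x)) :
    ∃ ρ : Torus q →ₐ[ℂ] E, ρ (Torus.gen q Gen.X) = x ∧ ρ (Torus.gen q Gen.Xinv) = x' ∧
      ρ (Torus.gen q Gen.Y) = u ∧ ρ (Torus.gen q Gen.Yinv) = u' := by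
  let F : FreeAlgebra ℂ Gen →ₐ[ℂ] E := FreeAlgebra.lift ℂ
    (fun g => match g with | Gen.X => x | Gen.Xinv => x' | Gen.Y => u | Gen.Yinv => u')
  have hF : ∀ ⦃a b : FreeAlgebra ℂ Gen⦄, TorusRel q a b → F a = F b := by
    intro a b hab
    cases hab with
    | X_mul_Xinv => simpa [F] using hx
    | Xinv_mul_X => simpa [F] using hx'
    | Y_mul_Yinv => simpa [F] using hu
    | Yinv_mul_Y => simpa [F] using hu'
    | comm =>
      have e : (q : ℂ)⁻¹ * (q : ℂ) ^ 2 = q := by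
        have := q.ne_zero
        field_simp
      simp [F, h, smul_smul, e]
  let ρ : Torus q →ₐ[ℂ] E := RingQuot.liftAlgHom ℂ ⟨F, hF⟩
  have key : ∀ g, ρ (Torus.gen q g) = F (FreeAlgebra.ι ℂ g) := fun g =>
    RingQuot.liftAlgHom_mkAlgHom_apply ℂ F hF (FreeAlgebra.ι ℂ g)
  exact ⟨ρ, by simp [key, F], by simp [key, F], by simp [key, F], by simp [key, F]⟩

/-- Left multiplication by `X` on functions on the exponent lattice. -/
def opX (s : ℤ) : Module.End ℂ (ℤ × ℤ → ℂ) where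
  toFun f p := f (p.1 - s, p.2)
  map_add' _ _ := rfl
  map_smul' _ _ := rfl

/-- Left multiplication by `Y ^ s` on functions on the exponent lattice. -/
def opY (q : ℂˣ) (s : ℤ) : Module.End ℂ (ℤ × ℤ → ℂ) where
  toFun f p := (q : ℂ) ^ (-2 * s * p.1) * f (p.1, p.2 - s)
  map_add' _ _ := by ext; simp [mul_add]
  map_smul' _ _ := by ext; simp; ring

@[simp] theorem opX_apply (s : ℤ) (f : ℤ × ℤ → ℂ) (p : ℤ × ℤ) :
    opX s f p = f (p.1 - s, p.2) := rfl

@[simp] theorem opY_apply (q : ℂˣ) (s : ℤ) (f : ℤ × ℤ → ℂ) (p : ℤ × ℤ) :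
    opY q s f p = (q : ℂ) ^ (-2 * s * p.1) * f (p.1, p.2 - s) := rfl

/-- The weight in `opY` comes from `Y Xᵃ = q⁻²ᵃ Xᵃ Y`, so these operators describe left
multiplication on coefficients with respect to `XᵃYᵇ`. -/
theorem exists_rep (q : ℂˣ) : ∃ ρ : Torus q →ₐ[ℂ] Module.End ℂ (ℤ × ℤ → ℂ),
    ρ (Torus.gen q Gen.X) = opX 1 ∧ ρ (Torus.gen q Gen.Xinv) = opX (-1) ∧
      ρ (Torus.gen q Gen.Y) = opY q 1 ∧ ρ (Torus.gen q Gen.Yinv) = opY q (-1) := by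
  have hq : (q : ℂ) ≠ 0 := q.ne_zero
  apply Torus.exists_lift
  · ext f p; simp
  · ext f p; simp
  · ext f p
    simp only [Module.End.mul_apply, opY_apply, ← mul_assoc, ← zpow_add₀ hq]
    simp
  · ext f p
    simp only [Module.End.mul_apply, opY_apply, ← mul_assoc, ← zpow_add₀ hq]
    simp
  · ext f p
    simp only [Module.End.mul_apply, opY_apply, opX_apply, LinearMap.smul_apply, Pi.smul_apply,
      smul_eq_mul, ← mul_assoc, ← zpow_natCast, ← zpow_add₀ hq]
    congr 2
    push_cast
    ring

/-- The regular representation of the quantum torus on functions on the exponent lattice. -/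
def rep (q : ℂˣ) : Torus q →ₐ[ℂ] Module.End ℂ (ℤ × ℤ → ℂ) := (exists_rep q).choose

theorem rep_X (q : ℂˣ) : rep q (Torus.gen q Gen.X) = opX 1 := (exists_rep q).choose_spec.1

theorem rep_Xinv (q : ℂˣ) : rep q (Torus.gen q Gen.Xinv) = opX (-1) :=
  (exists_rep q).choose_spec.2.1

theorem rep_Y (q : ℂˣ) : rep q (Torus.gen q Gen.Y) = opY q 1 := (exists_rep q).choose_spec.2.2.1

theorem rep_Yinv (q : ℂˣ) : rep q (Torus.gen q Gen.Yinv) = opY q (-1) :=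
  (exists_rep q).choose_spec.2.2.2

/-- The indicator function of the zero exponent. -/
def delta : ℤ × ℤ → ℂ := Pi.single 0 1

/-- The coefficients of an element of the quantum torus with respect to the monomials `XᵃYᵇ`. -/
def coeffs (q : ℂˣ) : Torus q →ₗ[ℂ] (ℤ × ℤ → ℂ) :=
  (LinearMap.applyₗ delta).comp (rep q).toLinearMap

theorem coeffs_apply (q : ℂˣ) (t : Torus q) : coeffs q t = rep q t delta := rfl

/-- `g` is the coordinatewise largest element of the support of `f`. -/
def Top (f : ℤ × ℤ → ℂ) (g : ℤ × ℤ) : Prop := f g ≠ 0 ∧ ∀ h, f h ≠ 0 → h ≤ g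

/-- The operator `T` shifts coordinatewise largest exponents by `g`. -/
def HasTop (T : Module.End ℂ (ℤ × ℤ → ℂ)) (g : ℤ × ℤ) : Prop := ∀ f h, Top f h → Top (T f) (h + g)

theorem HasTop.mul {S T : Module.End ℂ (ℤ × ℤ → ℂ)} {g h : ℤ × ℤ} (hS : HasTop S g)
    (hT : HasTop T h) : HasTop (S * T) (g + h) := by
  intro f p hf
  have := hS _ _ (hT _ _ hf)
  rwa [add_assoc, add_comm h g] at this

theorem HasTop.pow {T : Module.End ℂ (ℤ × ℤ → ℂ)} {h : ℤ × ℤ} (hT : HasTop T h) (n : ℕ) :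
    HasTop (T ^ n) (n • h) := by
  induction n with
  | zero => intro f p hf; simpa using hf
  | succ n ih => rw [pow_succ, succ_nsmul]; exact ih.mul hT

theorem HasTop.smul {T : Module.End ℂ (ℤ × ℤ → ℂ)} {h : ℤ × ℤ} (hT : HasTop T h) {c : ℂ}
    (hc : c ≠ 0) : HasTop (c • T) h := by
  intro f p hf
  obtain ⟨h1, h2⟩ := hT f p hf
  refine ⟨by simpa using ⟨hc, h1⟩, fun g hg => h2 g ?_⟩
  simp only [LinearMap.smul_apply, Pi.smul_apply, smul_eq_mul, ne_eq, mul_eq_zero, not_or] at hg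
  exact hg.2

/-- The coordinatewise largest exponents of the elements `y k`. -/
def topExp : ZMod 5 → ℤ × ℤ := ![(-1, 0), (0, 1), (1, 1), (1, 0), (0, -1)]

theorem Top.eq_zero {f : ℤ × ℤ → ℂ} {g : ℤ × ℤ} (hf : Top f g) {h : ℤ × ℤ}
    (hh : g.1 < h.1 ∨ g.2 < h.2) : f h = 0 := by
  by_contra hne
  have := hf.2 h hne
  rw [Prod.le_def] at this
  omega

theorem zmod_five_cases (k : ZMod 5) : k = 0 ∨ k = 1 ∨ k = 2 ∨ k = 3 ∨ k = 4 := by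
  revert k
  decide

/-- Each `y k` has one monomial whose exponent dominates the others in both coordinates, and a
monomial acts by a translation with nonzero weights. -/
theorem hasTop_rep_y (q : ℂˣ) (k : ZMod 5) : HasTop (rep q (y q k)) (topExp k) := by
  have hq : (q : ℂ) ≠ 0 := q.ne_zero
  have hk := zmod_five_cases k
  have h0 : y q 0 = Torus.gen q Gen.Xinv := rfl
  have y1 : y q 1 = Torus.gen q Gen.Y := rfl
  have y2 : y q 2 = (1 + (q : ℂ) • Torus.gen q Gen.Y) * Torus.gen q Gen.X := rfl
  have y3 : y q 3 = Torus.gen q Gen.Yinv + (q : ℂ) • (Torus.gen q Gen.X * Torus.gen q Gen.Yinv)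
      + Torus.gen q Gen.X := rfl
  have y4 : y q 4 = Torus.gen q Gen.Yinv
      + (q : ℂ) • (Torus.gen q Gen.Yinv * Torus.gen q Gen.Xinv) := rfl
  have t0 : topExp 0 = (-1, 0) := rfl
  have t1 : topExp 1 = (0, 1) := rfl
  have t2 : topExp 2 = (1, 1) := rfl
  have t3 : topExp 3 = (1, 0) := rfl
  have t4 : topExp 4 = (0, -1) := rfl
  have hz : ∀ n : ℤ, (q : ℂ) ^ n ≠ 0 := fun n => zpow_ne_zero n hq
  rintro f ⟨a, b⟩ hf
  have hv := @Top.eq_zero f (a, b) hf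
  have hf0 := hf.1
  rcases hk with rfl | rfl | rfl | rfl | rfl
  all_goals
    simp only [h0, y1, y2, y3, y4, t0, t1, t2, t3, t4, map_add, map_mul, map_smul, map_one, rep_X,
      rep_Xinv, rep_Y, rep_Yinv]
    refine ⟨?_, ?_⟩
    · simp only [Module.End.mul_apply, LinearMap.add_apply, LinearMap.smul_apply, Pi.add_apply,
        Pi.smul_apply, opX_apply, opY_apply, Module.End.one_apply, Prod.mk_add_mk, smul_eq_mul]
      first
      | simpa [hz, hq] using hf0
      -- At the new leading exponent the lower monomials read `f` beyond its top, where it vanishes,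
      -- so no cancellation can occur.
      | (rw [hv (h := (a + 1 - 1, b + 1)) (by simp)]; simpa [hz, hq] using hf0)
      | (rw [hv (h := (a + 1, b + 0 - -1)) (by simp), hv (h := (a + 1 - 1, b + 0 - -1)) (by simp)]
         simpa [hz, hq] using hf0)
      | (rw [hv (h := (a + 0 - -1, b + -1 - -1)) (by simp)]; simpa [hz, hq] using hf0)
    · rintro ⟨c, d⟩ hcd
      by_contra hle
      apply hcd
      simp only [Prod.mk_add_mk, Prod.mk_le_mk, not_and_or, not_le] at hle
      simp only [Module.End.mul_apply, LinearMap.add_apply, LinearMap.smul_apply, Pi.add_apply,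
        Pi.smul_apply, opX_apply, opY_apply, Module.End.one_apply, smul_eq_mul]
      simp (disch := (dsimp only; omega)) only [hv, mul_zero, add_zero]

theorem top_coeffs_clusterMonomial (q : ℂˣ) (k : ZMod 5) (m n : ℕ) :
    Top (coeffs q (clusterMonomial q k m n)) (m • topExp k + n • topExp (k + 1)) := by
  have h := ((((hasTop_rep_y q k).pow m).mul ((hasTop_rep_y q (k + 1)).pow n)).smul
    (pow_ne_zero (m * n) q.ne_zero)) delta 0 ⟨by simp [delta], fun h hh => ?_⟩
  · rw [coeffs_apply, clusterMonomial, map_smul, map_mul, map_pow, map_pow]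
    simpa using h
  · by_contra hne
    apply hh
    rw [delta, Pi.single_eq_of_ne]
    rintro rfl
    exact hne le_rfl

/-- Leading exponents add, and consecutive vectors `topExp k`, `topExp (k + 1)` span the five cones
covering the lattice; the powers in `canonicalMap` are the coordinates of `(a, b)` in its cone. -/
theorem top_coeffs_canonicalMap (q : ℂˣ) (a b : ℤ) : Top (coeffs q (canonicalMap q a b)) (a, b) := by
  have s1 : (0 : ZMod 5) + 1 = 1 ∧ (1 : ZMod 5) + 1 = 2 ∧ (2 : ZMod 5) + 1 = 3 ∧
    (3 : ZMod 5) + 1 = 4 ∧ (4 : ZMod 5) + 1 = 0 := by decide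
  obtain ⟨s10, s11, s12, s13, s14⟩ := s1
  have t0 : topExp 0 = (-1, 0) := rfl
  have t1 : topExp 1 = (0, 1) := rfl
  have t2 : topExp 2 = (1, 1) := rfl
  have t3 : topExp 3 = (1, 0) := rfl
  have t4 : topExp 4 = (0, -1) := rfl
  unfold canonicalMap
  split_ifs
  all_goals
    convert top_coeffs_clusterMonomial q _ _ _ using 1
    simp only [s10, s11, s12, s13, s14, t0, t1, t2, t3, t4, Prod.smul_mk, Prod.mk_add_mk,
      Prod.mk.injEq, nsmul_eq_mul]
    refine ⟨?_, ?_⟩ <;> simp <;> omega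

/-- In a vanishing combination take a maximal index `g` with nonzero coefficient. Any other term
nonzero at `g` would have an index above `g`, so the value at `g` is a single nonzero term. -/
theorem linearIndependent_of_top {f : ℤ × ℤ → (ℤ × ℤ → ℂ)} (hf : ∀ g, Top (f g) g) :
    LinearIndependent ℂ f := by
  rw [linearIndependent_iff']
  intro S c hc
  by_contra! hne
  obtain ⟨i, hi, hci⟩ := hne
  obtain ⟨g, hg⟩ := (S.filter fun i => c i ≠ 0).exists_maximal ⟨i, by simp [hi, hci]⟩
  have hgS := hg.1
  simp only [Finset.mem_filter] at hgS
  have h := congrFun hc g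
  rw [Finset.sum_apply, Finset.sum_eq_single g] at h
  · simp [hgS.2, (hf g).1] at h
  · intro j hj hjg
    by_contra hne
    simp only [Pi.smul_apply, smul_eq_mul, mul_eq_zero, not_or] at hne
    have hle := (hf j).2 g hne.2
    exact hjg (le_antisymm (hg.2 (by simpa using ⟨hj, hne.1⟩) hle) hle)
  · intro h
    exact absurd hgS.1 h

theorem linearIndependent_canonicalMap (q : ℂˣ) :
    LinearIndependent ℂ fun p : ℤ × ℤ => canonicalMap q p.1 p.2 := by
  apply LinearIndependent.of_comp (coeffs q)
  exact linearIndependent_of_top fun g => top_coeffs_canonicalMap q g.1 g.2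

/-! ## Coefficients of central elements -/

/-- Right multiplication by `X` on functions on the exponent lattice. -/
def opXr (q : ℂˣ) : Module.End ℂ (ℤ × ℤ → ℂ) where
  toFun f p := (q : ℂ) ^ (-2 * p.2) * f (p.1 - 1, p.2)
  map_add' _ _ := by ext; simp [mul_add]
  map_smul' _ _ := by ext; simp; ring

/-- Right multiplication by `Y` on functions on the exponent lattice. -/
def opYr : Module.End ℂ (ℤ × ℤ → ℂ) where
  toFun f p := f (p.1, p.2 - 1)
  map_add' _ _ := rfl
  map_smul' _ _ := rfl

theorem Torus.adjoin_gen (q : ℂˣ) : Algebra.adjoin ℂ (Set.range (Torus.gen q)) = ⊤ := by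
  have h := FreeAlgebra.adjoin_range_ι (R := ℂ) (X := Gen)
  have h2 := congrArg (Subalgebra.map (RingQuot.mkAlgHom ℂ (TorusRel q))) h
  rw [AlgHom.map_adjoin, ← Set.range_comp, Algebra.map_top] at h2
  have h3 : (RingQuot.mkAlgHom ℂ (TorusRel q)).range = ⊤ :=
    (AlgHom.range_eq_top _).2 (RingQuot.mkAlgHom_surjective ℂ (TorusRel q))
  exact h2.trans h3

theorem commute_rep (q : ℂˣ) (T : Module.End ℂ (ℤ × ℤ → ℂ))
    (hT : ∀ g, Commute T (rep q (Torus.gen q g))) (t : Torus q) : Commute T (rep q t) := by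
  have ht : t ∈ Algebra.adjoin ℂ (Set.range (Torus.gen q)) := by
    rw [Torus.adjoin_gen]; trivial
  induction ht using Algebra.adjoin_induction with
  | mem x hx => obtain ⟨g, rfl⟩ := hx; exact hT g
  | algebraMap r =>
    rw [AlgHom.commutes]
    exact (Algebra.commutes r T).symm
  | add x y _ _ hx hy => rw [map_add]; exact hx.add_right hy
  | mul x y _ _ hx hy => rw [map_mul]; exact hx.mul_right hy

theorem commute_opXr (q : ℂˣ) (t : Torus q) : Commute (opXr q) (rep q t) := by
  have hq : (q : ℂ) ≠ 0 := q.ne_zero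
  apply commute_rep
  rintro (_ | _ | _ | _)
  all_goals
    simp only [rep_X, rep_Xinv, rep_Y, rep_Yinv]
    ext f ⟨a, b⟩
    simp only [Module.End.mul_apply, opX_apply, opY_apply, opXr, LinearMap.coe_mk, AddHom.coe_mk,
      ← mul_assoc, ← zpow_add₀ hq]
    try ring_nf

theorem commute_opYr (q : ℂˣ) (t : Torus q) : Commute opYr (rep q t) := by
  apply commute_rep
  rintro (_ | _ | _ | _)
  all_goals
    simp only [rep_X, rep_Xinv, rep_Y, rep_Yinv]
    ext f ⟨a, b⟩
    simp only [Module.End.mul_apply, opX_apply, opY_apply, opYr, LinearMap.coe_mk, AddHom.coe_mk]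
    try ring_nf

/-- The exponents of an element commuting with `X` and `Y`. -/
theorem exponent_of_central (q : ℂˣ) (t : Torus q)
    (hX : t * Torus.gen q Gen.X = Torus.gen q Gen.X * t)
    (hY : t * Torus.gen q Gen.Y = Torus.gen q Gen.Y * t) {a b : ℤ} (h : coeffs q t (a, b) ≠ 0) :
    (q : ℂ) ^ (2 * a) = 1 ∧ (q : ℂ) ^ (2 * b) = 1 := by
  have hq : (q : ℂ) ≠ 0 := q.ne_zero
  have dX : rep q (Torus.gen q Gen.X) delta = opXr q delta := by
    rw [rep_X]
    ext ⟨a, b⟩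
    by_cases hb : b = 0
    · simp [opXr, hb]
    · simp [opXr, delta, hb]
  have dY : rep q (Torus.gen q Gen.Y) delta = opYr delta := by
    rw [rep_Y]
    ext ⟨a, b⟩
    by_cases ha : a = 0
    · simp [opYr, ha]
    · simp [opYr, delta, ha]
  -- Commutation makes left and right multiplication by `X` (and by `Y`) agree on the coefficients
  -- of `t`. Comparing them at `(a + 1, b)` gives `q^(-2b) = 1`, and at `(a, b + 1)` gives `q^(-2a)
  -- = 1`.
  have eX : rep q (Torus.gen q Gen.X) (coeffs q t) = opXr q (coeffs q t) := by
    rw [coeffs_apply, ← Module.End.mul_apply, ← map_mul, ← hX, map_mul, Module.End.mul_apply, dX,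
      ← Module.End.mul_apply, ← Module.End.mul_apply, (commute_opXr q t).eq]
  have eY : rep q (Torus.gen q Gen.Y) (coeffs q t) = opYr (coeffs q t) := by
    rw [coeffs_apply, ← Module.End.mul_apply, ← map_mul, ← hY, map_mul, Module.End.mul_apply, dY,
      ← Module.End.mul_apply, ← Module.End.mul_apply, (commute_opYr q t).eq]
  have e1 := congrFun eX (a + 1, b)
  have e2 := congrFun eY (a, b + 1)
  rw [rep_X] at e1
  rw [rep_Y] at e2
  simp only [opX_apply, opXr, LinearMap.coe_mk, AddHom.coe_mk, add_sub_cancel_right] at e1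
  simp only [opY_apply, opYr, LinearMap.coe_mk, AddHom.coe_mk, add_sub_cancel_right] at e2
  have f1 := mul_right_cancel₀ h ((one_mul _).trans e1)
  have f2 := mul_right_cancel₀ h (e2.trans (one_mul _).symm)
  refine ⟨?_, ?_⟩
  · rw [← inv_inj, ← zpow_neg, inv_one, ← f2]
    ring_nf
  · rw [← inv_inj, ← zpow_neg, inv_one, f1]
    ring_nf

/-! ## Powers of the cluster elements at a root of unity -/

/-- The cone and the coordinates of an integral tropical point. -/
def coneCoord (a b : ℤ) : ZMod 5 × ℕ × ℕ :=
  if a ≤ 0 ∧ 0 ≤ b then (0, (-a).toNat, b.toNat)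
  else if a ≤ 0 ∧ b ≤ 0 then (4, (-b).toNat, (-a).toNat)
  else if 0 ≤ a ∧ b ≤ 0 then (3, a.toNat, (-b).toNat)
  else if 0 ≤ b ∧ b ≤ a then (2, b.toNat, (a - b).toNat)
  else (1, (b - a).toNat, a.toNat)

theorem canonicalMap_eq (q : ℂˣ) (a b : ℤ) : canonicalMap q a b =
    clusterMonomial q (coneCoord a b).1 (coneCoord a b).2.1 (coneCoord a b).2.2 := by
  unfold canonicalMap coneCoord
  split_ifs <;> rfl

theorem coneCoord_mul {l : ℕ} (hl : 0 < l) (a b : ℤ) : coneCoord (l * a) (l * b) =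
    ((coneCoord a b).1, l * (coneCoord a b).2.1, l * (coneCoord a b).2.2) := by
  have hl' : (0 : ℤ) < l := by exact_mod_cast hl
  have e : ∀ x : ℤ, ((l : ℤ) * x).toNat = l * x.toNat := by
    intro x
    rcases le_total 0 x with hx | hx
    · zify
      rw [Int.toNat_of_nonneg hx, Int.toNat_of_nonneg (by positivity)]
    · rw [Int.toNat_of_nonpos hx, Int.toNat_of_nonpos (mul_nonpos_of_nonneg_of_nonpos hl'.le hx),
        mul_zero]
  have p1 : ∀ x : ℤ, (l : ℤ) * x ≤ 0 ↔ x ≤ 0 := fun x => by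
    constructor <;> intro h <;> nlinarith
  have p2 : ∀ x : ℤ, 0 ≤ (l : ℤ) * x ↔ 0 ≤ x := fun x => mul_nonneg_iff_of_pos_left hl'
  have p3 : (l : ℤ) * b ≤ l * a ↔ b ≤ a := mul_le_mul_iff_right₀ hl'
  unfold coneCoord
  simp only [p1, p2, p3]
  split_ifs <;> simp only [← mul_neg, ← mul_sub, e]

/-- A boundary ray belongs to two cones, while `coneCoord` selects only one of them. The hypothesis
`hf` identifies the two descriptions, so every triple is reached up to this ambiguity. -/
theorem exists_coneCoord {α : Type*} (f : ZMod 5 → ℕ → ℕ → α)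
    (hf : ∀ k m, f k 0 m = f (k + 1) m 0) (k : ZMod 5) (m n : ℕ) :
    ∃ a b : ℤ, f k m n = f (coneCoord a b).1 (coneCoord a b).2.1 (coneCoord a b).2.2 := by
  have k0 := hf 0
  have k1 := hf 1
  have k2 := hf 2
  have k3 := hf 3
  have k4 := hf 4
  rw [show (0 : ZMod 5) + 1 = 1 by decide] at k0
  rw [show (1 : ZMod 5) + 1 = 2 by decide] at k1
  rw [show (2 : ZMod 5) + 1 = 3 by decide] at k2
  rw [show (3 : ZMod 5) + 1 = 4 by decide] at k3
  rw [show (4 : ZMod 5) + 1 = 0 by decide] at k4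
  have c0 : ∀ m n : ℕ, ∃ a b : ℤ, f 0 m n = f (coneCoord a b).1 (coneCoord a b).2.1
      (coneCoord a b).2.2 := fun m n => ⟨-m, n, by simp [coneCoord]⟩
  have c4 : ∀ m n : ℕ, ∃ a b : ℤ, f 4 m n = f (coneCoord a b).1 (coneCoord a b).2.1
      (coneCoord a b).2.2 := by
    intro m n
    rcases Nat.eq_zero_or_pos m with rfl | hm
    · rw [k4 n]; exact c0 n 0
    · refine ⟨-n, -m, ?_⟩
      unfold coneCoord
      rw [if_neg (by omega), if_pos (by omega)]
      simp
  have c3 : ∀ m n : ℕ, ∃ a b : ℤ, f 3 m n = f (coneCoord a b).1 (coneCoord a b).2.1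
      (coneCoord a b).2.2 := by
    intro m n
    rcases Nat.eq_zero_or_pos m with rfl | hm
    · rw [k3 n]; exact c4 n 0
    · refine ⟨m, -n, ?_⟩
      unfold coneCoord
      rw [if_neg (by omega), if_neg (by omega), if_pos (by omega)]
      simp
  have c2 : ∀ m n : ℕ, ∃ a b : ℤ, f 2 m n = f (coneCoord a b).1 (coneCoord a b).2.1
      (coneCoord a b).2.2 := by
    intro m n
    rcases Nat.eq_zero_or_pos m with rfl | hm
    · rw [k2 n]; exact c3 n 0
    · refine ⟨m + n, m, ?_⟩
      unfold coneCoord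
      rw [if_neg (by omega), if_neg (by omega), if_neg (by omega), if_pos (by omega)]
      simp
  have c1 : ∀ m n : ℕ, ∃ a b : ℤ, f 1 m n = f (coneCoord a b).1 (coneCoord a b).2.1
      (coneCoord a b).2.2 := by
    intro m n
    rcases Nat.eq_zero_or_pos m with rfl | hm
    · rw [k1 n]; exact c2 n 0
    · rcases Nat.eq_zero_or_pos n with rfl | hn
      · rw [← k0 m]; exact c0 0 m
      · refine ⟨n, m + n, ?_⟩
        unfold coneCoord
        rw [if_neg (by omega), if_neg (by omega), if_neg (by omega), if_neg (by omega)]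
        simp
  have hk := zmod_five_cases k
  rcases hk with rfl | rfl | rfl | rfl | rfl
  exacts [c0 m n, c1 m n, c2 m n, c3 m n, c4 m n]

theorem commute_pow_add_one {q : ℂˣ} {l : ℕ} (h : ((q : ℂ) ^ 2) ^ l = 1) (k : ZMod 5) :
    Commute (y q k ^ l) (y q (k + 1)) := by
  have := y_add_one_mul_pow q k l
  rw [h, one_smul] at this
  exact this.symm

theorem commute_add_one_pow {q : ℂˣ} {l : ℕ} (h : ((q : ℂ) ^ 2) ^ l = 1) (k : ZMod 5) :
    Commute (y q (k + 1) ^ l) (y q k) := by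
  have := y_mul_add_one_pow q k l
  rw [inv_pow, h, inv_one, one_smul] at this
  exact this.symm

/-- With `l = n + 1`, splitting off one factor leaves `y_k^n (1 + c y_{k+1})` on both sides, with `c
= q⁻¹` on the left and `c = q · q^(2n)` on the right. These agree because `q^(2l) = 1`. -/
theorem commute_pow_add_two {q : ℂˣ} {l : ℕ} (hl : 0 < l) (h : ((q : ℂ) ^ 2) ^ l = 1)
    (k : ZMod 5) : Commute (y q k ^ l) (y q (k + 2)) := by
  obtain ⟨n, rfl⟩ : ∃ n, l = n + 1 := ⟨l - 1, by omega⟩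
  have hq : (q : ℂ) ≠ 0 := q.ne_zero
  have e : (q : ℂ) * ((q : ℂ) ^ 2) ^ n = (q : ℂ)⁻¹ := by
    apply eq_inv_of_mul_eq_one_left
    rw [← h]
    ring
  change y q k ^ (n + 1) * y q (k + 2) = y q (k + 2) * y q k ^ (n + 1)
  rw [pow_succ, mul_assoc, y_mul_add_two, ← pow_succ, pow_succ', ← mul_assoc, y_add_two_mul,
    add_mul, one_mul, smul_mul_assoc, y_add_one_mul_pow, smul_smul, e, mul_add, mul_one,
    mul_smul_comm]

theorem commute_add_two_pow {q : ℂˣ} {l : ℕ} (hl : 0 < l) (h : ((q : ℂ) ^ 2) ^ l = 1)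
    (k : ZMod 5) : Commute (y q (k + 2) ^ l) (y q k) := by
  obtain ⟨n, rfl⟩ : ∃ n, l = n + 1 := ⟨l - 1, by omega⟩
  have hq : (q : ℂ) ≠ 0 := q.ne_zero
  have e : (q : ℂ)⁻¹ * (((q : ℂ) ^ 2)⁻¹) ^ n = (q : ℂ) := by
    have h' : ((q : ℂ) ^ 2) ^ n * (q : ℂ) ^ 2 = 1 := by rw [← pow_succ, h]
    rw [inv_pow, ← mul_inv]
    apply inv_eq_of_mul_eq_one_right
    rw [← h']
    ring
  have e2 : k + 1 + 1 = k + 2 := by ring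
  change y q (k + 2) ^ (n + 1) * y q k = y q k * y q (k + 2) ^ (n + 1)
  have h2 := y_mul_add_one_pow q (k + 1) n
  rw [e2] at h2
  rw [pow_succ, mul_assoc, y_add_two_mul, ← pow_succ, pow_succ', ← mul_assoc, y_mul_add_two,
    add_mul, one_mul, smul_mul_assoc, h2, smul_smul, e, mul_add, mul_one, mul_smul_comm]

theorem commute_pow_y {q : ℂˣ} {l : ℕ} (hl : 0 < l) (h : ((q : ℂ) ^ 2) ^ l = 1) (j k : ZMod 5) :
    Commute (y q j ^ l) (y q k) := by
  have hj : j = k ∨ k = j + 1 ∨ j = k + 1 ∨ k = j + 2 ∨ j = k + 2 := by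
    revert j k
    decide
  rcases hj with rfl | rfl | rfl | rfl | rfl
  · exact (Commute.refl _).pow_left l
  · exact commute_pow_add_one h _
  · exact commute_add_one_pow h _
  · exact commute_pow_add_two hl h _
  · exact commute_add_two_pow hl h _

-- The innermost pair contributes `1 + q⁻¹ y_{k+1}`; moving its `y_{k+1}` to the right past
-- `y_{k+2}^n` costs `q^(-2n)`, which is the factor with `j = n`.
open Polynomial in
theorem y_pow_mul_y_pow (q : ℂˣ) (k : ZMod 5) (n : ℕ) :
    y q k ^ n * y q (k + 2) ^ n =
      aeval (y q (k + 1)) (∏ j ∈ Finset.range n, (1 + C (((q : ℂ)⁻¹) * (((q : ℂ) ^ 2)⁻¹) ^ j) * X)) := by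
  induction n with
  | zero => simp
  | succ n ih =>
    have e2 : k + 1 + 1 = k + 2 := by ring
    have h2 := y_mul_add_one_pow q (k + 1) n
    rw [e2] at h2
    rw [Finset.prod_range_succ, map_mul, ← ih, pow_succ (y q k), pow_succ' (y q (k + 2)), mul_assoc,
      ← mul_assoc (y q k), y_mul_add_two, add_mul, one_mul, smul_mul_assoc, h2, smul_smul, mul_assoc]
    congr 1
    rw [map_add, map_one, map_mul, aeval_C, aeval_X, mul_add, mul_one, Algebra.smul_def,
      ← mul_assoc, ← mul_assoc, Algebra.commutes]

-- This is the factorization of `1^l - (-sX)^l` over the `l`-th roots of unity, enumerated as powers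
-- of `ζ` inside `ℂ[X]`.
open Polynomial in
theorem prod_one_add {ζ : ℂ} {l : ℕ} (hl : 0 < l) (hζ : IsPrimitiveRoot ζ l) (s : ℂ) :
    ∏ j ∈ Finset.range l, (1 + C (s * ζ ^ j) * X) = 1 - C ((-s) ^ l) * X ^ l := by
  have h := (hζ.map_of_injective (C_injective (R := ℂ))).pow_sub_pow_eq_prod_sub_mul
    (1 : ℂ[X]) (C (-s) * X) hl
  rw [one_pow, mul_pow, ← C_pow] at h
  rw [h]
  have h2 := (hζ.map_of_injective (C_injective (R := ℂ)))
  symm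
  have : Polynomial.nthRootsFinset l (1 : ℂ[X]) = (Finset.range l).image (fun j => C ζ ^ j) := by
    ext x
    rw [mem_nthRootsFinset hl, Finset.mem_image]
    constructor
    · intro hx
      have : NeZero l := ⟨hl.ne'⟩
      obtain ⟨i, hi, hi'⟩ := h2.eq_pow_of_pow_eq_one hx
      exact ⟨i, by simpa using hi, hi'⟩
    · rintro ⟨i, -, rfl⟩
      rw [← pow_mul, mul_comm, pow_mul, h2.pow_eq_one, one_pow]
  rw [this, Finset.prod_image]
  · refine Finset.prod_congr rfl fun j _ => ?_
    simp only [C_mul, C_neg, C_pow]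
    ring
  · intro i hi j hj hij
    exact h2.pow_inj (by simpa using hi) (by simpa using hj) hij

/-- The product of linear factors collapses to `1 - (-q⁻¹)^l y_{k+1}^l`, and `(-q⁻¹)^l = -ε` because
`ε` is its own inverse. This is where the sign `ε` enters. -/
theorem y_pow_mul_y_pow_eq {q : ℂˣ} {l : ℕ} (hl : 0 < l) (hq2 : IsPrimitiveRoot ((q : ℂ) ^ 2) l)
    {ε : ℂ} (hε : (-(q : ℂ)) ^ l = -ε) (hεε : ε * ε = 1) (k : ZMod 5) :
    y q k ^ l * y q (k + 2) ^ l = 1 + ε • y q (k + 1) ^ l := by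
  rw [y_pow_mul_y_pow, prod_one_add hl hq2.inv]
  have hε' : ε⁻¹ = ε := inv_eq_of_mul_eq_one_left hεε
  have : (-(q : ℂ)⁻¹) ^ l = -ε := by
    rw [← inv_neg, inv_pow, hε, inv_neg, hε']
  simp [this, Algebra.smul_def]

/-! ## The center -/

theorem y_mem (q : ℂˣ) (k : ZMod 5) : y q k ∈ L q := by
  have := monomial_mem_canonicalSpan q k 1 0
  rwa [pow_one, pow_zero, mul_one] at this

/-- The element `y k` of `L_q`. -/
def yL (q : ℂˣ) (k : ZMod 5) : L q := ⟨y q k, y_mem q k⟩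

theorem adjoin_yL (q : ℂˣ) : Algebra.adjoin ℂ (Set.range (yL q)) = ⊤ := by
  rw [eq_top_iff]
  rintro ⟨s, hs⟩ -
  have h : s ∈ (Algebra.adjoin ℂ (Set.range (yL q))).map (L q).val := by
    have hs' : s ∈ canonicalSpan q := hs
    rw [canonicalSpan, range_canonicalMap] at hs'
    refine Submodule.span_le (p := Subalgebra.toSubmodule
      ((Algebra.adjoin ℂ (Set.range (yL q))).map (L q).val)) |>.2 ?_ hs'
    rintro _ ⟨⟨k, m, n⟩, rfl⟩
    have hk : ∀ k, y q k ∈ (Algebra.adjoin ℂ (Set.range (yL q))).map (L q).val := fun k =>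
      ⟨yL q k, Algebra.subset_adjoin ⟨k, rfl⟩, rfl⟩
    exact Subalgebra.smul_mem _ (mul_mem (pow_mem (hk _) _) (pow_mem (hk _) _)) _
  obtain ⟨t, ht, rfl⟩ := h
  exact ht

theorem mem_center_of_commute {q : ℂˣ} {z : L q} (h : ∀ k, Commute z (yL q k)) :
    z ∈ Subalgebra.center ℂ (L q) := by
  rw [Subalgebra.mem_center_iff]
  intro b
  have hb : b ∈ Algebra.adjoin ℂ (Set.range (yL q)) := by rw [adjoin_yL]; trivial
  change Commute b z
  induction hb using Algebra.adjoin_induction with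
  | mem x hx => obtain ⟨k, rfl⟩ := hx; exact (h k).symm
  | algebraMap r => exact Algebra.commutes r z
  | add x y _ _ hx hy => exact hx.add_left hy
  | mul x y _ _ hx hy => exact hx.mul_left hy

theorem yL_pow_mem_center {q : ℂˣ} {l : ℕ} (hl : 0 < l) (h : ((q : ℂ) ^ 2) ^ l = 1) (k : ZMod 5) :
    yL q k ^ l ∈ Subalgebra.center ℂ (L q) :=
  mem_center_of_commute fun j => Subtype.ext (commute_pow_y hl h k j)

theorem basisElt_eq (q : ℂˣ) (m n : ℕ) (c : ZMod 5) : basisElt q m n c =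
    ((q : ℂ) ^ (m * n)) • (yL q (3 * c + 2) ^ m * yL q (3 * c + 2 + 1) ^ n) := rfl

theorem basisElt_mem_center {q : ℂˣ} {l : ℕ} (hl : 0 < l) (h : ((q : ℂ) ^ 2) ^ l = 1) (m n : ℕ)
    (c : ZMod 5) : basisElt q (l * m) (l * n) c ∈ Subalgebra.center ℂ (L q) := by
  rw [basisElt_eq, pow_mul (yL q (3 * c + 2)), pow_mul (yL q (3 * c + 2 + 1))]
  have h1 := (Subalgebra.center ℂ (L q)).pow_mem (yL_pow_mem_center hl h (3 * c + 2)) m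
  have h2 := (Subalgebra.center ℂ (L q)).pow_mem (yL_pow_mem_center hl h (3 * c + 2 + 1)) n
  exact (Subalgebra.center ℂ (L q)).smul_mem ((Subalgebra.center ℂ (L q)).mul_mem h1 h2) _

theorem coe_basisElt (q : ℂˣ) (m n : ℕ) (k : ZMod 5) :
    (basisElt q m n (2 * k + 1) : Torus q) = clusterMonomial q k m n := by
  have : 3 * (2 * k + 1) + 2 = k := by
    revert k
    decide
  simp only [basisElt, this]

/-- Commuting with `y 0 = X⁻¹` means commuting with `X`, and `y 1 = Y`; so `exponent_of_central`
applies although `X` itself is not assumed to lie in `L q`. -/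
theorem exponent_of_mem_center {q : ℂˣ} {l : ℕ} (hq2 : IsPrimitiveRoot ((q : ℂ) ^ 2) l) {z : L q}
    (hz : z ∈ Subalgebra.center ℂ (L q)) {g : ℤ × ℤ} (hg : coeffs q z g ≠ 0) :
    (l : ℤ) ∣ g.1 ∧ (l : ℤ) ∣ g.2 := by
  have hy : ∀ k, (z : Torus q) * y q k = y q k * z := fun k =>
    (congrArg Subtype.val (Subalgebra.mem_center_iff.1 hz (yL q k))).symm
  have hX : (z : Torus q) * Torus.gen q Gen.X = Torus.gen q Gen.X * z := by
    have h0 : (z : Torus q) * Torus.gen q Gen.Xinv = Torus.gen q Gen.Xinv * z := hy 0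
    calc (z : Torus q) * Torus.gen q Gen.X
        = Torus.gen q Gen.X * (Torus.gen q Gen.Xinv * z) * Torus.gen q Gen.X := by
          rw [← mul_assoc, Torus.X_mul_Xinv, one_mul]
      _ = Torus.gen q Gen.X * z * (Torus.gen q Gen.Xinv * Torus.gen q Gen.X) := by
          rw [← h0]; simp only [mul_assoc]
      _ = _ := by rw [Torus.Xinv_mul_X, mul_one]
  have key := exponent_of_central q z hX (hy 1) (a := g.1) (b := g.2) hg
  simp only [zpow_mul] at key
  exact ⟨(hq2.zpow_eq_one_iff_dvd _).1 (by exact_mod_cast key.1),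
    (hq2.zpow_eq_one_iff_dvd _).1 (by exact_mod_cast key.2)⟩

/-- Suppose the canonical expansion of `z` uses indices outside `lℤ²`, and let `g` be a maximal one.
Other such indices do not contribute at exponent `g` by maximality, and indices in `lℤ²` do not
because their basis elements are central. So `z` has a nonzero coefficient at `g`, which centrality
forbids. -/
theorem center_le_span {q : ℂˣ} {l : ℕ} (hl : 0 < l) (hq2 : IsPrimitiveRoot ((q : ℂ) ^ 2) l)
    {z : L q} (hz : z ∈ Subalgebra.center ℂ (L q)) :
    z ∈ Submodule.span ℂ (Set.range fun p : ZMod 5 × ℕ × ℕ =>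
      basisElt q (l * p.2.1) (l * p.2.2) (2 * p.1 + 1)) := by
  classical
  obtain ⟨c, hc⟩ := (Finsupp.mem_span_range_iff_exists_finsupp).1 z.2
  have hcan : ∀ g : ℤ × ℤ, (l : ℤ) ∣ g.1 ∧ (l : ℤ) ∣ g.2 → ∃ p : ZMod 5 × ℕ × ℕ,
      (basisElt q (l * p.2.1) (l * p.2.2) (2 * p.1 + 1) : Torus q) = canonicalMap q g.1 g.2 := by
    rintro ⟨_, _⟩ ⟨⟨a, rfl⟩, ⟨b, rfl⟩⟩
    refine ⟨coneCoord a b, ?_⟩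
    rw [coe_basisElt, canonicalMap_eq, coneCoord_mul hl]
  have hsupp : ∀ g ∈ c.support, (l : ℤ) ∣ g.1 ∧ (l : ℤ) ∣ g.2 := by
    by_contra! hne
    obtain ⟨i, hi, hci⟩ := hne
    obtain ⟨g, hg⟩ := (c.support.filter fun i => ¬ ((l : ℤ) ∣ i.1 ∧ (l : ℤ) ∣ i.2)).exists_maximal
      ⟨i, by simpa using ⟨by simpa using hi, hci⟩⟩
    have hgS : g ∈ c.support.filter _ := hg.1
    rw [Finset.mem_filter] at hgS
    apply hgS.2
    apply exponent_of_mem_center hq2 hz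
    rw [← hc, Finsupp.sum, map_sum, Finset.sum_apply, Finset.sum_eq_single g]
    · have h1 := (top_coeffs_canonicalMap q g.1 g.2).1
      simpa using ⟨by simpa using hgS.1, h1⟩
    · intro j hj hjg
      by_contra hne
      simp only [map_smul, Pi.smul_apply, smul_eq_mul, mul_eq_zero, not_or] at hne
      by_cases hjl : (l : ℤ) ∣ j.1 ∧ (l : ℤ) ∣ j.2
      · obtain ⟨p, hp⟩ := hcan j hjl
        rw [← hp] at hne
        exact hgS.2 (exponent_of_mem_center hq2
          (basisElt_mem_center hl hq2.pow_eq_one _ _ _) hne.2)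
      · have hle := (top_coeffs_canonicalMap q j.1 j.2).2 g hne.2
        exact hjg (le_antisymm (hg.2 (Finset.mem_filter.2 ⟨hj, hjl⟩) hle) hle)
    · intro h
      exact absurd hgS.1 h
  have hz' : z = ∑ g ∈ c.support.attach, c g • (⟨canonicalMap q g.1.1 g.1.2,
      Submodule.subset_span ⟨g.1, rfl⟩⟩ : L q) := by
    apply Subtype.ext
    rw [← hc, Finsupp.sum, ← Finset.sum_attach]
    simp
  rw [hz']
  refine Submodule.sum_mem _ fun g _ => Submodule.smul_mem _ _ (Submodule.subset_span ?_)
  obtain ⟨p, hp⟩ := hcan g (hsupp g g.2)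
  exact ⟨p, Subtype.ext hp⟩

theorem center_eq_adjoin {q : ℂˣ} {l : ℕ} (hl : 0 < l) (hq2 : IsPrimitiveRoot ((q : ℂ) ^ 2) l) :
    Subalgebra.center ℂ (L q) = Algebra.adjoin ℂ
      { z | ∃ (m n : ℕ) (c : ZMod 5), z = basisElt q (l * m) (l * n) c } := by
  apply le_antisymm
  · intro z hz
    refine Submodule.span_le (p := Subalgebra.toSubmodule (Algebra.adjoin ℂ
      { z | ∃ (m n : ℕ) (c : ZMod 5), z = basisElt q (l * m) (l * n) c })) |>.2 ?_
      (center_le_span hl hq2 hz)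
    rintro _ ⟨p, rfl⟩
    exact Algebra.subset_adjoin ⟨_, _, _, rfl⟩
  · rw [Algebra.adjoin_le_iff]
    rintro _ ⟨m, n, c, rfl⟩
    exact basisElt_mem_center hl hq2.pow_eq_one m n c

/-! ## The pentagon ring -/

/-- The pentagon relations. -/
def IsPentagon {A : Type*} [CommRing A] (w : ZMod 5 → A) : Prop :=
  ∀ k, w k * w (k + 2) = 1 + w (k + 1)

theorem IsPentagon.map {A B : Type*} [CommRing A] [CommRing B] [Algebra ℂ A] [Algebra ℂ B]
    {w : ZMod 5 → A} (hw : IsPentagon w) (f : A →ₐ[ℂ] B) : IsPentagon fun k => f (w k) := by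
  intro k
  rw [← map_mul, hw k, map_add, map_one]

/-- The ideal generated by the pentagon relations. -/
def pentagonIdeal : Ideal (MvPolynomial (ZMod 5) ℂ) :=
  Ideal.span (Set.range fun k => MvPolynomial.X k * MvPolynomial.X (k + 2)
    - (1 + MvPolynomial.X (k + 1)))

/-- The algebra presented by the pentagon relations. -/
abbrev PentagonRing : Type := MvPolynomial (ZMod 5) ℂ ⧸ pentagonIdeal

/-- The generators of the pentagon ring. -/
def PentagonRing.gen (k : ZMod 5) : PentagonRing := Ideal.Quotient.mkₐ ℂ pentagonIdeal (.X k)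

theorem PentagonRing.isPentagon : IsPentagon PentagonRing.gen := by
  intro k
  have h : Ideal.Quotient.mkₐ ℂ pentagonIdeal (MvPolynomial.X k * MvPolynomial.X (k + 2)
      - (1 + MvPolynomial.X (k + 1))) = 0 :=
    Ideal.Quotient.eq_zero_iff_mem.2 (Ideal.subset_span ⟨k, rfl⟩)
  rw [map_sub, map_mul, map_add, map_one, sub_eq_zero] at h
  exact h

theorem PentagonRing.adjoin_gen : Algebra.adjoin ℂ (Set.range PentagonRing.gen) = ⊤ := by
  have h2 := congrArg (Subalgebra.map (Ideal.Quotient.mkₐ ℂ pentagonIdeal))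
    (MvPolynomial.adjoin_range_X (R := ℂ) (σ := ZMod 5))
  rw [AlgHom.map_adjoin, ← Set.range_comp, Algebra.map_top] at h2
  exact h2.trans ((AlgHom.range_eq_top _).2 (Ideal.Quotient.mkₐ_surjective ℂ _))

theorem PentagonRing.exists_lift {A : Type*} [CommRing A] [Algebra ℂ A] {w : ZMod 5 → A}
    (hw : IsPentagon w) : ∃ f : PentagonRing →ₐ[ℂ] A, ∀ k, f (PentagonRing.gen k) = w k := by
  have hI : ∀ a ∈ pentagonIdeal, MvPolynomial.aeval w a = 0 := by
    intro a ha
    have : pentagonIdeal ≤ RingHom.ker (MvPolynomial.aeval (R := ℂ) w) := by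
      rw [pentagonIdeal, Ideal.span_le]
      rintro _ ⟨k, rfl⟩
      simp [RingHom.mem_ker, hw k]
    exact this ha
  refine ⟨Ideal.Quotient.liftₐ pentagonIdeal (MvPolynomial.aeval w) hI, fun k => ?_⟩
  exact MvPolynomial.aeval_X w k

/-! ### Straightening into monomials in two neighbouring generators -/

section span

variable {A : Type*} [CommRing A] [Algebra ℂ A]

/-- The span of the monomials in two neighbouring elements. -/
def monomialSpan (w : ZMod 5 → A) : Submodule ℂ A :=
  Submodule.span ℂ (Set.range fun p : ZMod 5 × ℕ × ℕ => w p.1 ^ p.2.1 * w (p.1 + 1) ^ p.2.2)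

theorem monomial_mem_monomialSpan (w : ZMod 5 → A) (k : ZMod 5) (m n : ℕ) :
    w k ^ m * w (k + 1) ^ n ∈ monomialSpan w := Submodule.subset_span ⟨(k, m, n), rfl⟩

/-- Two generators that are not neighbours stand at distance two on the 5-cycle, so their product
can be rewritten as `1` plus the generator between them; this lowers the degree until only
neighbours remain. -/
theorem mul_mem_monomialSpan {w : ZMod 5 → A} (hw : IsPentagon w) (j : ZMod 5) {s : A}
    (hs : s ∈ monomialSpan w) : w j * s ∈ monomialSpan w := by
  have hM := monomial_mem_monomialSpan w
  have c1 : ∀ k m n, w (k + 1) * (w k ^ m * w (k + 1) ^ n) ∈ monomialSpan w := by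
    intro k m n
    rw [mul_left_comm, ← pow_succ']
    exact hM k _ _
  have c2 : ∀ k m n, w (k + 2) * (w k ^ m * w (k + 1) ^ n) ∈ monomialSpan w := by
    intro k m n
    cases m with
    | zero =>
      have h := c1 (k + 1) n 0
      have e : k + 1 + 1 = k + 2 := by ring
      simpa [e] using h
    | succ m =>
      have : w (k + 2) * (w k ^ (m + 1) * w (k + 1) ^ n)
          = w k ^ m * w (k + 1) ^ n + w k ^ m * w (k + 1) ^ (n + 1) := by
        linear_combination (w k ^ m * w (k + 1) ^ n) * hw k
      rw [this]
      exact add_mem (hM k _ _) (hM k _ _)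
  have c4 : ∀ k m n, w k * (w (k + 1) ^ m * w (k + 2) ^ n) ∈ monomialSpan w := by
    intro k m n
    have e : k + 1 + 1 = k + 2 := by ring
    cases n with
    | zero => simpa using hM k 1 m
    | succ n =>
      have : w k * (w (k + 1) ^ m * w (k + 2) ^ (n + 1))
          = w (k + 1) ^ m * w (k + 1 + 1) ^ n + w (k + 1) ^ (m + 1) * w (k + 1 + 1) ^ n := by
        rw [e]
        linear_combination (w (k + 1) ^ m * w (k + 2) ^ n) * hw k
      rw [this]
      exact add_mem (hM (k + 1) _ _) (hM (k + 1) _ _)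
  have c3 : ∀ k m n, w k * (w (k + 2) ^ m * w (k + 3) ^ n) ∈ monomialSpan w := by
    intro k m n
    have e : k + 2 + 1 = k + 3 := by ring
    cases m with
    | zero =>
      have e1 : k + 3 + 2 = k := by
        rw [add_assoc, show (3 : ZMod 5) + 2 = 0 by decide, add_zero]
      have h := c2 (k + 3) n 0
      rw [e1] at h
      simpa using h
    | succ m =>
      have e' : k + 1 + 1 = k + 2 := by ring
      have e'' : k + 1 + 2 = k + 3 := by ring
      have : w k * (w (k + 2) ^ (m + 1) * w (k + 3) ^ n)
          = w (k + 2) ^ m * w (k + 2 + 1) ^ n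
            + w (k + 1) * (w (k + 1 + 1) ^ m * w (k + 1 + 2) ^ n) := by
        rw [e, e', e'']
        linear_combination (w (k + 2) ^ m * w (k + 3) ^ n) * hw k
      rw [this]
      exact add_mem (hM (k + 2) _ _) (c4 (k + 1) _ _)
  refine Submodule.span_induction (p := fun s _ => w j * s ∈ monomialSpan w) ?_ ?_ ?_ ?_ hs
  · rintro _ ⟨⟨k, m, n⟩, rfl⟩
    have hj : j = k ∨ j = k + 1 ∨ j = k + 2 ∨ k = j + 2 ∨ k = j + 1 := by
      revert j k
      decide
    rcases hj with rfl | rfl | rfl | rfl | rfl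
    · dsimp only
      rw [← mul_assoc, ← pow_succ']
      exact hM _ _ _
    · exact c1 _ _ _
    · exact c2 _ _ _
    · have e : j + 2 + 1 = j + 3 := by ring
      simp only [e]
      exact c3 _ _ _
    · have e : j + 1 + 1 = j + 2 := by ring
      simp only [e]
      exact c4 _ _ _
  · simp
  · intro a b _ _ ha hb
    rw [mul_add]
    exact add_mem ha hb
  · intro r a _ ha
    rw [mul_smul_comm]
    exact (monomialSpan w).smul_mem _ ha

theorem monomialSpan_eq_top {w : ZMod 5 → A} (hw : IsPentagon w)
    (hA : Algebra.adjoin ℂ (Set.range w) = ⊤) : monomialSpan w = ⊤ := by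
  rw [eq_top_iff]
  rintro a -
  have key : ∀ a ∈ Algebra.adjoin ℂ (Set.range w), ∀ s ∈ monomialSpan w, a * s ∈ monomialSpan w := by
    intro a ha
    induction ha using Algebra.adjoin_induction with
    | mem x hx => obtain ⟨k, rfl⟩ := hx; exact fun s hs => mul_mem_monomialSpan hw k hs
    | algebraMap r =>
      intro s hs
      rw [← Algebra.smul_def]
      exact (monomialSpan w).smul_mem _ hs
    | add x y _ _ hx hy => intro s hs; rw [add_mul]; exact add_mem (hx s hs) (hy s hs)
    | mul x y _ _ hx hy => intro s hs; rw [mul_assoc]; exact hx _ (hy s hs)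
  have h := key a (by rw [hA]; trivial) 1 (by simpa using monomial_mem_monomialSpan w 0 0 0)
  rwa [mul_one] at h

/-- The monomial in two neighbouring elements given by an integral tropical point. -/
def tropicalMonomial (w : ZMod 5 → A) (p : ℤ × ℤ) : A :=
  w (coneCoord p.1 p.2).1 ^ (coneCoord p.1 p.2).2.1
    * w ((coneCoord p.1 p.2).1 + 1) ^ (coneCoord p.1 p.2).2.2

theorem span_tropicalMonomial {w : ZMod 5 → A} (hw : IsPentagon w)
    (hA : Algebra.adjoin ℂ (Set.range w) = ⊤) :
    Submodule.span ℂ (Set.range (tropicalMonomial w)) = ⊤ := by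
  rw [eq_top_iff, ← monomialSpan_eq_top hw hA, monomialSpan, Submodule.span_le]
  rintro _ ⟨⟨k, m, n⟩, rfl⟩
  obtain ⟨a, b, h⟩ := exists_coneCoord (fun k m n => w k ^ m * w (k + 1) ^ n) (by simp) k m n
  exact Submodule.subset_span ⟨(a, b), h.symm⟩

/-- The tropical monomials span the source, so a relation in the kernel would be a relation among
their independent images. -/
theorem injective_of_linearIndependent {B : Type*} [CommRing B] [Algebra ℂ B] {w : ZMod 5 → A}
    (hw : IsPentagon w) (hA : Algebra.adjoin ℂ (Set.range w) = ⊤) (f : A →ₐ[ℂ] B)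
    (h : LinearIndependent ℂ (tropicalMonomial fun k => f (w k))) : Function.Injective f := by
  rw [injective_iff_map_eq_zero]
  intro a ha
  have hmem : a ∈ Submodule.span ℂ (Set.range (tropicalMonomial w)) := by
    rw [span_tropicalMonomial hw hA]; trivial
  obtain ⟨c, rfl⟩ := (Finsupp.mem_span_range_iff_exists_finsupp).1 hmem
  have hc : c = 0 := by
    apply linearIndependent_iff.1 h
    rw [← ha, Finsupp.linearCombination_apply, Finsupp.sum, Finsupp.sum, map_sum]
    refine Finset.sum_congr rfl fun p _ => ?_
    rw [map_smul, tropicalMonomial, tropicalMonomial, map_mul, map_pow, map_pow]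
  simp [hc]

end span

/-! ## The pentagon ring is reduced -/

/-- Laurent polynomials in two variables. -/
abbrev Laurent : Type := AddMonoidAlgebra ℂ (ℤ × ℤ)

/-- At `q = 1` the torus is commutative. Compatibility with `rep 1` carries the leading exponent
computation over to Laurent polynomials; stating it for every `f` lets the induction pass through
products. -/
theorem exists_laurent : ∃ h : Torus 1 →ₐ[ℂ] Laurent,
    ∀ (t : Torus 1) (f : Laurent), ((h t * f).coeff : ℤ × ℤ → ℂ) = rep 1 t f.coeff := by
  obtain ⟨h, hX, hX', hY, hY'⟩ := Torus.exists_lift 1 (E := Laurent)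
    (AddMonoidAlgebra.single (1, 0) 1) (AddMonoidAlgebra.single (-1, 0) 1)
    (AddMonoidAlgebra.single (0, 1) 1) (AddMonoidAlgebra.single (0, -1) 1)
    (by simp [AddMonoidAlgebra.one_def]; rfl) (by simp [AddMonoidAlgebra.one_def]; rfl)
    (by simp [AddMonoidAlgebra.one_def]; rfl) (by simp [AddMonoidAlgebra.one_def]; rfl) (by simp)
  refine ⟨h, fun t => ?_⟩
  have ht : t ∈ Algebra.adjoin ℂ (Set.range (Torus.gen 1)) := by
    rw [Torus.adjoin_gen]; trivial
  induction ht using Algebra.adjoin_induction with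
  | mem x hx =>
    obtain ⟨g, rfl⟩ := hx
    intro f
    cases g <;> ext ⟨a, b⟩ <;>
      simp [hX, hX', hY, hY', rep_X, rep_Xinv, rep_Y, rep_Yinv, sub_eq_neg_add]
  | algebraMap r =>
    intro f
    rw [AlgHom.commutes, AlgHom.commutes, ← Algebra.smul_def]
    rfl
  | add x y _ _ hx hy =>
    intro f
    rw [map_add, map_add, add_mul, LinearMap.add_apply, ← hx, ← hy]
    rfl
  | mul x y _ _ hx hy =>
    intro f
    rw [map_mul, map_mul, mul_assoc, Module.End.mul_apply, ← hy, hx]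

/-- Sending the generators to the elements `y 1 k` embeds the ring in Laurent polynomials: the
monomials go to canonical basis elements at `q = 1`, which have distinct leading exponents. -/
instance : IsReduced PentagonRing := by
  obtain ⟨h, hh⟩ := exists_laurent
  have hw : IsPentagon fun k => h (y 1 k) := by
    intro k
    simp only [← map_mul, y_mul_add_two]
    simp
  obtain ⟨f, hf⟩ := PentagonRing.exists_lift hw
  have hinj : Function.Injective f := by
    apply injective_of_linearIndependent PentagonRing.isPentagon PentagonRing.adjoin_gen
    simp only [hf]
    let φ : Laurent →ₗ[ℂ] (ℤ × ℤ → ℂ) :=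
      { toFun := fun f => f.coeff
        map_add' := fun _ _ => rfl
        map_smul' := fun _ _ => rfl }
    apply LinearIndependent.of_comp φ
    apply linearIndependent_of_top
    intro g
    have h1 := top_coeffs_canonicalMap 1 g.1 g.2
    have h2 := hh (canonicalMap 1 g.1 g.2) 1
    have h3 : ((1 : Laurent).coeff : ℤ × ℤ → ℂ) = delta := by
      ext p
      simp [AddMonoidAlgebra.one_def, delta, Pi.single_apply, Finsupp.single_apply, eq_comm]
    rw [h3, mul_one, ← coeffs_apply] at h2
    rw [← h2, canonicalMap_eq, clusterMonomial] at h1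
    simp only [one_pow, Units.val_one, one_smul, map_mul, map_pow] at h1
    exact h1
  exact isReduced_of_injective f hinj

/-! ## Algebras isomorphic to the pentagon ring -/

/-- The elements `w` of the algebra `A` satisfy the pentagon relations and present it. -/
structure PresentedByPentagon {A : Type*} [CommRing A] [Algebra ℂ A] (w : ZMod 5 → A) : Prop where
  isPentagon : IsPentagon w
  adjoin_eq_top : Algebra.adjoin ℂ (Set.range w) = ⊤
  isReduced : IsReduced A
  exists_eval : ∀ p : ZMod 5 → ℂ, IsPentagon p → ∃ χ : A →ₐ[ℂ] ℂ, ∀ k, χ (w k) = p k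

/-- Independence makes the canonical surjection from `PentagonRing` an isomorphism, so reducedness
and the universal property transfer. -/
theorem presentedByPentagon_of_linearIndependent {A : Type*} [CommRing A] [Algebra ℂ A]
    {w : ZMod 5 → A} (hw : IsPentagon w) (hA : Algebra.adjoin ℂ (Set.range w) = ⊤)
    (h : LinearIndependent ℂ (tropicalMonomial w)) : PresentedByPentagon w := by
  obtain ⟨f, hf⟩ := PentagonRing.exists_lift hw
  have hinj : Function.Injective f :=
    injective_of_linearIndependent PentagonRing.isPentagon PentagonRing.adjoin_gen f
      (by simpa only [hf] using h)
  have hsurj : Function.Surjective f := by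
    rw [← AlgHom.range_eq_top, eq_top_iff, ← hA, Algebra.adjoin_le_iff]
    rintro _ ⟨k, rfl⟩
    exact ⟨_, hf k⟩
  let e : PentagonRing ≃ₐ[ℂ] A := AlgEquiv.ofBijective f ⟨hinj, hsurj⟩
  have he : ∀ k, e.symm (w k) = PentagonRing.gen k := fun k => by
    rw [AlgEquiv.symm_apply_eq]; exact (hf k).symm
  refine ⟨hw, hA, isReduced_of_injective e.symm e.symm.injective, fun p hp => ?_⟩
  obtain ⟨χ, hχ⟩ := PentagonRing.exists_lift hp
  exact ⟨χ.comp e.symm.toAlgHom, fun k => by simp [he, hχ]⟩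

section center

variable {q : ℂˣ} {l : ℕ} (hl : 0 < l) (hq2 : IsPrimitiveRoot ((q : ℂ) ^ 2) l)

/-- The normalized central elements `ε yₖˡ`. -/
def centralGen (ε : ℂ) (k : ZMod 5) : Subalgebra.center ℂ (L q) :=
  ε • ⟨yL q k ^ l, yL_pow_mem_center hl hq2.pow_eq_one k⟩

/-- Since `ε² = 1`, rescaling by `ε` normalizes the relation between the `l`-th powers to the
classical one. Monomials in neighbouring generators are nonzero multiples of basis elements with
indices in `lℤ²`, which gives both generation and independence. -/
theorem presentedByPentagon_centralGen {ε : ℂ} (hε : (-(q : ℂ)) ^ l = -ε) (hεε : ε * ε = 1) :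
    PresentedByPentagon (centralGen hl hq2 ε) := by
  have hε0 : ε ≠ 0 := left_ne_zero_of_mul_eq_one hεε
  have hw : IsPentagon (centralGen hl hq2 ε) := by
    intro k
    apply Subtype.ext
    apply Subtype.ext
    change (ε • y q k ^ l) * (ε • y q (k + 2) ^ l) = 1 + ε • y q (k + 1) ^ l
    rw [smul_mul_smul_comm, hεε, one_smul, y_pow_mul_y_pow_eq hl hq2 hε hεε]
  have hval : ∀ k m n, ((centralGen hl hq2 ε k ^ m * centralGen hl hq2 ε (k + 1) ^ n :
      Subalgebra.center ℂ (L q)) : L q)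
        = (ε ^ m * ε ^ n * ((q : ℂ) ^ (l * m * (l * n)))⁻¹) •
          basisElt q (l * m) (l * n) (2 * k + 1) := by
    intro k m n
    apply Subtype.ext
    change (ε • y q k ^ l) ^ m * (ε • y q (k + 1) ^ l) ^ n = _ • (basisElt q _ _ _ : Torus q)
    rw [coe_basisElt, clusterMonomial, smul_smul, mul_assoc (ε ^ m * ε ^ n),
      inv_mul_cancel₀ (pow_ne_zero _ q.ne_zero), mul_one, smul_pow, smul_pow, smul_mul_smul_comm,
      pow_mul, pow_mul]
  refine presentedByPentagon_of_linearIndependent hw ?_ ?_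
  · rw [eq_top_iff]
    rintro z -
    have hz := center_le_span hl hq2 z.2
    have h2 : (z : L q) ∈ ((Algebra.adjoin ℂ (Set.range (centralGen hl hq2 ε))).map
        (Subalgebra.center ℂ (L q)).val) := by
      refine Submodule.span_le (p := Subalgebra.toSubmodule
        ((Algebra.adjoin ℂ (Set.range (centralGen hl hq2 ε))).map
          (Subalgebra.center ℂ (L q)).val)) |>.2 ?_ hz
      rintro _ ⟨⟨k, m, n⟩, rfl⟩
      have hc : (ε ^ m * ε ^ n * ((q : ℂ) ^ (l * m * (l * n)))⁻¹) ≠ 0 := by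
        have := q.ne_zero
        positivity
      have hk : ∀ k, centralGen hl hq2 ε k ∈ Algebra.adjoin ℂ (Set.range (centralGen hl hq2 ε)) :=
        fun k => Algebra.subset_adjoin ⟨k, rfl⟩
      refine ⟨(ε ^ m * ε ^ n * ((q : ℂ) ^ (l * m * (l * n)))⁻¹)⁻¹ •
        (centralGen hl hq2 ε k ^ m * centralGen hl hq2 ε (k + 1) ^ n),
        Subalgebra.smul_mem _ (mul_mem (pow_mem (hk _) _) (pow_mem (hk _) _)) _, ?_⟩
      change (ε ^ m * ε ^ n * ((q : ℂ) ^ (l * m * (l * n)))⁻¹)⁻¹ •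
        ((centralGen hl hq2 ε k ^ m * centralGen hl hq2 ε (k + 1) ^ n :
          Subalgebra.center ℂ (L q)) : L q) = _
      rw [hval, smul_smul, inv_mul_cancel₀ hc, one_smul]
    obtain ⟨t, ht, h⟩ := h2
    rwa [← Subtype.ext h]
  · let φ : Subalgebra.center ℂ (L q) →ₗ[ℂ] Torus q :=
      (L q).val.toLinearMap.comp (Subalgebra.center ℂ (L q)).val.toLinearMap
    apply LinearIndependent.of_comp φ
    have hinj : Function.Injective fun p : ℤ × ℤ => ((l : ℤ) * p.1, (l : ℤ) * p.2) := by
      rintro ⟨a, b⟩ ⟨c, d⟩ h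
      simpa [hl.ne'] using h
    have h1 := (linearIndependent_canonicalMap q).comp _ hinj
    have h2 := h1.units_smul (fun p : ℤ × ℤ => Units.mk0 ε hε0 ^ (coneCoord p.1 p.2).2.1
      * Units.mk0 ε hε0 ^ (coneCoord p.1 p.2).2.2
      * (q ^ (l * (coneCoord p.1 p.2).2.1 * (l * (coneCoord p.1 p.2).2.2)))⁻¹)
    convert h2 using 1
    ext p
    have h3 := congrArg Subtype.val
      (hval (coneCoord p.1 p.2).1 (coneCoord p.1 p.2).2.1 (coneCoord p.1 p.2).2.2)
    refine h3.trans ?_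
    simp only [Pi.smul_apply', Function.comp_apply, Units.smul_def, canonicalMap_eq,
      coneCoord_mul hl]
    rw [← coe_basisElt]
    simp

end center

/-! ## Cross-ratio coordinates of configurations -/

/-- The area of the parallelogram spanned by two vectors. -/
def area {A : Type*} [CommRing A] (v w : Fin 2 → A) : A := v 0 * w 1 - v 1 * w 0

theorem area_swap {A : Type*} [CommRing A] (v w : Fin 2 → A) : area v w = -area w v := by
  simp only [area]; ring

theorem bracket_eq (z w : Projectivization ℂ (Fin 2 → ℂ)) : bracket z w = area z.rep w.rep := rfl

theorem mk_eq_mk_of_area {v w : Fin 2 → ℂ} (hv : v ≠ 0) (hw : w ≠ 0) (h : area v w = 0) :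
    Projectivization.mk ℂ v hv = Projectivization.mk ℂ w hw := by
  rw [Projectivization.mk_eq_mk_iff']
  simp only [area] at h
  by_cases h0 : w 0 = 0
  · have h1 : w 1 ≠ 0 := fun h1 => hw (by ext i; fin_cases i <;> simp [h0, h1])
    refine ⟨v 1 / w 1, ?_⟩
    ext i
    fin_cases i
    · simp only [h0, mul_zero, sub_zero] at h
      simp [h0, (mul_eq_zero.1 h).resolve_right h1]
    · simp [h1]
  · refine ⟨v 0 / w 0, ?_⟩
    ext i
    fin_cases i
    · simp [h0]
    · simp only [Pi.smul_apply, smul_eq_mul, Fin.mk_one]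
      field_simp
      linear_combination h

theorem area_rep_ne_zero {z w : Projectivization ℂ (Fin 2 → ℂ)} (h : z ≠ w) :
    area z.rep w.rep ≠ 0 := by
  intro h0
  apply h
  rw [← z.mk_rep, ← w.mk_rep]
  exact mk_eq_mk_of_area _ _ h0

theorem mk_ne_mk_of_area {v w : Fin 2 → ℂ} (hv : v ≠ 0) (hw : w ≠ 0) (h : area v w ≠ 0) :
    Projectivization.mk ℂ v hv ≠ Projectivization.mk ℂ w hw := by
  intro h0
  rw [Projectivization.mk_eq_mk_iff'] at h0
  obtain ⟨a, rfl⟩ := h0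
  apply h
  simp only [area, Pi.smul_apply, smul_eq_mul]
  ring

/-- The cross-ratio coordinates of a family of five vectors in the plane. -/
def crossCoord (v : ZMod 5 → Fin 2 → ℂ) (k : ZMod 5) : ℂ :=
  (area (v (2 * k + 1 + 1)) (v (2 * k + 1 + 2)) * area (v (2 * k + 1 + 3)) (v (2 * k + 1))) /
    (area (v (2 * k + 1 + 1)) (v (2 * k + 1)) * area (v (2 * k + 1 + 2)) (v (2 * k + 1 + 3)))

/-- The cross-ratio coordinates of a configuration. -/
def Config.cross (x : Config) : ZMod 5 → ℂ := crossCoord fun i => (x.1 i).rep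

theorem Config.area_ne_zero (x : Config) (i : ZMod 5) :
    area (x.1 i).rep (x.1 (i + 1)).rep ≠ 0 := area_rep_ne_zero (x.2 i)

/-- After cancelling areas of neighbours, this is the three-term Plücker relation for the vectors
with indices `c`, `c + 2`, `c + 3`, `c + 4`, where `c = 2 * k + 1`. -/
theorem isPentagon_crossCoord {v : ZMod 5 → Fin 2 → ℂ}
    (hv : ∀ i, area (v i) (v (i + 1)) ≠ 0) : IsPentagon (crossCoord v) := by
  intro k
  have e1 : 2 * (k + 2) + 1 = (2 * k + 1) + 4 := by ring
  have e2 : 2 * (k + 1) + 1 = (2 * k + 1) + 2 := by ring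
  simp only [crossCoord, e1, e2]
  generalize 2 * k + 1 = c
  have a1 : c + 4 + 1 = c := by rw [add_assoc, show (4 : ZMod 5) + 1 = 0 by decide, add_zero]
  have a2 : c + 4 + 2 = c + 1 := by rw [add_assoc, show (4 : ZMod 5) + 2 = 1 by decide]
  have a3 : c + 4 + 3 = c + 2 := by rw [add_assoc, show (4 : ZMod 5) + 3 = 2 by decide]
  have a4 : c + 2 + 1 = c + 3 := by rw [add_assoc, show (2 : ZMod 5) + 1 = 3 by decide]
  have a5 : c + 2 + 2 = c + 4 := by rw [add_assoc, show (2 : ZMod 5) + 2 = 4 by decide]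
  have a6 : c + 2 + 3 = c := by rw [add_assoc, show (2 : ZMod 5) + 3 = 0 by decide, add_zero]
  have a7 : c + 1 + 1 = c + 2 := by rw [add_assoc, show (1 : ZMod 5) + 1 = 2 by decide]
  have a8 : c + 3 + 1 = c + 4 := by rw [add_assoc, show (3 : ZMod 5) + 1 = 4 by decide]
  simp only [a1, a2, a3, a4, a5, a6]
  have h0 := hv c
  have h1 := hv (c + 1)
  have h2 := hv (c + 2)
  have h3 := hv (c + 3)
  have h4 := hv (c + 4)
  rw [a7] at h1
  rw [a4] at h2
  rw [a8] at h3
  rw [a1] at h4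
  rw [area_swap (v (c + 1)) (v c), area_swap (v c) (v (c + 4)), area_swap (v (c + 3)) (v (c + 2))]
  field_simp
  simp only [area]
  ring

theorem Config.isPentagon_cross (x : Config) : IsPentagon x.cross :=
  isPentagon_crossCoord x.area_ne_zero

/-- Every vector occurs equally often in numerator and denominator. The `a i` account for the choice
of homogeneous coordinates and `d` for the determinant of a linear map. -/
theorem crossCoord_smul {v v' : ZMod 5 → Fin 2 → ℂ} {d : ℂ} {a : ZMod 5 → ℂ} (hd : d ≠ 0)
    (ha : ∀ i, a i ≠ 0) (h : ∀ i j, area (v' i) (v' j) = a i * a j * d * area (v i) (v j)) :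
    crossCoord v' = crossCoord v := by
  ext k
  simp only [crossCoord, h]
  generalize 2 * k + 1 = c
  have h0 := ha c
  have h1 := ha (c + 1)
  have h2 := ha (c + 2)
  have h3 := ha (c + 3)
  have : d * d * a c * a (c + 1) * a (c + 2) * a (c + 3) ≠ 0 := by positivity
  symm
  rw [← mul_div_mul_left _ _ this]
  congr 1 <;> ring

theorem GL_smul_apply (g : GL (Fin 2) ℂ) (v : Fin 2 → ℂ) (i : Fin 2) :
    (g • v) i = g i 0 * v 0 + g i 1 * v 1 := by
  change (g.1.mulVec v) i = _
  simp [Matrix.mulVec, dotProduct, Fin.sum_univ_two]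

theorem area_GL_smul (g : GL (Fin 2) ℂ) (v w : Fin 2 → ℂ) :
    area (g • v) (g • w) = g.1.det * area v w := by
  simp only [area, GL_smul_apply, Matrix.det_fin_two]
  ring

theorem Config.cross_eq_of_rel {x x' : Config} (h : x ≈ x') : x.cross = x'.cross := by
  obtain ⟨g, hg⟩ := h
  induction g using Matrix.ProjGenLinGroup.induction_on with | mk g =>
  have key : ∀ i, ∃ a : ℂ, a ≠ 0 ∧ (x'.1 i).rep = a • (g • (x.1 i).rep) := by
    intro i
    have h1 : x'.1 i = Projectivization.mk ℂ (g • (x.1 i).rep)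
        ((smul_ne_zero_iff_ne g).2 (x.1 i).rep_nonzero) := by
      rw [hg i]
      conv_lhs => rw [← (x.1 i).mk_rep]
      exact Projectivization.PGL.mk_smul_mk g _
    obtain ⟨a, ha⟩ := Projectivization.exists_smul_eq_mk_rep ℂ (g • (x.1 i).rep)
      ((smul_ne_zero_iff_ne g).2 (x.1 i).rep_nonzero)
    rw [← h1] at ha
    exact ⟨a, a.ne_zero, ha.symm⟩
  choose a ha hx using key
  symm
  refine crossCoord_smul (d := g.1.det) (a := a) ?_ ha fun i j => ?_
  · exact ((Matrix.isUnit_iff_isUnit_det _).1 g.isUnit).ne_zero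
  · rw [hx, hx, mul_assoc, ← area_GL_smul]
    simp only [area, Pi.smul_apply, smul_eq_mul]
    ring

/-- The cross-ratio coordinates of a point of the moduli space. -/
def ModuliSpace.cross : ModuliSpace → ZMod 5 → ℂ :=
  Quotient.lift Config.cross fun _ _ h => Config.cross_eq_of_rel h

@[simp] theorem ModuliSpace.cross_mk (x : Config) : (ModuliSpace.mk x).cross = x.cross := rfl

theorem ModuliSpace.isPentagon_cross (p : ModuliSpace) : IsPentagon p.cross := by
  induction p using Quotient.ind with | _ x => exact x.isPentagon_cross

/-! ## The section of the quotient map -/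

/-- Five vectors with prescribed cross-ratio coordinates, all areas of neighbours being `-1`. -/
def secVec {A : Type*} [CommRing A] (p : ZMod 5 → A) : ZMod 5 → Fin 2 → A :=
  ![![1, 0], ![0, -1], ![-1, p 3], ![p 1, -p 2], ![-p 0, 1]]

theorem area_secVec {A : Type*} [CommRing A] {p : ZMod 5 → A} (hp : IsPentagon p) (i : ZMod 5) :
    area (secVec p i) (secVec p (i + 1)) = -1 := by
  have v0 : secVec p 0 = ![1, 0] := rfl
  have v1 : secVec p 1 = ![0, -1] := rfl
  have v2 : secVec p 2 = ![-1, p 3] := rfl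
  have v3 : secVec p 3 = ![p 1, -p 2] := rfl
  have v4 : secVec p 4 = ![-p 0, 1] := rfl
  have h0 : p 0 * p 2 = 1 + p 1 := hp 0
  have h1 : p 1 * p 3 = 1 + p 2 := hp 1
  have hi := zmod_five_cases i
  rcases hi with rfl | rfl | rfl | rfl | rfl
  · change area (secVec p 0) (secVec p 1) = -1
    rw [v0, v1]; simp [area]
  · change area (secVec p 1) (secVec p 2) = -1
    rw [v1, v2]; simp [area]
  · change area (secVec p 2) (secVec p 3) = -1
    rw [v2, v3]; simp only [area, Matrix.cons_val_zero, Matrix.cons_val_one]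
    linear_combination -h1
  · change area (secVec p 3) (secVec p 4) = -1
    rw [v3, v4]; simp only [area, Matrix.cons_val_zero, Matrix.cons_val_one]
    linear_combination -h0
  · change area (secVec p 4) (secVec p 0) = -1
    rw [v4, v0]; simp [area]

/-- With all neighbouring areas equal to `-1`, the cross-ratio collapses to one diagonal area, and
the vectors are chosen so that this area is `p k`. -/
theorem crossCoord_secVec {p : ZMod 5 → ℂ} (hp : IsPentagon p) : crossCoord (secVec p) = p := by
  have v0 : secVec p 0 = ![1, 0] := rfl
  have v1 : secVec p 1 = ![0, -1] := rfl
  have v2 : secVec p 2 = ![-1, p 3] := rfl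
  have v3 : secVec p 3 = ![p 1, -p 2] := rfl
  have v4 : secVec p 4 = ![-p 0, 1] := rfl
  have h3 : p 3 * p 0 = 1 + p 4 := hp 3
  ext k
  have e1 := area_secVec hp (2 * k + 1)
  have e2 := area_secVec hp (2 * k + 1 + 1)
  have e3 := area_secVec hp (2 * k + 1 + 2)
  have a7 : 2 * k + 1 + 1 + 1 = 2 * k + 1 + 2 := by ring
  have a8 : 2 * k + 1 + 2 + 1 = 2 * k + 1 + 3 := by ring
  rw [a7] at e2
  rw [a8] at e3
  have h : area (secVec p (2 * k + 1 + 3)) (secVec p (2 * k + 1)) = p k := by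
    have hk := zmod_five_cases k
    rcases hk with rfl | rfl | rfl | rfl | rfl
    · change area (secVec p 4) (secVec p 1) = p 0
      rw [v4, v1]; simp [area]
    · change area (secVec p 1) (secVec p 3) = p 1
      rw [v1, v3]; simp [area]
    · change area (secVec p 3) (secVec p 0) = p 2
      rw [v3, v0]; simp [area]
    · change area (secVec p 0) (secVec p 2) = p 3
      rw [v0, v2]; simp [area]
    · change area (secVec p 2) (secVec p 4) = p 4
      rw [v2, v4]; simp only [area, Matrix.cons_val_zero, Matrix.cons_val_one]
      linear_combination h3
  rw [crossCoord, area_swap (secVec p (2 * k + 1 + 1)) (secVec p (2 * k + 1)), e1, e2, e3, h]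
  ring

theorem secVec_ne_zero {p : ZMod 5 → ℂ} (hp : IsPentagon p) (i : ZMod 5) : secVec p i ≠ 0 := by
  intro h
  have := area_secVec hp i
  rw [h] at this
  simp [area] at this

/-- The configuration with prescribed cross-ratio coordinates. -/
def secConfig (p : ZMod 5 → ℂ) (hp : IsPentagon p) : Config :=
  ⟨fun i => Projectivization.mk ℂ (secVec p i) (secVec_ne_zero hp i), fun i =>
    mk_ne_mk_of_area _ _ (by rw [area_secVec hp]; norm_num)⟩

theorem exists_rep_secConfig {p : ZMod 5 → ℂ} (hp : IsPentagon p) : ∃ a : ZMod 5 → ℂ,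
    (∀ i, a i ≠ 0) ∧ ∀ i j, (secConfig p hp).coord (i, j) = a i * secVec p i j := by
  have key : ∀ i, ∃ a : ℂ, a ≠ 0 ∧ ((secConfig p hp).1 i).rep = a • secVec p i := by
    intro i
    obtain ⟨a, ha⟩ := Projectivization.exists_smul_eq_mk_rep ℂ (secVec p i) (secVec_ne_zero hp i)
    exact ⟨a, a.ne_zero, ha.symm⟩
  choose a ha h using key
  refine ⟨a, ha, fun i j => ?_⟩
  rw [Config.coord]
  dsimp only
  rw [h i]
  rfl

theorem cross_secConfig {p : ZMod 5 → ℂ} (hp : IsPentagon p) : (secConfig p hp).cross = p := by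
  obtain ⟨a, ha, h⟩ := exists_rep_secConfig hp
  refine Eq.trans ?_ (crossCoord_secVec hp)
  refine crossCoord_smul (d := 1) (a := a) one_ne_zero ha fun i j => ?_
  have h' : ∀ i j, ((secConfig p hp).1 i).rep j = a i * secVec p i j := h
  simp only [area, h']
  ring

theorem secConfig_cross_rel (x : Config) : secConfig x.cross x.isPentagon_cross ≈ x := by
  have h0 : area (x.1 0).rep (x.1 1).rep ≠ 0 := x.area_ne_zero 0
  have h1 : area (x.1 1).rep (x.1 2).rep ≠ 0 := x.area_ne_zero 1
  have h2 : area (x.1 2).rep (x.1 3).rep ≠ 0 := x.area_ne_zero 2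
  have h3 : area (x.1 3).rep (x.1 4).rep ≠ 0 := x.area_ne_zero 3
  have h4 : area (x.1 4).rep (x.1 0).rep ≠ 0 := x.area_ne_zero 4
  have c0 : x.cross 0 = (area (x.1 2).rep (x.1 3).rep * area (x.1 4).rep (x.1 1).rep) /
    (area (x.1 2).rep (x.1 1).rep * area (x.1 3).rep (x.1 4).rep) := rfl
  have c1 : x.cross 1 = (area (x.1 4).rep (x.1 0).rep * area (x.1 1).rep (x.1 3).rep) /
    (area (x.1 4).rep (x.1 3).rep * area (x.1 0).rep (x.1 1).rep) := rfl
  have c2 : x.cross 2 = (area (x.1 1).rep (x.1 2).rep * area (x.1 3).rep (x.1 0).rep) /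
    (area (x.1 1).rep (x.1 0).rep * area (x.1 2).rep (x.1 3).rep) := rfl
  have c3 : x.cross 3 = (area (x.1 3).rep (x.1 4).rep * area (x.1 0).rep (x.1 2).rep) /
    (area (x.1 3).rep (x.1 2).rep * area (x.1 4).rep (x.1 0).rep) := rfl
  rw [area_swap (x.1 2).rep (x.1 1).rep] at c0
  rw [area_swap (x.1 4).rep (x.1 3).rep] at c1
  rw [area_swap (x.1 1).rep (x.1 0).rep] at c2
  rw [area_swap (x.1 3).rep (x.1 2).rep] at c3
  set r : ZMod 5 → Fin 2 → ℂ := fun i => (x.1 i).rep with hr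
  have hri : ∀ i, (x.1 i).rep = r i := fun i => rfl
  simp only [hri] at h0 h1 h2 h3 h4 c0 c1 c2 c3
  -- The columns are multiples of `r 0` and `r 1`, so the first two normalized points go where they
  -- should. The multiples are fixed by requiring `(-1, x.cross 3)` to go to a multiple of `r 2`;
  -- the last two points then follow from their cross-ratios.
  have hdet : (!![-area (r 3) (r 4) * area (r 1) (r 2) * r 0 0,
        area (r 2) (r 3) * area (r 4) (r 0) * r 1 0;
      -area (r 3) (r 4) * area (r 1) (r 2) * r 0 1,
        area (r 2) (r 3) * area (r 4) (r 0) * r 1 1] : Matrix (Fin 2) (Fin 2) ℂ).det ≠ 0 := by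
    rw [Matrix.det_fin_two_of]
    have : -(area (r 3) (r 4) * area (r 1) (r 2) * area (r 2) (r 3) * area (r 4) (r 0)
      * area (r 0) (r 1)) ≠ 0 := neg_ne_zero.2 (by positivity)
    convert this using 1
    simp only [area]
    ring
  let g : GL (Fin 2) ℂ := Matrix.GeneralLinearGroup.mkOfDetNeZero _ hdet
  have g00 : g 0 0 = -area (r 3) (r 4) * area (r 1) (r 2) * r 0 0 := rfl
  have g01 : g 0 1 = area (r 2) (r 3) * area (r 4) (r 0) * r 1 0 := rfl
  have g10 : g 1 0 = -area (r 3) (r 4) * area (r 1) (r 2) * r 0 1 := rfl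
  have g11 : g 1 1 = area (r 2) (r 3) * area (r 4) (r 0) * r 1 1 := rfl
  refine ⟨.mk g, fun i => ?_⟩
  change x.1 i = (.mk g : Matrix.ProjGenLinGroup (Fin 2) ℂ) •
    Projectivization.mk ℂ (secVec x.cross i) _
  rw [Projectivization.PGL.mk_smul_mk, ← (x.1 i).mk_rep]
  apply mk_eq_mk_of_area
  rw [hri]
  have v0 : secVec x.cross 0 = ![1, 0] := rfl
  have v1 : secVec x.cross 1 = ![0, -1] := rfl
  have v2 : secVec x.cross 2 = ![-1, x.cross 3] := rfl
  have v3 : secVec x.cross 3 = ![x.cross 1, -x.cross 2] := rfl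
  have v4 : secVec x.cross 4 = ![-x.cross 0, 1] := rfl
  have hi := zmod_five_cases i
  have expand : ∀ v : Fin 2 → ℂ, area (r i) (g • v) =
      -area (r 3) (r 4) * area (r 1) (r 2) * area (r i) (r 0) * v 0
        + area (r 2) (r 3) * area (r 4) (r 0) * area (r i) (r 1) * v 1 := by
    intro v
    rw [area, GL_smul_apply, GL_smul_apply, g00, g01, g10, g11, area.eq_def (r i),
      area.eq_def (r i)]
    ring
  rw [expand]
  rcases hi with rfl | rfl | rfl | rfl | rfl
  · rw [v0]
    simp [area, mul_comm]
  · rw [v1]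
    simp [area, mul_comm]
  · rw [v2, c3]
    simp only [Matrix.cons_val_zero, Matrix.cons_val_one]
    field_simp
    rw [area_swap (r 2) (r 0), area_swap (r 2) (r 1)]
    ring
  · rw [v3, c1, c2]
    simp only [Matrix.cons_val_zero, Matrix.cons_val_one]
    field_simp
    rw [area_swap (r 3) (r 1)]
    ring
  · rw [v4, c0]
    simp only [Matrix.cons_val_zero, Matrix.cons_val_one]
    field_simp
    ring

theorem mk_secConfig_cross (p : ModuliSpace) :
    ModuliSpace.mk (secConfig p.cross p.isPentagon_cross) = p := by
  induction p using Quotient.ind with | _ x => exact Quotient.sound (secConfig_cross_rel x)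

/-! ## Evaluation at the points of the moduli space -/

namespace PresentedByPentagon

variable {A : Type} [CommRing A] [Algebra ℂ A] {w : ZMod 5 → A} (hw : PresentedByPentagon w)

/-- The character given by a solution of the pentagon relations. -/
def evalAt (p : ZMod 5 → ℂ) (hp : IsPentagon p) : A →ₐ[ℂ] ℂ := (hw.exists_eval p hp).choose

theorem evalAt_gen (p : ZMod 5 → ℂ) (hp : IsPentagon p) (k : ZMod 5) : hw.evalAt p hp (w k) = p k :=
  (hw.exists_eval p hp).choose_spec k

/-- The character given by a point of the moduli space. -/
def ev (p : ModuliSpace) : A →ₐ[ℂ] ℂ := hw.evalAt p.cross p.isPentagon_cross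

theorem ev_gen (p : ModuliSpace) (k : ZMod 5) : hw.ev p (w k) = p.cross k := hw.evalAt_gen _ _ k

theorem algHom_ext (hw : PresentedByPentagon w) {χ ψ : A →ₐ[ℂ] ℂ} (h : ∀ k, χ (w k) = ψ (w k)) : χ = ψ := by
  apply AlgHom.ext_of_adjoin_eq_top hw.adjoin_eq_top
  rintro _ ⟨k, rfl⟩
  exact h k

theorem exists_ev_eq (χ : A →ₐ[ℂ] ℂ) : ∃ p, hw.ev p = χ := by
  have hp : IsPentagon fun k => χ (w k) := hw.isPentagon.map χ
  refine ⟨.mk (secConfig _ hp), hw.algHom_ext fun k => ?_⟩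
  rw [ev_gen, ModuliSpace.cross_mk, cross_secConfig]

theorem finiteType (hw : PresentedByPentagon w) : Algebra.FiniteType ℂ A := by
  refine ⟨⟨(Set.finite_range w).toFinset, ?_⟩⟩
  rw [Set.Finite.coe_toFinset]
  exact hw.adjoin_eq_top

/-- By the Nullstellensatz the residue field is `ℂ`, so the quotient map is a character; its values
on the generators solve the pentagon relations and hence come from a configuration. -/
theorem exists_ev_of_isMaximal (m : Ideal A) [m.IsMaximal] :
    ∃ p, ∀ a, a ∈ m ↔ hw.ev p a = 0 := by
  have := hw.finiteType
  let _ := Ideal.Quotient.field m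
  have : Algebra.FiniteType ℂ (A ⧸ m) :=
    Algebra.FiniteType.of_surjective (Ideal.Quotient.mkₐ ℂ m) (Ideal.Quotient.mkₐ_surjective ℂ m)
  have : Module.Finite ℂ (A ⧸ m) := finite_of_finite_type_of_isJacobsonRing ℂ (A ⧸ m)
  let e : ℂ ≃ₐ[ℂ] (A ⧸ m) := AlgEquiv.ofBijective (Algebra.ofId ℂ (A ⧸ m))
    (IsAlgClosed.algebraMap_bijective_of_isIntegral (k := ℂ) (K := A ⧸ m))
  obtain ⟨p, hp⟩ := hw.exists_ev_eq (e.symm.toAlgHom.comp (Ideal.Quotient.mkₐ ℂ m))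
  refine ⟨p, fun a => ?_⟩
  rw [hp, ← Ideal.Quotient.eq_zero_iff_mem]
  exact (map_eq_zero_iff e.symm e.symm.injective).symm

/-- A finitely generated `ℂ`-algebra is a Jacobson ring, so radicals are detected by maximal ideals,
which are points of the moduli space. -/
theorem mem_radical_of_ev {J : Ideal A} {s : A}
    (h : ∀ p, (∀ a ∈ J, hw.ev p a = 0) → hw.ev p s = 0) : s ∈ J.radical := by
  have := hw.finiteType
  have : IsJacobsonRing A := isJacobsonRing_of_finiteType (A := ℂ)
  rw [Ideal.radical_eq_jacobson, Ideal.jacobson, Ideal.mem_sInf]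
  rintro m ⟨hJ, hm⟩
  obtain ⟨p, hp⟩ := hw.exists_ev_of_isMaximal m
  rw [hp]
  exact h p fun a ha => (hp a).1 (hJ ha)

theorem eq_zero_of_ev {a : A} (h : ∀ p, hw.ev p a = 0) : a = 0 := by
  have := hw.isReduced
  have h1 : a ∈ (⊥ : Ideal A).radical := hw.mem_radical_of_ev fun p _ => h p
  obtain ⟨n, hn⟩ := h1
  exact IsReduced.eq_zero a ⟨n, Ideal.mem_bot.1 hn⟩

end PresentedByPentagon

/-! ## Regular functions -/

theorem ModuliSpace.isQuotientMap_mk : Topology.IsQuotientMap ModuliSpace.mk :=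
  isQuotientMap_quotient_mk'

theorem isOpen_eval_ne_zero {Q : MvPolynomial (ZMod 5 × Fin 2) ℂ} {d : ZMod 5 → ℕ}
    (hQ : IsMultihomogeneous Q d) : IsOpen { x : Config | MvPolynomial.eval x.coord Q ≠ 0 } :=
  TopologicalSpace.isOpen_generateFrom_of_mem ⟨Q, d, hQ, rfl⟩

theorem IsMultihomogeneous.eval_smul {Q : MvPolynomial (ZMod 5 × Fin 2) ℂ} {d : ZMod 5 → ℕ}
    (hQ : IsMultihomogeneous Q d) (a : ZMod 5 → ℂ) (v : ZMod 5 × Fin 2 → ℂ) :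
    MvPolynomial.eval (fun p => a p.1 * v p) Q = (∏ i, a i ^ d i) * MvPolynomial.eval v Q := by
  rw [MvPolynomial.eval_eq', MvPolynomial.eval_eq', Finset.mul_sum]
  refine Finset.sum_congr rfl fun m hm => ?_
  have h := hQ (MvPolynomial.mem_support_iff.1 hm)
  have h1 : ∀ i, ∑ j, m (i, j) = d i := by
    intro i
    rw [← h, Finsupp.weight_apply, Finsupp.sum_fintype _ _ (by simp), Finset.sum_apply,
      Fintype.sum_prod_type, Finset.sum_eq_single i]
    · simp
    · intro b _ hb
      simp [hb.symm]
    · simp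
  simp only [mul_pow, Finset.prod_mul_distrib]
  have h2 : ∏ p : ZMod 5 × Fin 2, a p.1 ^ m p = ∏ i, a i ^ d i := by
    rw [Fintype.prod_prod_type]
    refine Finset.prod_congr rfl fun i _ => ?_
    rw [← h1 i]
    exact Finset.prod_pow_eq_pow_sum Finset.univ (fun j => m (i, j)) (a i)
  rw [h2]
  ring

/-- The area of two of the five vectors, as a polynomial. -/
def areaPoly (i j : ZMod 5) : MvPolynomial (ZMod 5 × Fin 2) ℂ :=
  .X (i, 0) * .X (j, 1) - .X (i, 1) * .X (j, 0)

theorem isMultihomogeneous_areaPoly (i j : ZMod 5) :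
    IsMultihomogeneous (areaPoly i j) (Pi.single i 1 + Pi.single j 1) := by
  have hX : ∀ p : ZMod 5 × Fin 2, IsMultihomogeneous (.X p) (Pi.single p.1 1) := fun p =>
    MvPolynomial.isWeightedHomogeneous_X ℂ _ p
  exact MvPolynomial.IsWeightedHomogeneous.sub ((hX (i, 0)).mul (hX (j, 1)))
    ((hX (i, 1)).mul (hX (j, 0)))

theorem eval_areaPoly (x : Config) (i j : ZMod 5) :
    MvPolynomial.eval x.coord (areaPoly i j) = area (x.1 i).rep (x.1 j).rep := by
  simp [areaPoly, area, Config.coord]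

/-- One global fraction suffices: its denominator is a product of areas of neighbours, which never
vanish on `Config`. -/
theorem cross_mem_regularFunctions (k : ZMod 5) :
    (fun p : (⊤ : TopologicalSpace.Opens ModuliSpace) => p.1.cross k) ∈ regularFunctions ⊤ := by
  intro x _
  have hden : ∀ x' : Config, MvPolynomial.eval x'.coord
      (areaPoly (2 * k + 1 + 1) (2 * k + 1) * areaPoly (2 * k + 1 + 2) (2 * k + 1 + 3)) ≠ 0 := by
    intro x'
    rw [map_mul, eval_areaPoly, eval_areaPoly, area_swap]
    have h1 := x'.area_ne_zero (2 * k + 1)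
    have h2 := x'.area_ne_zero (2 * k + 1 + 2)
    have a8 : 2 * k + 1 + 2 + 1 = 2 * k + 1 + 3 := by ring
    rw [a8] at h2
    exact mul_ne_zero (neg_ne_zero.2 h1) h2
  refine ⟨⊤, trivial, areaPoly (2 * k + 1 + 1) (2 * k + 1 + 2) * areaPoly (2 * k + 1 + 3) (2 * k + 1),
    areaPoly (2 * k + 1 + 1) (2 * k + 1) * areaPoly (2 * k + 1 + 2) (2 * k + 1 + 3), _,
    (isMultihomogeneous_areaPoly _ _).mul (isMultihomogeneous_areaPoly _ _), ?_, fun x' _ =>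
      ⟨hden x', fun _ => ?_⟩⟩
  · convert (isMultihomogeneous_areaPoly _ _).mul (isMultihomogeneous_areaPoly _ _) using 1
    abel
  · simp only [map_mul, eval_areaPoly]
    rfl

theorem isOpen_ne_zero_of_mem_regularFunctions
    {f : (⊤ : TopologicalSpace.Opens ModuliSpace) → ℂ} (hf : f ∈ regularFunctions ⊤) :
    IsOpen { p : ModuliSpace | f ⟨p, trivial⟩ ≠ 0 } := by
  rw [← ModuliSpace.isQuotientMap_mk.isOpen_preimage, isOpen_iff_forall_mem_open]
  intro x hx
  obtain ⟨W, hxW, P, Q, d, hP, hQ, h⟩ := hf x trivial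
  refine ⟨W ∩ { x | MvPolynomial.eval x.coord P ≠ 0 }, ?_, W.2.inter (isOpen_eval_ne_zero hP),
    hxW, ?_⟩
  · rintro x' ⟨hx'W, hx'⟩
    obtain ⟨h1, h2⟩ := h x' hx'W
    change f ⟨.mk x', trivial⟩ ≠ 0
    rw [h2 trivial]
    exact div_ne_zero hx' h1
  · intro h0
    apply hx
    rw [(h x hxW).2 trivial, h0, zero_div]

theorem inv_mem_regularFunctions {V : TopologicalSpace.Opens ModuliSpace} {f : V → ℂ}
    (hf : f ∈ regularFunctions V) (h0 : ∀ p, f p ≠ 0) : (fun p => (f p)⁻¹) ∈ regularFunctions V := by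
  intro x hx
  obtain ⟨W, hxW, P, Q, d, hP, hQ, h⟩ := hf x hx
  refine ⟨W ⊓ ⟨_, isOpen_eval_ne_zero hP⟩, ⟨hxW, ?_⟩, Q, P, d, hQ, hP, ?_⟩
  · intro hP0
    apply h0 ⟨.mk x, hx⟩
    rw [(h x hxW).2 hx, hP0, zero_div]
  · rintro x' ⟨hx'W, hx'⟩
    refine ⟨hx', fun hV => ?_⟩
    dsimp only
    rw [(h x' hx'W).2 hV, inv_div]

/-! ## The spectrum -/

theorem secVec_map {A B : Type*} [CommRing A] [CommRing B] [Algebra ℂ A] [Algebra ℂ B]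
    (f : A →ₐ[ℂ] B) (w : ZMod 5 → A) (i : ZMod 5) (j : Fin 2) :
    f (secVec w i j) = secVec (fun k => f (w k)) i j := by
  have hi := zmod_five_cases i
  rcases hi with rfl | rfl | rfl | rfl | rfl <;> fin_cases j
  exacts [map_one f, map_zero f, map_zero f, (map_neg f _).trans (by rw [map_one]; rfl),
    (map_neg f _).trans (by rw [map_one]; rfl), rfl, rfl, map_neg f _, map_neg f _, map_one f]

namespace PresentedByPentagon

variable {A : Type} [CommRing A] [Algebra ℂ A] {w : ZMod 5 → A} (hw : PresentedByPentagon w)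

theorem ev_mem_regularFunctions (a : A) :
    (fun p : (⊤ : TopologicalSpace.Opens ModuliSpace) => hw.ev p.1 a) ∈ regularFunctions ⊤ := by
  let F : A →ₐ[ℂ] ((⊤ : TopologicalSpace.Opens ModuliSpace) → ℂ) :=
    AlgHom.pi fun p => hw.ev p.1
  have h : (⊤ : Subalgebra ℂ A) ≤ (regularFunctions ⊤).comap F := by
    rw [← hw.adjoin_eq_top, Algebra.adjoin_le_iff]
    rintro _ ⟨k, rfl⟩
    have h1 := cross_mem_regularFunctions k
    change (fun p : (⊤ : TopologicalSpace.Opens ModuliSpace) => hw.ev p.1 (w k))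
      ∈ regularFunctions ⊤
    simpa only [ev_gen] using h1
  exact h (Algebra.mem_top (x := a))

/-- An element of the algebra as a regular function. -/
def toRegular : A →ₐ[ℂ] regularFunctions ⊤ :=
  (AlgHom.pi fun p : (⊤ : TopologicalSpace.Opens ModuliSpace) => hw.ev p.1).codRestrict _
    hw.ev_mem_regularFunctions

theorem toRegular_apply (a : A) (p : (⊤ : TopologicalSpace.Opens ModuliSpace)) :
    (hw.toRegular a).1 p = hw.ev p.1 a := rfl

/-- The maximal ideal of a point. -/
def point (p : ModuliSpace) : MaximalSpectrum A :=
  ⟨RingHom.ker (hw.ev p), RingHom.ker_isMaximal_of_surjective _ fun r =>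
    ⟨algebraMap ℂ A r, (hw.ev p).commutes r⟩⟩

theorem mem_point {p : ModuliSpace} {a : A} : a ∈ (hw.point p).asIdeal ↔ hw.ev p a = 0 := Iff.rfl

theorem point_bijective : Function.Bijective hw.point := by
  constructor
  · intro p p' h
    have hc : p.cross = p'.cross := by
      ext k
      have h1 : w k - algebraMap ℂ A (p.cross k) ∈ (hw.point p).asIdeal := by
        rw [mem_point, map_sub, ev_gen, AlgHom.commutes]
        exact sub_self _
      rw [h, mem_point, map_sub, ev_gen, AlgHom.commutes, sub_eq_zero] at h1
      exact h1.symm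
    rw [← mk_secConfig_cross p, ← mk_secConfig_cross p']
    congr 2
  · intro m
    have := m.isMaximal
    obtain ⟨p, hp⟩ := hw.exists_ev_of_isMaximal m.asIdeal
    refine ⟨p, ?_⟩
    ext a
    rw [mem_point, ← hp]

theorem continuous_point : Continuous hw.point := by
  rw [continuous_induced_rng, PrimeSpectrum.isTopologicalBasis_basic_opens.continuous_iff]
  rintro _ ⟨a, rfl⟩
  exact isOpen_ne_zero_of_mem_regularFunctions (hw.ev_mem_regularFunctions a)

/-- The configuration with normalized homogeneous coordinates representing a maximal ideal. -/
def configOf (m : MaximalSpectrum A) : Config :=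
  secConfig ((Equiv.ofBijective _ hw.point_bijective).symm m).cross
    ((Equiv.ofBijective _ hw.point_bijective).symm m).isPentagon_cross

theorem configOf_point (p : ModuliSpace) :
    hw.configOf (hw.point p) = secConfig p.cross p.isPentagon_cross := by
  have : (Equiv.ofBijective _ hw.point_bijective).symm (hw.point p) = p :=
    Equiv.ofBijective_symm_apply_apply _ _ _
  simp only [configOf, this]

theorem mk_configOf_point (p : ModuliSpace) : ModuliSpace.mk (hw.configOf (hw.point p)) = p := by
  rw [configOf_point, mk_secConfig_cross]

/-- The value of a polynomial in the homogeneous coordinates at the normalized coordinates. -/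
def pullback (w : ZMod 5 → A) : MvPolynomial (ZMod 5 × Fin 2) ℂ →ₐ[ℂ] A :=
  MvPolynomial.aeval fun p => secVec w p.1 p.2

/-- The chosen representatives differ from the normalized vectors by one scalar per point. By
multihomogeneity this becomes a factor depending on `d` and not on `Q`, so it cancels in ratios of
equal multidegree. -/
theorem exists_eval_configOf (p : ModuliSpace) (d : ZMod 5 → ℕ) : ∃ c : ℂ, c ≠ 0 ∧
    ∀ Q, IsMultihomogeneous Q d →
      MvPolynomial.eval (hw.configOf (hw.point p)).coord Q = c * hw.ev p (pullback w Q) := by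
  obtain ⟨a, ha, h⟩ := exists_rep_secConfig p.isPentagon_cross
  refine ⟨∏ i, a i ^ d i, Finset.prod_ne_zero_iff.2 fun i _ => pow_ne_zero _ (ha i), fun Q hQ => ?_⟩
  have h1 : (hw.configOf (hw.point p)).coord = fun ij => a ij.1 * secVec p.cross ij.1 ij.2 := by
    ext ⟨i, j⟩
    rw [configOf_point, h]
  have h2 : hw.ev p (pullback w Q)
      = MvPolynomial.eval (fun ij : ZMod 5 × Fin 2 => secVec p.cross ij.1 ij.2) Q := by
    have h3 : (hw.ev p).comp (pullback w)
        = MvPolynomial.aeval (fun ij : ZMod 5 × Fin 2 => secVec p.cross ij.1 ij.2) := by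
      apply MvPolynomial.algHom_ext
      intro ij
      rw [AlgHom.comp_apply, pullback, MvPolynomial.aeval_X, MvPolynomial.aeval_X, secVec_map]
      simp only [ev_gen]
    exact (DFunLike.congr_fun h3 Q).trans (MvPolynomial.aeval_def _ _)
  rw [h1, hQ.eval_smul a fun ij => secVec p.cross ij.1 ij.2, h2]

/-- The polynomial section pulls the basic open set of `Q` back to the basic open set of `pullback w
Q`. -/
theorem continuous_configOf : Continuous hw.configOf := by
  refine continuous_generateFrom_iff.2 ?_
  rintro _ ⟨Q, d, hQ, rfl⟩
  refine ⟨PrimeSpectrum.basicOpen (pullback w Q), (PrimeSpectrum.basicOpen _).2, ?_⟩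
  ext m
  obtain ⟨p, rfl⟩ := hw.point_bijective.2 m
  obtain ⟨c, hc, h⟩ := hw.exists_eval_configOf p d
  change ¬ (pullback w Q ∈ (hw.point p).asIdeal) ↔ _
  rw [mem_point, Set.mem_preimage, Set.mem_ofPred_eq, h Q hQ]
  simp [hc]

/-- The moduli space is homeomorphic to the maximal spectrum. -/
def homeomorph : ModuliSpace ≃ₜ MaximalSpectrum A where
  toEquiv := Equiv.ofBijective _ hw.point_bijective
  continuous_toFun := hw.continuous_point
  continuous_invFun := by
    have : ((Equiv.ofBijective _ hw.point_bijective).symm : MaximalSpectrum A → ModuliSpace)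
        = ModuliSpace.mk ∘ hw.configOf := by
      ext m
      obtain ⟨p, rfl⟩ := hw.point_bijective.2 m
      rw [Function.comp_apply, mk_configOf_point]
      exact Equiv.ofBijective_symm_apply_apply _ _ _
    change Continuous ((Equiv.ofBijective _ hw.point_bijective).symm :
      MaximalSpectrum A → ModuliSpace)
    rw [this]
    exact ModuliSpace.isQuotientMap_mk.continuous.comp hw.continuous_configOf

/-- The elements `a` for which `a f` comes from `A` form the ideal `J` of denominators. Near each
point with `s ≠ 0` a local fraction for `f` gives a denominator nonzero there, so `s` vanishes on
the zero locus of `J` and lies in its radical. -/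
theorem exists_pow_mul_eq {s : A} {V : TopologicalSpace.Opens ModuliSpace}
    (hV : ∀ p, hw.ev p s ≠ 0 → p ∈ V) {f : V → ℂ}
    (hf : f ∈ regularFunctions V) :
    ∃ (n : ℕ) (b : A), ∀ p : V, hw.ev p.1 s ^ n * f p = hw.ev p.1 b := by
  let J : Ideal A :=
    { carrier := { a | ∃ b : A, ∀ p : V, hw.ev p.1 a * f p = hw.ev p.1 b }
      add_mem' := by
        rintro a a' ⟨b, hb⟩ ⟨b', hb'⟩
        exact ⟨b + b', fun p => by rw [map_add, map_add, add_mul, hb, hb']⟩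
      zero_mem' := ⟨0, fun p => by simp⟩
      smul_mem' := by
        rintro c a ⟨b, hb⟩
        exact ⟨c * b, fun p => by rw [smul_eq_mul, map_mul, map_mul, mul_assoc, hb]⟩ }
  have hs : s ∈ J.radical := by
    refine hw.mem_radical_of_ev fun p hp => ?_
    by_contra hps
    have hpV := hV p hps
    obtain ⟨W, hxW, P, Q, d, hP, hQ, h⟩ := hf (hw.configOf (hw.point p))
      (by rwa [mk_configOf_point])
    obtain ⟨U, hU, hUW⟩ := hw.continuous_configOf.isOpen_preimage W W.2
    have hpU : (hw.point p).toPrimeSpectrum ∈ U := by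
      have : hw.point p ∈ MaximalSpectrum.toPrimeSpectrum ⁻¹' U := by rw [hUW]; exact hxW
      exact this
    obtain ⟨_, ⟨a, rfl⟩, hpa, haU⟩ :=
      PrimeSpectrum.isTopologicalBasis_basic_opens.exists_subset_of_mem_open hpU hU
    have hpa' : hw.ev p a ≠ 0 := hpa
    have hW : ∀ p', hw.ev p' a ≠ 0 → hw.configOf (hw.point p') ∈ W := by
      intro p' hp'
      have h1 : hw.point p' ∈ MaximalSpectrum.toPrimeSpectrum ⁻¹' U := haU hp'
      rw [hUW] at h1
      exact h1
    have hQ' : ∀ p', hw.ev p' a ≠ 0 → hw.ev p' (pullback w Q) ≠ 0 := by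
      intro p' hp' h0
      obtain ⟨c, hc, hcQ⟩ := hw.exists_eval_configOf p' d
      apply (h _ (hW p' hp')).1
      rw [hcQ Q hQ, h0, mul_zero]
    -- The fraction is only known where `a ≠ 0`; multiplying by `a` makes the identity hold on all
    -- of `V`.
    have hmem : a * pullback w Q ∈ J := by
      refine ⟨a * pullback w P, fun p' => ?_⟩
      by_cases hp' : hw.ev p'.1 a = 0
      · simp [hp']
      · obtain ⟨c, hc, hcQ⟩ := hw.exists_eval_configOf p'.1 d
        have h1 := (h _ (hW p'.1 hp')).2 (by rw [mk_configOf_point]; exact p'.2)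
        have h2 : (⟨ModuliSpace.mk (hw.configOf (hw.point p'.1)),
            by rw [mk_configOf_point]; exact p'.2⟩ : V) = p' :=
          Subtype.ext (hw.mk_configOf_point p'.1)
        rw [h2, hcQ Q hQ, hcQ P hP, mul_div_mul_left _ _ hc] at h1
        have h3 := hQ' p'.1 hp'
        rw [h1, map_mul, map_mul]
        field_simp
    have := hp _ hmem
    rw [map_mul] at this
    exact mul_ne_zero hpa' (hQ' p hpa') this
  obtain ⟨n, b, hb⟩ := hs
  exact ⟨n, b, fun p => by rw [← hb, map_pow]⟩

theorem toRegular_bijective : Function.Bijective hw.toRegular := by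
  constructor
  · rw [injective_iff_map_eq_zero]
    intro a ha
    refine hw.eq_zero_of_ev fun p => ?_
    have := congrFun (congrArg Subtype.val ha) ⟨p, trivial⟩
    exact this
  · rintro ⟨f, hf⟩
    obtain ⟨n, b, hb⟩ := hw.exists_pow_mul_eq (s := 1) (V := ⊤) (fun _ _ => trivial) hf
    refine ⟨b, ?_⟩
    ext p
    rw [toRegular_apply, ← hb]
    simp

/-- The algebra is isomorphic to the algebra of global regular functions. -/
def equivRegular : A ≃ₐ[ℂ] regularFunctions ⊤ := AlgEquiv.ofBijective _ hw.toRegular_bijective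

theorem equivRegular_apply (a : A) (p : (⊤ : TopologicalSpace.Opens ModuliSpace)) :
    (hw.equivRegular a).1 p = hw.ev p.1 a := rfl

theorem identifiesSpectrum : IdentifiesSpectrum hw.equivRegular.toAlgHom where
  points := ⟨hw.homeomorph, fun _ _ => Iff.rfl⟩
  sections s V hV := by
    have hV1 : ∀ p : V, hw.ev p.1 s ≠ 0 := fun p => (hV p.1).1 p.2
    have key : ∀ (a : A) (p : V),
        (algebraMap A (Functions hw.equivRegular.toAlgHom V) a : regularFunctions V).1 p
          = hw.ev p.1 a := fun _ _ => rfl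
    refine (isLocalization_iff _ _).2 ?_
    refine ⟨?_, ?_, ?_⟩
    · rintro ⟨_, n, rfl⟩
      dsimp only
      rw [map_pow]
      refine IsUnit.pow n ?_
      let g : regularFunctions V := ⟨_, inv_mem_regularFunctions
        (algebraMap A (Functions hw.equivRegular.toAlgHom V) s : regularFunctions V).2 hV1⟩
      refine IsUnit.of_mul_eq_one (b := (g : Functions hw.equivRegular.toAlgHom V)) ?_
      refine Subtype.ext ?_
      ext p
      exact mul_inv_cancel₀ (hV1 p)
    · intro z
      obtain ⟨n, b, hb⟩ := hw.exists_pow_mul_eq (fun p hp => (hV p).2 hp)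
        (f := (z : regularFunctions V).1) (z : regularFunctions V).2
      refine ⟨(b, ⟨s ^ n, n, rfl⟩), ?_⟩
      refine Subtype.ext ?_
      ext p
      change (z : regularFunctions V).1 p * hw.ev p.1 (s ^ n) = hw.ev p.1 b
      rw [← hb, map_pow, mul_comm]
    · intro a b hab
      -- A single factor `s` suffices: `s (a - b)` vanishes at every point, either through `s` or
      -- because the point lies in `V`, and elements of `A` are determined by their values.
      refine ⟨⟨s, 1, pow_one s⟩, ?_⟩
      rw [← sub_eq_zero, ← mul_sub]
      refine hw.eq_zero_of_ev fun p => ?_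
      rw [map_mul, map_sub]
      by_cases hp : hw.ev p s = 0
      · rw [hp, zero_mul]
      · have h1 : hw.ev p a = hw.ev p b :=
          congrFun (congrArg (fun z : regularFunctions V => z.1) hab) ⟨p, (hV p).2 hp⟩
        rw [h1, sub_self, mul_zero]

end PresentedByPentagon

/-! ## A criterion for Azumaya algebras -/

section criterion

open MulOpposite

/-- The action of `B ⊗ Bᵒᵖ` on `B` can be used to write the identity by means of elements that
annihilate all commutators and map `B` to the base ring; and the base ring is a direct summand. -/
structure HasTraces (R B : Type*) [CommRing R] [Ring B] [Algebra R B] : Prop where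
  exists_repr : ∃ (n : ℕ) (e : Fin n → B) (t : Fin n → B ⊗[R] Bᵐᵒᵖ) (f : Fin n → B →ₗ[R] R),
    (∀ i b, (b ⊗ₜ 1) * t i = (1 ⊗ₜ op b) * t i) ∧
    (∀ i x, AlgHom.mulLeftRight R B (t i) x = algebraMap R B (f i x)) ∧
    ∑ i, (e i ⊗ₜ 1) * t i = 1
  exists_retraction : ∃ g : B →ₗ[R] R, g 1 = 1

variable {R B : Type*} [CommRing R] [Ring B] [Algebra R B]

/-- In front of `t` a right multiplication may be traded for a left one, so `a ⊗ b` acts as left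
multiplication by `a b`, the value of its action on `1`. -/
theorem mul_eq_of_invariant {t : B ⊗[R] Bᵐᵒᵖ} (ht : ∀ b, (b ⊗ₜ 1) * t = (1 ⊗ₜ op b) * t)
    (u : B ⊗[R] Bᵐᵒᵖ) : u * t = (AlgHom.mulLeftRight R B u 1 ⊗ₜ 1) * t := by
  induction u with
  | zero => simp
  | tmul a b =>
    have h1 : (a ⊗ₜ[R] b) = (a ⊗ₜ 1) * (1 ⊗ₜ op b.unop) := by simp
    rw [AlgHom.mulLeftRight_apply, mul_one, h1, mul_assoc, ← ht, ← mul_assoc]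
    simp
  | add x y hx hy =>
    rw [add_mul, hx, hy, map_add, LinearMap.add_apply, TensorProduct.add_tmul, add_mul]

/-- Let the identity `∑ (eᵢ ⊗ 1) tᵢ = 1` act on `x`; each `tᵢ` sends `x` to a scalar. -/
theorem HasTraces.exists_dualBasis (h : HasTraces R B) : ∃ (n : ℕ) (e : Fin n → B)
    (f : Fin n → B →ₗ[R] R), ∀ x, x = ∑ i, f i x • e i := by
  obtain ⟨n, e, t, f, h1, h2, h3⟩ := h.exists_repr
  refine ⟨n, e, f, fun x => ?_⟩
  have h4 := congrArg (fun s => AlgHom.mulLeftRight R B s x) h3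
  simp only [map_sum, map_mul, map_one, LinearMap.sum_apply, Module.End.mul_apply, h2,
    AlgHom.mulLeftRight_apply, unop_one, mul_one, Module.End.one_apply] at h4
  rw [← h4]
  refine Finset.sum_congr rfl fun i _ => ?_
  rw [← Algebra.commutes, Algebra.smul_def, h4]

/-- If `s` acts as zero, then `s (eᵢ ⊗ 1) tᵢ = (s(eᵢ) ⊗ 1) tᵢ = 0`, and summation gives `s = 0`. An
endomorphism `φ` is the action of `∑ (φ(eᵢ) ⊗ 1) tᵢ`, by the dual basis. The retraction is used for
faithfulness of the scalars. -/
theorem HasTraces.isAzumaya (h : HasTraces R B) : IsAzumaya R B := by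
  obtain ⟨g, hg⟩ := h.exists_retraction
  have hfin : Module.Projective R B ∧ Module.Finite R B := by
    obtain ⟨n, e, f, h1⟩ := h.exists_dualBasis
    have h2 : (Fintype.linearCombination R e).comp (LinearMap.pi f) = LinearMap.id := by
      ext x
      rw [LinearMap.comp_apply, Fintype.linearCombination_apply]
      exact (h1 x).symm
    refine ⟨Module.Projective.of_split _ _ h2,
      Module.Finite.of_surjective (Fintype.linearCombination R e) fun x => ⟨_,
        DFunLike.congr_fun h2 x⟩⟩
  obtain ⟨n, e, t, f, h1, h2, h3⟩ := h.exists_repr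
  have hsmul : FaithfulSMul R B := by
    refine ⟨fun {r s} hrs => ?_⟩
    have := congrArg g (hrs 1)
    simpa [hg] using this
  obtain ⟨hproj, hfinite⟩ := hfin
  refine { bij := ⟨?_, ?_⟩ }
  · rw [injective_iff_map_eq_zero]
    intro s hs
    rw [← mul_one s, ← h3, Finset.mul_sum]
    refine Finset.sum_eq_zero fun i _ => ?_
    rw [← mul_assoc, mul_eq_of_invariant (h1 i), map_mul, hs, zero_mul, LinearMap.zero_apply,
      TensorProduct.zero_tmul, zero_mul]
  · intro φ
    refine ⟨∑ i, (φ (e i) ⊗ₜ 1) * t i, ?_⟩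
    ext x
    have h4 := congrArg (fun s => φ (AlgHom.mulLeftRight R B s x)) h3
    simp only [map_sum, map_mul, map_one, LinearMap.sum_apply, Module.End.mul_apply, h2,
      AlgHom.mulLeftRight_apply, unop_one, mul_one, Module.End.one_apply] at h4 ⊢
    rw [← h4]
    refine Finset.sum_congr rfl fun i _ => ?_
    rw [← Algebra.commutes, ← Algebra.commutes, ← Algebra.smul_def, ← Algebra.smul_def, map_smul]

/-! ### Base change of traces -/

section baseChange

variable (R' : Type*) [CommRing R'] [Algebra R R']

/-- The base change map for enveloping algebras. -/
def envelopingMap : B ⊗[R] Bᵐᵒᵖ →ₐ[R] (R' ⊗[R] B) ⊗[R'] (R' ⊗[R] B)ᵐᵒᵖ :=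
  Algebra.TensorProduct.lift
    ((Algebra.TensorProduct.includeLeft : _ →ₐ[R'] (R' ⊗[R] B) ⊗[R'] (R' ⊗[R] B)ᵐᵒᵖ).restrictScalars
      R |>.comp (Algebra.TensorProduct.includeRight : B →ₐ[R] R' ⊗[R] B))
    ((Algebra.TensorProduct.includeRight : _ →ₐ[R'] (R' ⊗[R] B) ⊗[R'] (R' ⊗[R] B)ᵐᵒᵖ).restrictScalars
      R |>.comp (Algebra.TensorProduct.includeRight : B →ₐ[R] R' ⊗[R] B).op)
    (fun a b => by
      change ((1 ⊗ₜ a) ⊗ₜ 1) * (1 ⊗ₜ op (1 ⊗ₜ b.unop)) = (1 ⊗ₜ op (1 ⊗ₜ b.unop)) * ((1 ⊗ₜ a) ⊗ₜ 1)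
      simp)

theorem envelopingMap_tmul (a : B) (b : Bᵐᵒᵖ) :
    envelopingMap R' (a ⊗ₜ[R] b) = (1 ⊗ₜ a) ⊗ₜ op (1 ⊗ₜ b.unop) := by
  rw [envelopingMap, Algebra.TensorProduct.lift_tmul]
  change ((1 ⊗ₜ a) ⊗ₜ 1) * (1 ⊗ₜ op (1 ⊗ₜ b.unop)) = _
  simp

/-- The base change of a linear form. -/
def formBaseChange (f : B →ₗ[R] R) : R' ⊗[R] B →ₗ[R'] R' :=
  (TensorProduct.AlgebraTensorModule.rid R R' R').toLinearMap.comp (f.baseChange R')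

theorem formBaseChange_tmul (f : B →ₗ[R] R) (r : R') (b : B) :
    formBaseChange R' f (r ⊗ₜ b) = f b • r := by
  simp [formBaseChange]

theorem HasTraces.baseChange (h : HasTraces R B) : HasTraces R' (R' ⊗[R] B) := by
  obtain ⟨n, e, t, f, h1, h2, h3⟩ := h.exists_repr
  obtain ⟨g, hg⟩ := h.exists_retraction
  refine ⟨⟨n, fun i => 1 ⊗ₜ e i, fun i => envelopingMap R' (t i), fun i => formBaseChange R' (f i),
    fun i b => ?_, fun i x => ?_, ?_⟩, formBaseChange R' g, ?_⟩
  · induction b with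
    | zero => simp
    | tmul r b =>
      have e1 : (r ⊗ₜ[R] b) = r • (1 ⊗ₜ b) := by rw [TensorProduct.smul_tmul', smul_eq_mul, mul_one]
      have e2 := congrArg (envelopingMap R') (h1 i b)
      rw [map_mul, map_mul, envelopingMap_tmul, envelopingMap_tmul] at e2
      rw [e1, op_smul, TensorProduct.tmul_smul, ← TensorProduct.smul_tmul', smul_mul_assoc,
        smul_mul_assoc]
      exact congrArg (r • ·) e2
    | add x y hx hy =>
      rw [TensorProduct.add_tmul, add_mul, hx, hy, op_add, TensorProduct.tmul_add, add_mul]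
  · have key : ∀ (s : B ⊗[R] Bᵐᵒᵖ) (x : B), AlgHom.mulLeftRight R' (R' ⊗[R] B) (envelopingMap R' s)
        (1 ⊗ₜ x) = 1 ⊗ₜ AlgHom.mulLeftRight R B s x := by
      intro s x
      induction s with
      | zero => simp
      | tmul a b => simp [envelopingMap_tmul]
      | add s s' hs hs' =>
        rw [map_add, map_add, LinearMap.add_apply, hs, hs', map_add, LinearMap.add_apply,
          TensorProduct.tmul_add]
    induction x with
    | zero => simp
    | tmul r x =>
      have e1 : (r ⊗ₜ[R] x) = r • (1 ⊗ₜ x) := by rw [TensorProduct.smul_tmul', smul_eq_mul, mul_one]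
      rw [e1, map_smul, key, h2, map_smul, formBaseChange_tmul, smul_eq_mul, map_mul,
        ← Algebra.smul_def]
      congr 1
      rw [Algebra.algebraMap_eq_smul_one, TensorProduct.tmul_smul, TensorProduct.smul_tmul',
        Algebra.TensorProduct.algebraMap_apply]
      rfl
    | add x y hx hy => rw [map_add, hx, hy, map_add, map_add]
  · rw [← map_one (envelopingMap R' (R := R) (B := B)), ← h3, map_sum]
    refine Finset.sum_congr rfl fun i _ => ?_
    rw [map_mul, envelopingMap_tmul]
    rfl
  · rw [Algebra.TensorProduct.one_def, formBaseChange_tmul, hg, one_smul]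

theorem eq_sum_formBaseChange {n : ℕ} {e : Fin n → B} {f : Fin n → B →ₗ[R] R}
    (h : ∀ x, x = ∑ i, f i x • e i) (t : R' ⊗[R] B) :
    t = ∑ i, formBaseChange R' (f i) t ⊗ₜ e i := by
  induction t with
  | zero => simp
  | tmul r b =>
    conv_lhs => rw [h b]
    simp only [formBaseChange_tmul, TensorProduct.tmul_sum, TensorProduct.smul_tmul]
  | add x y hx hy =>
    simp only [map_add, TensorProduct.add_tmul, Finset.sum_add_distrib, ← hx, ← hy]

end baseChange

end criterion

/-! ## Sheaves -/

/-- Values may be taken from any member of the cover containing the point, and regularity is a local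
condition. -/
theorem exists_glue_regularFunctions {ι : Type} (V : ι → TopologicalSpace.Opens ModuliSpace)
    (s : ∀ i, regularFunctions (V i))
    (hs : ∀ i j, restrict (inf_le_left : V i ⊓ V j ≤ V i) (s i)
      = restrict (inf_le_right : V i ⊓ V j ≤ V j) (s j)) :
    ∃ t : regularFunctions (⨆ i, V i), ∀ i, restrict (le_iSup V i) t = s i := by
  have hV : ∀ p : (⨆ i, V i : TopologicalSpace.Opens ModuliSpace), ∃ i, p.1 ∈ V i := fun p =>
    TopologicalSpace.Opens.mem_iSup.1 p.2
  choose c hc using hV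
  let f : (⨆ i, V i : TopologicalSpace.Opens ModuliSpace) → ℂ := fun p => (s (c p)).1 ⟨p.1, hc p⟩
  have hf : ∀ (i : ι) (p : (⨆ i, V i : TopologicalSpace.Opens ModuliSpace)) (hp : p.1 ∈ V i),
      f p = (s i).1 ⟨p.1, hp⟩ := fun i p hp =>
    congrFun (congrArg Subtype.val (hs (c p) i)) ⟨p.1, hc p, hp⟩
  refine ⟨⟨f, fun x hx => ?_⟩, fun i => ?_⟩
  · obtain ⟨i, hi⟩ := TopologicalSpace.Opens.mem_iSup.1 hx
    obtain ⟨W, hxW, P, Q, d, hP, hQ, h⟩ := (s i).2 x hi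
    refine ⟨W ⊓ ⟨_, (V i).2.preimage ModuliSpace.isQuotientMap_mk.continuous⟩, ⟨hxW, hi⟩, P, Q, d,
      hP, hQ, ?_⟩
    rintro x' ⟨hx'W, hx'V⟩
    refine ⟨(h x' hx'W).1, fun hV => ?_⟩
    rw [hf i ⟨_, hV⟩ hx'V]
    exact (h x' hx'W).2 hx'V
  · apply Subtype.ext
    ext p
    exact hf i _ p.2

section sheaf

variable {A : Type} [CommRing A] [Algebra ℂ A] (φ : A →ₐ[ℂ] regularFunctions ⊤)
  {B : Type} [Ring B] [Algebra A B]

theorem formBaseChange_res (f : B →ₗ[A] A) {V W : TopologicalSpace.Opens ModuliSpace} (h : V ≤ W)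
    (t : AlgebraSections φ B W) :
    formBaseChange (Functions φ V) f (AlgebraSections.res φ B h t)
      = Functions.res φ h (formBaseChange (Functions φ W) f t) := by
  induction t using TensorProduct.induction_on with
  | zero => simp only [map_zero]
  | tmul r b =>
    rw [AlgebraSections.res, Algebra.TensorProduct.map_tmul, formBaseChange_tmul,
      formBaseChange_tmul, map_smul, AlgHom.id_apply]
  | add x y hx hy => simp only [map_add, hx, hy]

/-- A dual basis gives every section coordinates that are regular functions and commute with
restriction; sections are therefore glued, and compared, coordinate by coordinate. -/
theorem HasTraces.isSheafOfAzumayaAlgebras (h : HasTraces A B) :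
    IsSheafOfAzumayaAlgebras φ B where
  isAzumaya V := (h.baseChange (Functions φ V)).isAzumaya
  existsUnique_glue ι V s hs := by
    obtain ⟨n, e, f, hef⟩ := h.exists_dualBasis
    have key : ∀ k, ∃ t : Functions φ (⨆ i, V i), ∀ i,
        Functions.res φ (le_iSup V i) t = formBaseChange (Functions φ (V i)) (f k) (s i) := by
      intro k
      refine exists_glue_regularFunctions V
        (fun i => formBaseChange (Functions φ (V i)) (f k) (s i)) fun i j => ?_
      have := congrArg (formBaseChange (Functions φ (V i ⊓ V j)) (f k)) (hs i j)
      rw [formBaseChange_res, formBaseChange_res] at this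
      exact this
    choose c hc using key
    refine ⟨∑ k, c k ⊗ₜ e k, fun i => ?_, fun t ht => ?_⟩
    · rw [map_sum, eq_sum_formBaseChange _ hef (s i)]
      refine Finset.sum_congr rfl fun k _ => ?_
      rw [AlgebraSections.res, Algebra.TensorProduct.map_tmul, hc, AlgHom.id_apply]
    · rw [eq_sum_formBaseChange _ hef t]
      refine Finset.sum_congr rfl fun k _ => ?_
      congr 1
      refine Subtype.ext ?_
      ext p
      obtain ⟨i, hi⟩ := TopologicalSpace.Opens.mem_iSup.1 p.2
      have h1 := hc k i
      rw [← ht i, formBaseChange_res] at h1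
      exact (congrFun (congrArg (fun z : regularFunctions (V i) => z.1) h1) ⟨p.1, hi⟩).symm

end sheaf

/-! ## Traces on quantum tori -/

section traces

open MulOpposite

variable {R B : Type*} [CommRing R] [Ring B] [Algebra R B]

/-- Left multiplication, as an element of the enveloping algebra. -/
def lft (R : Type*) {B : Type*} [CommRing R] [Ring B] [Algebra R B] (b : B) : B ⊗[R] Bᵐᵒᵖ := b ⊗ₜ 1

/-- Right multiplication, as an element of the enveloping algebra. -/
def rgt (R : Type*) {B : Type*} [CommRing R] [Ring B] [Algebra R B] (b : B) : B ⊗[R] Bᵐᵒᵖ :=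
  1 ⊗ₜ op b

theorem lft_mul (a b : B) : lft R (a * b) = lft R a * lft R b := by simp [lft]

theorem rgt_mul (a b : B) : rgt R (a * b) = rgt R b * rgt R a := by simp [rgt]

theorem lft_smul (r : R) (b : B) : lft R (r • b) = r • lft R b := by
  simp [lft, TensorProduct.smul_tmul']

theorem rgt_smul (r : R) (b : B) : rgt R (r • b) = r • rgt R b := by
  simp [rgt]

theorem lft_one : lft R (1 : B) = 1 := rfl

theorem rgt_one : rgt R (1 : B) = 1 := rfl

theorem lft_add (a b : B) : lft R (a + b) = lft R a + lft R b := TensorProduct.add_tmul _ _ _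

theorem rgt_add (a b : B) : rgt R (a + b) = rgt R a + rgt R b := TensorProduct.tmul_add _ _ _

theorem commute_lft_rgt (a b : B) : Commute (lft R a) (rgt R b) := by
  simp [Commute, SemiconjBy, lft, rgt]

/-- The elements of `B` whose left and right multiplications agree after composition with `t`. -/
def invariance (t : B ⊗[R] Bᵐᵒᵖ) : Subalgebra R B where
  carrier := { b | lft R b * t = rgt R b * t }
  mul_mem' {a b} ha hb := by
    change lft R (a * b) * t = rgt R (a * b) * t
    rw [lft_mul, rgt_mul, mul_assoc, show lft R b * t = rgt R b * t from hb, ← mul_assoc,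
      (commute_lft_rgt a b).eq, mul_assoc, mul_assoc, show lft R a * t = rgt R a * t from ha]
  add_mem' {a b} ha hb := by
    change lft R (a + b) * t = rgt R (a + b) * t
    rw [lft_add, rgt_add, add_mul, add_mul, show lft R b * t = rgt R b * t from hb,
      show lft R a * t = rgt R a * t from ha]
  algebraMap_mem' r := by
    change lft R _ * t = rgt R _ * t
    rw [Algebra.algebraMap_eq_smul_one, lft_smul, rgt_smul, lft_one, rgt_one]

theorem mem_invariance {t : B ⊗[R] Bᵐᵒᵖ} {b : B} :
    b ∈ invariance t ↔ lft R b * t = rgt R b * t := Iff.rfl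

theorem mem_invariance_smul {t : B ⊗[R] Bᵐᵒᵖ} {b : B} {r : R} (h : r • b ∈ invariance t) :
    b ∈ invariance (r • t) := by
  rw [mem_invariance, lft_smul, rgt_smul, smul_mul_assoc, smul_mul_assoc] at h
  rw [mem_invariance, mul_smul_comm, mul_smul_comm, h]

theorem invariance_le_smul (t : B ⊗[R] Bᵐᵒᵖ) (r : R) : invariance t ≤ invariance (r • t) :=
  fun _ hb => mem_invariance_smul ((invariance t).smul_mem hb r)

theorem invariance_le_mul (t s : B ⊗[R] Bᵐᵒᵖ) : invariance t ≤ invariance (t * s) := by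
  intro b hb
  rw [mem_invariance] at hb ⊢
  rw [← mul_assoc, hb, mul_assoc]

/-- The span of the elements `a t` with `a` in `B` and `t` annihilated by all commutators. -/
def traceSpan (R B : Type*) [CommRing R] [Ring B] [Algebra R B] : Submodule R (B ⊗[R] Bᵐᵒᵖ) :=
  Submodule.span R { x | ∃ (e : B) (t : B ⊗[R] Bᵐᵒᵖ), invariance t = ⊤ ∧ x = lft R e * t }

theorem exists_form_of_invariance (hc : ∀ b : B, (∀ a, Commute a b) → ∃ r, algebraMap R B r = b)
    -- Invariance says `a · t(x) = t(x) · a` for all `a`, so `t` takes central values, which are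
    -- scalars.
    (hinj : Function.Injective (algebraMap R B)) {t : B ⊗[R] Bᵐᵒᵖ} (ht : invariance t = ⊤) :
    ∃ f : B →ₗ[R] R, ∀ x, AlgHom.mulLeftRight R B t x = algebraMap R B (f x) := by
  have h : ∀ x, ∃ r, algebraMap R B r = AlgHom.mulLeftRight R B t x := by
    refine fun x => hc _ fun a => ?_
    have ha : a ∈ invariance t := by rw [ht]; trivial
    have h1 := congrArg (fun s => AlgHom.mulLeftRight R B s x) (mem_invariance.1 ha)
    simpa [lft, rgt, map_mul] using! h1
  choose f hf using h
  refine ⟨{ toFun := f, map_add' := fun x y => hinj ?_, map_smul' := fun r x => hinj ?_ },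
    fun x => (hf x).symm⟩
  · rw [map_add, hf, hf, hf, map_add]
  · rw [hf, map_smul, RingHom.id_apply, smul_eq_mul, map_mul, hf, Algebra.smul_def]

/-- Each invariant `t` defines a linear form. The values of linear forms at `1` constitute an ideal,
and `h2` makes it contain `1`, which yields the retraction. -/
theorem hasTraces_of_traceSpan (hc : ∀ b : B, (∀ a, Commute a b) → ∃ r, algebraMap R B r = b)
    (hinj : Function.Injective (algebraMap R B)) (h1 : 1 ∈ traceSpan R B)
    (h2 : Ideal.span { r : R | ∃ t : B ⊗[R] Bᵐᵒᵖ, invariance t = ⊤ ∧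
      AlgHom.mulLeftRight R B t 1 = algebraMap R B r } = ⊤) : HasTraces R B := by
  refine ⟨?_, ?_⟩
  · obtain ⟨n, r, g, hg⟩ := Submodule.mem_span_set'.1 h1
    choose e t ht he using fun i => (g i).2
    choose f hf using fun i => exists_form_of_invariance hc hinj (ht i)
    refine ⟨n, fun i => r i • e i, t, f, fun i b => ?_, hf, ?_⟩
    · have hb : b ∈ invariance (t i) := by rw [ht i]; trivial
      exact hb
    · rw [← hg]
      refine Finset.sum_congr rfl fun i _ => ?_
      rw [he i, ← smul_mul_assoc, ← lft_smul]
      rfl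
  · have h3 : (⊤ : Ideal R) ≤ LinearMap.range (LinearMap.applyₗ (R := R) (M₂ := R) (1 : B)) := by
      rw [← h2, Ideal.span, Submodule.span_le]
      rintro r ⟨t, ht, htr⟩
      obtain ⟨f, hf⟩ := exists_form_of_invariance hc hinj ht
      exact ⟨f, hinj ((hf 1).symm.trans htr)⟩
    exact h3 (x := 1) trivial

/-- Averaging over the powers of `U`. -/
def powerTrace (R : Type*) {B : Type*} [CommRing R] [Ring B] [Algebra R B] (l : ℕ) (U : B) :
    B ⊗[R] Bᵐᵒᵖ :=
  ∑ i ∈ Finset.range l, lft R (U ^ i) * rgt R (U ^ (l - i))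

/-- Left and right multiplication by `U` give sums differing only by a shift of the index; the end
terms agree because the scalar `U^l` passes through the tensor. -/
theorem self_mem_invariance_powerTrace {l : ℕ} {U : B} {z : R} (hU : U ^ l = algebraMap R B z) :
    U ∈ invariance (powerTrace R l U) := by
  let g : ℕ → B ⊗[R] Bᵐᵒᵖ := fun i => lft R (U ^ i) * rgt R (U ^ (l + 1 - i))
  have e1 : lft R U * powerTrace R l U = ∑ i ∈ Finset.range l, g (i + 1) := by
    rw [powerTrace, Finset.mul_sum]
    refine Finset.sum_congr rfl fun i _ => ?_
    simp only [g]
    rw [← mul_assoc, ← lft_mul, ← pow_succ', Nat.add_sub_add_right]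
  have e2 : rgt R U * powerTrace R l U = ∑ i ∈ Finset.range l, g i := by
    rw [powerTrace, Finset.mul_sum]
    refine Finset.sum_congr rfl fun i hi => ?_
    rw [Finset.mem_range] at hi
    simp only [g]
    rw [← mul_assoc, ← (commute_lft_rgt _ _).eq, mul_assoc, ← rgt_mul, ← pow_succ,
      show l - i + 1 = l + 1 - i by omega]
  have e3 : g 0 = g l := by
    simp only [g]
    rw [pow_zero, lft_one, one_mul, Nat.sub_zero, show l + 1 - l = 1 by omega, pow_one, pow_succ,
      hU, Algebra.algebraMap_eq_smul_one, smul_mul_assoc, one_mul, lft_smul, rgt_smul, lft_one,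
      smul_mul_assoc, one_mul]
  have e4 := Finset.sum_range_succ g l
  rw [Finset.sum_range_succ', e3] at e4
  rw [mem_invariance, e1, e2, add_right_cancel e4]

theorem mul_pow_of_commute_up_to {ζ : R} {U V : B} (h : V * U = ζ • (U * V)) (a b : ℕ) :
    V ^ b * U ^ a = (ζ ^ (b * a)) • (U ^ a * V ^ b) := by
  have h1 : ∀ a, V * U ^ a = (ζ ^ a) • (U ^ a * V) := by
    intro a
    induction a with
    | zero => simp
    | succ a ih =>
      rw [pow_succ, ← mul_assoc, ih, smul_mul_assoc, mul_assoc, h, mul_smul_comm, smul_smul,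
        ← pow_succ, mul_assoc]
  induction b with
  | zero => simp
  | succ b ih =>
    rw [pow_succ, mul_assoc, h1, mul_smul_comm, ← mul_assoc, ih, smul_mul_assoc, smul_smul,
      mul_assoc, ← pow_add, add_mul, one_mul, add_comm]

/-- Moving `V` past the average on either side produces the same twisted sum `τ`, since `ζ^i ζ^(l-i)
= 1`; the invariance of `s` then finishes. -/
theorem mem_invariance_powerTrace_mul {l : ℕ} {ζ : R} {U V : B} (hζ : ζ ^ l = 1)
    (h : V * U = ζ • (U * V)) {s : B ⊗[R] Bᵐᵒᵖ} (hs : V ∈ invariance s) :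
    V ∈ invariance (powerTrace R l U * s) := by
  let τ : B ⊗[R] Bᵐᵒᵖ := ∑ i ∈ Finset.range l, (ζ ^ i) • (lft R (U ^ i) * rgt R (U ^ (l - i)))
  have h' : ∀ a, V * U ^ a = (ζ ^ a) • (U ^ a * V) := fun a => by
    have := mul_pow_of_commute_up_to h a 1
    rwa [pow_one, one_mul] at this
  have e1 : lft R V * powerTrace R l U = τ * lft R V := by
    rw [powerTrace, Finset.mul_sum, Finset.sum_mul]
    refine Finset.sum_congr rfl fun i _ => ?_
    rw [← mul_assoc, ← lft_mul, h', lft_smul, lft_mul, smul_mul_assoc, smul_mul_assoc, mul_assoc,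
      (commute_lft_rgt V _).eq, mul_assoc]
  have e2 : rgt R V * powerTrace R l U = τ * rgt R V := by
    rw [powerTrace, Finset.mul_sum, Finset.sum_mul]
    refine Finset.sum_congr rfl fun i hi => ?_
    rw [Finset.mem_range] at hi
    rw [smul_mul_assoc, mul_assoc (lft R _), ← rgt_mul, h', rgt_smul, mul_smul_comm, smul_smul,
      ← pow_add, show i + (l - i) = l by omega, hζ, one_smul, rgt_mul, ← mul_assoc,
      ← (commute_lft_rgt _ _).eq, mul_assoc]
  rw [mem_invariance] at hs ⊢
  rw [← mul_assoc, e1, mul_assoc, hs, ← mul_assoc, ← e2, mul_assoc]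

/-- Passing `V^b` through scales the `i`-th term by `ζ^(ib)`, so the sum over `b` leaves only `i =
0`. -/
theorem sum_lft_powerTrace {l : ℕ} (hl : 0 < l) {ζ : R} {U V : B} {z z' : R}
    (hζ : ∀ i, 0 < i → i < l → ∑ b ∈ Finset.range l, (ζ ^ i) ^ b = 0)
    (h : V * U = ζ • (U * V)) (hU : U ^ l = algebraMap R B z) (hV : V ^ l = algebraMap R B z') :
    ∑ b ∈ Finset.range l, lft R (V ^ b) * powerTrace R l U * lft R (V ^ (l - b))
      = ((l : R) * (z * z')) • 1 := by
  have e1 : ∀ b ∈ Finset.range l, lft R (V ^ b) * powerTrace R l U * lft R (V ^ (l - b))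
      = ∑ i ∈ Finset.range l, ((ζ ^ i) ^ b) • (lft R (U ^ i * V ^ l) * rgt R (U ^ (l - i))) := by
    intro b hb
    rw [Finset.mem_range] at hb
    rw [powerTrace, Finset.mul_sum, Finset.sum_mul]
    refine Finset.sum_congr rfl fun i _ => ?_
    rw [← mul_assoc, ← lft_mul, mul_assoc, ← (commute_lft_rgt _ _).eq, ← mul_assoc, ← lft_mul,
      mul_pow_of_commute_up_to h, smul_mul_assoc, mul_assoc, ← pow_add,
      show b + (l - b) = l by omega, lft_smul, smul_mul_assoc, ← pow_mul, mul_comm i b]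
  rw [Finset.sum_congr rfl e1, Finset.sum_comm, Finset.sum_eq_single_of_mem 0 (by simpa using hl)]
  · simp only [pow_zero, one_pow, one_smul, one_mul, Nat.sub_zero, Finset.sum_const,
      Finset.card_range]
    rw [hU, hV, Algebra.algebraMap_eq_smul_one, Algebra.algebraMap_eq_smul_one, lft_smul, rgt_smul,
      lft_one, rgt_one, smul_mul_smul_comm, mul_one, ← Nat.cast_smul_eq_nsmul R, smul_smul,
      mul_comm z']
  · intro i hi hi0
    rw [← Finset.sum_smul, hζ i (Nat.pos_of_ne_zero hi0) (by simpa using hi), zero_smul]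

theorem mem_traceSpan_of_torus {l : ℕ} (hl : 0 < l) {ζ ζ' : R} {U V : B} {z z' r : R}
    (hζζ : ζ * ζ' = 1)
    (hζ : ∀ i, 0 < i → i < l → ∑ b ∈ Finset.range l, (ζ ^ i) ^ b = 0)
    (hζ' : ∀ i, 0 < i → i < l → ∑ b ∈ Finset.range l, (ζ' ^ i) ^ b = 0)
    (h : V * U = ζ • (U * V)) (hU : U ^ l = algebraMap R B z) (hV : V ^ l = algebraMap R B z')
    (ht : invariance (r • (powerTrace R l U * powerTrace R l V)) = ⊤) :
    (r * ((l : R) * (z * z')) ^ 2) • 1 ∈ traceSpan R B := by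
  have h' : U * V = ζ' • (V * U) := by rw [h, smul_smul, mul_comm, hζζ, one_smul]
  -- The inner sum, over powers of `V`, removes the average over `U`; the outer sum removes the
  -- average over `V` with `ζ'` in place of `ζ`. Each pass contributes `l z z'`.
  have e1 : ∑ a ∈ Finset.range l, ∑ b ∈ Finset.range l, lft R (U ^ a * V ^ b) *
      ((r • (powerTrace R l U * powerTrace R l V)) * lft R (V ^ (l - b) * U ^ (l - a)))
        = (r * ((l : R) * (z * z')) ^ 2) • 1 := by
    have comm : ∀ b, powerTrace R l V * lft R (V ^ b) = lft R (V ^ b) * powerTrace R l V := by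
      intro b
      rw [powerTrace, Finset.sum_mul, Finset.mul_sum]
      refine Finset.sum_congr rfl fun i _ => ?_
      rw [mul_assoc, ← (commute_lft_rgt _ _).eq, ← mul_assoc, ← mul_assoc, ← lft_mul, ← lft_mul,
        ← pow_add, ← pow_add, add_comm]
    have e2 : ∀ a, ∑ b ∈ Finset.range l, lft R (U ^ a * V ^ b) *
      ((r • (powerTrace R l U * powerTrace R l V)) * lft R (V ^ (l - b) * U ^ (l - a)))
        = (r * ((l : R) * (z * z'))) • (lft R (U ^ a) * powerTrace R l V * lft R (U ^ (l - a))) := by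
      intro a
      have e3 := congrArg (fun x => r • (lft R (U ^ a) * (x * powerTrace R l V) * lft R (U ^ (l - a))))
        (sum_lft_powerTrace hl hζ h hU hV)
      simp only [Finset.sum_mul, Finset.mul_sum, Finset.smul_sum, smul_mul_assoc, mul_smul_comm,
        one_mul, smul_smul] at e3
      rw [← e3]
      refine Finset.sum_congr rfl fun b _ => ?_
      rw [lft_mul, lft_mul, smul_mul_assoc, mul_smul_comm]
      congr 1
      simp only [mul_assoc]
      rw [← mul_assoc (powerTrace R l V), comm]
      simp only [mul_assoc]
    rw [Finset.sum_congr rfl fun a _ => e2 a, ← Finset.smul_sum,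
      sum_lft_powerTrace hl hζ' h' hV hU, smul_smul]
    congr 1
    ring
  rw [← e1]
  refine Submodule.sum_mem _ fun a _ => Submodule.sum_mem _ fun b _ => Submodule.subset_span
    ⟨_, _, ?_, rfl⟩
  exact top_unique (ht ▸ invariance_le_mul _ _)

theorem mulLeftRight_powerTrace {l : ℕ} {U : B} {z : R} (hU : U ^ l = algebraMap R B z) (r : R) :
    AlgHom.mulLeftRight R B (powerTrace R l U) (r • 1) = ((l : R) * z * r) • 1 := by
  have e : ∀ i ∈ Finset.range l, AlgHom.mulLeftRight R B (lft R (U ^ i) * rgt R (U ^ (l - i)))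
      (r • 1) = (z * r) • 1 := by
    intro i hi
    rw [Finset.mem_range] at hi
    rw [map_mul, Module.End.mul_apply, lft, rgt, AlgHom.mulLeftRight_apply,
      AlgHom.mulLeftRight_apply, unop_op, unop_one, mul_one, one_mul, smul_mul_assoc, one_mul,
      mul_smul_comm, ← pow_add, show i + (l - i) = l by omega, hU, Algebra.algebraMap_eq_smul_one,
      smul_smul, mul_comm]
  rw [powerTrace, map_sum, LinearMap.sum_apply, Finset.sum_congr rfl e, Finset.sum_const,
    Finset.card_range, ← Nat.cast_smul_eq_nsmul R, smul_smul, mul_assoc]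

end traces

/-! ### Traces for algebras with quantum pentagon relations -/

section pentagon

variable {R B : Type*} [CommRing R] [Ring B] [Algebra R B]

/-- Five elements of an algebra subject to the quantum pentagon relations, with central `l`-th
powers. -/
structure QuantumPentagon (l : ℕ) (ζ a b : R) (Y : ZMod 5 → B) (z : ZMod 5 → R) : Prop where
  pow : ∀ k, Y k ^ l = algebraMap R B (z k)
  comm : ∀ k, Y (k + 1) * Y k = ζ • (Y k * Y (k + 1))
  mul_add_two : ∀ k, Y k * Y (k + 2) = 1 + a • Y (k + 1)
  add_two_mul : ∀ k, Y (k + 2) * Y k = 1 + b • Y (k + 1)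
  adjoin : Algebra.adjoin R (Set.range Y) = ⊤

variable {l : ℕ} {ζ a b : R} {Y : ZMod 5 → B} {z : ZMod 5 → R}

/-- The product of averages is invariant under `Y k` and `Y (k + 1)`. A pentagon relation then gives
a further generator after multiplication by `z j`, since `z j • x = Y j ^ (l - 1) * (Y j * x)`. The
factor `z k` reaches `Y (k + 2)`, and `z (k + 1)` reaches `Y (k + 3)` and `Y (k + 4)`. -/
theorem QuantumPentagon.invariance_eq_top (H : QuantumPentagon l ζ a b Y z) (hl : 0 < l)
    (hζ : ζ ^ l = 1) (k : ZMod 5) :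
    invariance ((z (k + 1) * z k) • (powerTrace R l (Y k) * powerTrace R l (Y (k + 1)))) = ⊤ := by
  set t : B ⊗[R] Bᵐᵒᵖ := powerTrace R l (Y k) * powerTrace R l (Y (k + 1)) with ht
  have hU : Y k ∈ invariance t :=
    invariance_le_mul _ _ (self_mem_invariance_powerTrace (H.pow k))
  have hV : Y (k + 1) ∈ invariance t :=
    mem_invariance_powerTrace_mul hζ (H.comm k) (self_mem_invariance_powerTrace (H.pow (k + 1)))
  have hsmul : ∀ (s : B ⊗[R] Bᵐᵒᵖ) (c : R) {x : B}, x ∈ invariance s →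
      1 + c • x ∈ invariance s :=
    fun s c x hx => add_mem (one_mem _) ((invariance s).smul_mem hx c)
  have hpow : ∀ (s : B ⊗[R] Bᵐᵒᵖ) (j : ZMod 5) {x : B}, Y j ∈ invariance s →
      Y j * x ∈ invariance s → x ∈ invariance (z j • s) := by
    intro s j x hj hjx
    apply mem_invariance_smul
    have e : z j • x = Y j ^ (l - 1) * (Y j * x) := by
      rw [Algebra.smul_def, ← H.pow, ← mul_assoc, ← pow_succ, Nat.sub_add_cancel hl]
    rw [e]
    exact mul_mem (pow_mem hj _) hjx
  have k4 : k + 4 + 2 = k + 1 := by rw [add_assoc, show (4 : ZMod 5) + 2 = 1 by decide]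
  have k5 : k + 4 + 1 = k := by rw [add_assoc, show (4 : ZMod 5) + 1 = 0 by decide, add_zero]
  have r3 := H.mul_add_two (k + 1)
  rw [show k + 1 + 2 = k + 3 by ring, show k + 1 + 1 = k + 2 by ring] at r3
  have r4 := H.add_two_mul (k + 4)
  rw [k4, k5] at r4
  have h2 : Y (k + 2) ∈ invariance (z k • t) :=
    hpow t k hU (by rw [H.mul_add_two]; exact hsmul _ _ hV)
  have h3 : Y (k + 3) ∈ invariance (z (k + 1) • z k • t) :=
    hpow _ _ (invariance_le_smul _ _ hV) (by rw [r3]; exact hsmul _ _ h2)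
  have h4 : Y (k + 4) ∈ invariance (z (k + 1) • z k • t) :=
    hpow _ _ (invariance_le_smul _ _ hV) (by
      rw [r4]; exact hsmul _ _ (invariance_le_smul _ _ hU))
  have hall : ∀ j, Y j ∈ invariance (z (k + 1) • z k • t) := by
    intro j
    have hj : j = k ∨ j = k + 1 ∨ j = k + 2 ∨ j = k + 3 ∨ j = k + 4 := by
      clear * -
      revert j k
      decide
    rcases hj with rfl | rfl | rfl | rfl | rfl
    · exact invariance_le_smul _ _ (invariance_le_smul _ _ hU)
    · exact invariance_le_smul _ _ (invariance_le_smul _ _ hV)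
    · exact invariance_le_smul _ _ h2
    · exact h3
    · exact h4
  rw [mul_smul, eq_top_iff, ← H.adjoin, Algebra.adjoin_le_iff]
  rintro _ ⟨j, rfl⟩
  exact hall j

/-- Each quantum torus yields the required data up to `l² (z_k z_{k+1})³` for the identity and `l²
(z_k z_{k+1})²` for the retraction. Powers of elements generating the unit ideal still generate it,
and `l` is invertible. -/
theorem QuantumPentagon.hasTraces (H : QuantumPentagon l ζ a b Y z) (hl : 0 < l)
    (hζ1 : ζ ^ l = 1) {ζ' : R} (hζζ : ζ * ζ' = 1)
    (hζ : ∀ i, 0 < i → i < l → ∑ b ∈ Finset.range l, (ζ ^ i) ^ b = 0)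
    (hζ' : ∀ i, 0 < i → i < l → ∑ b ∈ Finset.range l, (ζ' ^ i) ^ b = 0)
    (hlunit : IsUnit (l : R))
    (hc : ∀ b : B, (∀ a, Commute a b) → ∃ r, algebraMap R B r = b)
    (hinj : Function.Injective (algebraMap R B))
    (hz : Ideal.span (Set.range fun k => z k * z (k + 1)) = ⊤) : HasTraces R B := by
  have hideal : ∀ (n : ℕ) (I : Ideal R),
      (∀ k, (l : R) ^ 2 * (z k * z (k + 1)) ^ n ∈ I) → I = ⊤ := by
    intro n I hI
    rw [eq_top_iff, ← Ideal.span_pow_eq_top _ hz n, Ideal.span_le]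
    rintro _ ⟨_, ⟨k, rfl⟩, rfl⟩
    exact (Ideal.unit_mul_mem_iff_mem I (hlunit.pow 2)).1 (hI k)
  refine hasTraces_of_traceSpan hc hinj ?_ ?_
  · let I : Ideal R := (traceSpan R B).comap (LinearMap.toSpanSingleton R _ 1)
    have hI : I = ⊤ := by
      refine hideal 3 I fun k => ?_
      have h := mem_traceSpan_of_torus hl hζζ hζ hζ' (H.comm k) (H.pow k) (H.pow (k + 1))
        (H.invariance_eq_top hl hζ1 k)
      change (_ * _ : R) • (1 : B ⊗[R] Bᵐᵒᵖ) ∈ traceSpan R B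
      convert h using 2
      ring
    have h1 : (1 : R) ∈ I := by rw [hI]; trivial
    change (1 : R) • (1 : B ⊗[R] Bᵐᵒᵖ) ∈ traceSpan R B at h1
    rwa [one_smul] at h1
  · refine hideal 2 _ fun k => Ideal.subset_span ⟨_, H.invariance_eq_top hl hζ1 k, ?_⟩
    have e1 := mulLeftRight_powerTrace (H.pow (k + 1)) 1
    rw [one_smul, mul_one] at e1
    rw [map_smul, LinearMap.smul_apply, map_mul, Module.End.mul_apply, e1,
      mulLeftRight_powerTrace (H.pow k), smul_smul, Algebra.algebraMap_eq_smul_one]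
    congr 1
    ring

end pentagon

/-! ## The algebra `L_q` over its center -/

/-- A maximal ideal containing all these products would contain at least one of any two neighbours,
but never both, as `w_k w_{k+2} - w_{k+1} = 1`. Such an alternation is impossible on a cycle of odd
length. -/
theorem IsPentagon.span_mul_eq_top {A : Type*} [CommRing A] {w : ZMod 5 → A} (hw : IsPentagon w) :
    Ideal.span (Set.range fun k => w k * w (k + 1)) = ⊤ := by
  by_contra h
  obtain ⟨m, hm, hle⟩ := Ideal.exists_le_maximal _ h
  have h1 : ∀ k, w k ∈ m ∨ w (k + 1) ∈ m := fun k =>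
    hm.isPrime.mem_or_mem (hle (Ideal.subset_span ⟨k, rfl⟩))
  have h2 : ∀ k, w k ∈ m → w (k + 1) ∉ m := by
    intro k h0 h1
    apply hm.ne_top
    rw [Ideal.eq_top_iff_one]
    have h3 := m.sub_mem (m.mul_mem_right (w (k + 2)) h0) h1
    rwa [hw k, add_sub_cancel_right] at h3
  have a0 : w 0 ∈ m ∨ w 1 ∈ m := h1 0
  have a1 : w 1 ∈ m ∨ w 2 ∈ m := h1 1
  have a2 : w 2 ∈ m ∨ w 3 ∈ m := h1 2
  have a3 : w 3 ∈ m ∨ w 4 ∈ m := h1 3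
  have a4 : w 4 ∈ m ∨ w 0 ∈ m := h1 4
  have b0 : w 0 ∈ m → w 1 ∉ m := h2 0
  have b1 : w 1 ∈ m → w 2 ∉ m := h2 1
  have b2 : w 2 ∈ m → w 3 ∉ m := h2 2
  have b3 : w 3 ∈ m → w 4 ∉ m := h2 3
  have b4 : w 4 ∈ m → w 0 ∉ m := h2 4
  tauto

theorem quantumPentagon_yL {q : ℂˣ} {l : ℕ} (hq2 : ((q : ℂ) ^ 2) ^ l = 1) (hl : 0 < l) :
    QuantumPentagon (R := Subalgebra.center ℂ (L q)) l
      (algebraMap ℂ (Subalgebra.center ℂ (L q)) ((q : ℂ) ^ 2))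
      (algebraMap ℂ (Subalgebra.center ℂ (L q)) (q : ℂ)⁻¹)
      (algebraMap ℂ (Subalgebra.center ℂ (L q)) (q : ℂ)) (yL q)
      (fun k => ⟨yL q k ^ l, yL_pow_mem_center hl hq2 k⟩) where
  pow _ := rfl
  comm k := Subtype.ext ((y_add_one_mul q k).trans (Algebra.smul_def _ _))
  mul_add_two k := Subtype.ext ((y_mul_add_two q k).trans
    (congrArg (1 + ·) (Algebra.smul_def _ _)))
  add_two_mul k := Subtype.ext ((y_add_two_mul q k).trans
    (congrArg (1 + ·) (Algebra.smul_def _ _)))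
  adjoin := by
    rw [eq_top_iff]
    intro b _
    have hb : b ∈ Algebra.adjoin ℂ (Set.range (yL q)) := by rw [adjoin_yL]; trivial
    induction hb using Algebra.adjoin_induction with
    | mem x hx => exact Algebra.subset_adjoin hx
    | algebraMap r =>
      exact Subalgebra.algebraMap_mem _ (algebraMap ℂ (Subalgebra.center ℂ (L q)) r)
    | add x y _ _ hx hy => exact add_mem (hx trivial) (hy trivial)
    | mul x y _ _ hx hy => exact mul_mem (hx trivial) (hy trivial)

theorem hasTraces_L {q : ℂˣ} {l : ℕ} (hl : 0 < l) (hq2 : IsPrimitiveRoot ((q : ℂ) ^ 2) l) {ε : ℂ}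
    (hε : (-(q : ℂ)) ^ l = -ε) (hεε : ε * ε = 1) :
    HasTraces (Subalgebra.center ℂ (L q)) (L q) := by
  have hζ : ∀ {ζ : ℂ}, IsPrimitiveRoot ζ l → ∀ i, 0 < i → i < l →
      ∑ b ∈ Finset.range l, ((algebraMap ℂ (Subalgebra.center ℂ (L q)) ζ) ^ i) ^ b = 0 := by
    intro ζ hζ i hi hil
    have h1 : ζ ^ i ≠ 1 := hζ.pow_ne_one_of_pos_of_lt hi.ne' hil
    have h2 : ∑ b ∈ Finset.range l, (ζ ^ i) ^ b = 0 := by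
      rw [geom_sum_eq h1, ← pow_mul, mul_comm, pow_mul, hζ.pow_eq_one, one_pow, sub_self, zero_div]
    have h3 := congrArg (algebraMap ℂ (Subalgebra.center ℂ (L q))) h2
    simpa only [map_sum, map_pow, map_zero] using h3
  refine (quantumPentagon_yL hq2.pow_eq_one hl).hasTraces hl ?_
    (ζ' := algebraMap ℂ _ ((q : ℂ) ^ 2)⁻¹) ?_ (hζ hq2) (hζ hq2.inv) ?_
    (fun b hb => ⟨⟨b, Subalgebra.mem_center_iff.2 fun a => hb a⟩, rfl⟩) Subtype.val_injective ?_
  · rw [← map_pow, hq2.pow_eq_one, map_one]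
  · rw [← map_mul, mul_inv_cancel₀ (pow_ne_zero 2 q.ne_zero), map_one]
  · simpa only [map_natCast] using
      (Nat.cast_ne_zero (R := ℂ).2 hl.ne').isUnit.map (algebraMap ℂ (Subalgebra.center ℂ (L q)))
  -- The classical pentagon relations hold for `ε yₖˡ`, whereas the traces use `yₖˡ`; products of
  -- two generators agree since `ε² = 1`.
  · rw [← (presentedByPentagon_centralGen hl hq2 hε hεε).isPentagon.span_mul_eq_top]
    congr 2
    funext k
    refine Eq.symm (Subtype.ext ?_)
    change (ε • yL q k ^ l) * (ε • yL q (k + 1) ^ l) = yL q k ^ l * yL q (k + 1) ^ l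
    rw [smul_mul_smul_comm, hεε, one_smul]

/-! ## The isomorphism on basis elements -/

/-- The index `3 * c + 2` inverts `k ↦ 2 * k + 1` modulo 5; its successor is based at `c + 2`, and
sign changes of areas cancel in pairs. -/
theorem classicalX_eq_cross (m n : ℕ) (c : ZMod 5) (x : Config) :
    classicalX m n c x = x.cross (3 * c + 2) ^ m * x.cross (3 * c + 2 + 1) ^ n := by
  have h1 : x.cross (3 * c + 2) = crossRatio (x.1 (c + 1)) (x.1 (c + 2)) (x.1 (c + 3)) (x.1 c) := by
    have e : 2 * (3 * c + 2) + 1 = c := by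
      revert c
      decide
    simp only [Config.cross, crossCoord, crossRatio, bracket_eq, e]
  have h2 : x.cross (3 * c + 2 + 1)
      = crossRatio (x.1 c) (x.1 (c + 2)) (x.1 (c + 3)) (x.1 (c + 4)) := by
    have e : 2 * (3 * c + 2 + 1) + 1 = c + 2 ∧ c + 2 + 1 = c + 3 ∧ c + 2 + 2 = c + 4 ∧
        c + 2 + 3 = c := by
      clear * -
      revert c
      decide
    obtain ⟨e0, e1, e2, e3⟩ := e
    simp only [Config.cross, crossCoord, crossRatio, bracket_eq, e0, e1, e2, e3]
    rw [area_swap (x.1 (c + 3)).rep (x.1 (c + 2)).rep, area_swap (x.1 (c + 4)).rep (x.1 c).rep,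
      neg_mul_neg, mul_comm (area (x.1 (c + 3)).rep _),
      mul_comm (area (x.1 (c + 2)).rep (x.1 (c + 3)).rep)]
  rw [classicalX, h1, h2]

/-- The sign `ε^(m+n)` compensates the normalization `ε yₖˡ`, and `ε^(mn)` is the prefactor `q^(lm ·
ln)` of the basis element. -/
theorem coe_smul_centralGen_pow {q : ℂˣ} {l : ℕ} (hl : 0 < l)
    (hq2 : IsPrimitiveRoot ((q : ℂ) ^ 2) l) {ε : ℂ} (hεε : ε * ε = 1)
    (hqll : (q : ℂ) ^ (l * l) = ε) (m n : ℕ) (c : ZMod 5) :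
    ((ε ^ (m + n + m * n) • (centralGen hl hq2 ε (3 * c + 2) ^ m *
      centralGen hl hq2 ε (3 * c + 2 + 1) ^ n) : Subalgebra.center ℂ (L q)) : L q)
      = basisElt q (l * m) (l * n) c := by
  change ε ^ (m + n + m * n) • ((ε • yL q (3 * c + 2) ^ l) ^ m *
    (ε • yL q (3 * c + 2 + 1) ^ l) ^ n) = _
  rw [basisElt_eq, smul_pow, smul_pow, smul_mul_smul_comm, smul_smul, ← pow_mul, ← pow_mul]
  congr 1
  rw [show l * m * (l * n) = l * l * (m * n) by ring, pow_mul, hqll, pow_add, pow_add]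
  calc ε ^ m * ε ^ n * ε ^ (m * n) * (ε ^ m * ε ^ n)
      = (ε * ε) ^ m * (ε * ε) ^ n * ε ^ (m * n) := by rw [mul_pow, mul_pow]; ring
    _ = ε ^ (m * n) := by rw [hεε, one_pow, one_pow, one_mul, one_mul]

/-- The order of `q ^ 2` and the signs attached to a primitive `N`-th root of unity `q`. -/
theorem primitiveRoot_signs {N : ℕ} (hN : 0 < N) {q : ℂ} (hq : IsPrimitiveRoot q N) {l : ℕ}
    (hl : l = if Even N then N / 2 else N) {ε : ℂ} (hε : ε = if N % 4 = 2 then -1 else 1) :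
    0 < l ∧ IsPrimitiveRoot (q ^ 2) l ∧ (-q) ^ l = -ε ∧ ε * ε = 1 ∧ q ^ (l * l) = ε := by
  by_cases hev : Even N
  · obtain ⟨r, hr⟩ := hev.two_dvd
    have hlr : l = r := by rw [hl, if_pos hev]; omega
    subst hlr
    have hl0 : 0 < l := by omega
    have hql : q ^ l = -1 := by
      have h1 : (q ^ l - 1) * (q ^ l + 1) = 0 := by
        have h2 := hq.pow_eq_one
        rw [hr, mul_comm, pow_mul] at h2
        linear_combination h2
      rcases mul_eq_zero.1 h1 with h | h
      · exact absurd (sub_eq_zero.1 h) (hq.pow_ne_one_of_pos_of_lt hl0.ne' (by omega))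
      · exact eq_neg_of_add_eq_zero_left h
    refine ⟨hl0, hq.pow hN hr, ?_⟩
    -- As `q^l = -1`, the remaining quantities are `(-q)^l = -(-1)^l` and `q^(l·l) = (-1)^l`; both
    -- depend on the parity of `l = N/2`, odd exactly when `N ≡ 2` modulo 4.
    rw [neg_pow, pow_mul, hql]
    rcases Nat.even_or_odd l with hle | hlo
    · have hmod : N % 4 ≠ 2 := by
        obtain ⟨s, hs⟩ := hle
        omega
      rw [hε, if_neg hmod, hle.neg_one_pow]
      norm_num
    · have hmod : N % 4 = 2 := by
        obtain ⟨s, hs⟩ := hlo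
        omega
      rw [hε, if_pos hmod, hlo.neg_one_pow]
      norm_num
  · have hodd := Nat.not_even_iff_odd.1 hev
    rw [if_neg hev] at hl
    subst hl
    have hmod : l % 4 ≠ 2 := by
      obtain ⟨s, hs⟩ := hodd
      omega
    rw [if_neg hmod] at hε
    subst hε
    refine ⟨hN, hq.pow_of_coprime 2 (Nat.coprime_two_left.2 hodd), ?_, by norm_num, ?_⟩
    · rw [hodd.neg_pow, hq.pow_eq_one]
    · rw [pow_mul, hq.pow_eq_one, one_pow]

end QuantumM05

end

/-! ### The main theorem -/

theorem mainTheorem7 (N : ℕ) (hN : 0 < N) (q : ℂˣ) (hq : IsPrimitiveRoot q N)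
    (l : ℕ) (hl : l = if Even N then N / 2 else N)
    (ε : ℂ) (hε : ε = if N % 4 = 2 then -1 else 1) :
    Subalgebra.center ℂ (QuantumM05.L q)
        = Algebra.adjoin ℂ
            { z | ∃ (m n : ℕ) (c : ZMod 5), z = QuantumM05.basisElt q (l * m) (l * n) c } ∧
      ∃ φ : Subalgebra.center ℂ (QuantumM05.L q) ≃ₐ[ℂ] QuantumM05.regularFunctions ⊤,
        (∀ (m n : ℕ) (c : ZMod 5), ∃ z : Subalgebra.center ℂ (QuantumM05.L q),
          (z : QuantumM05.L q) = QuantumM05.basisElt q (l * m) (l * n) c ∧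
          ∀ x : QuantumM05.Config,
            (φ z).1 ⟨QuantumM05.ModuliSpace.mk x, trivial⟩
              = ε ^ (m + n + m * n) * QuantumM05.classicalX m n c x) ∧
        QuantumM05.IdentifiesSpectrum φ.toAlgHom ∧
        QuantumM05.IsSheafOfAzumayaAlgebras φ.toAlgHom (QuantumM05.L q) := by
  obtain ⟨hl0, hq2, h1, hεε, hqll⟩ :=
    QuantumM05.primitiveRoot_signs hN (IsPrimitiveRoot.coe_units_iff.2 hq) hl hε
  have hw := QuantumM05.presentedByPentagon_centralGen hl0 hq2 h1 hεε
  refine ⟨QuantumM05.center_eq_adjoin hl0 hq2, hw.equivRegular, fun m n c =>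
    ⟨_, QuantumM05.coe_smul_centralGen_pow hl0 hq2 hεε hqll m n c, fun x => ?_⟩,
    hw.identifiesSpectrum,
    (QuantumM05.hasTraces_L hl0 hq2 h1 hεε).isSheafOfAzumayaAlgebras _⟩
  rw [hw.equivRegular_apply, map_smul, map_mul, map_pow, map_pow, hw.ev_gen, hw.ev_gen,
    QuantumM05.ModuliSpace.cross_mk, QuantumM05.classicalX_eq_cross, smul_eq_mul]
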